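/- **Setting.** A *Lorentzian pre-length space* $(X,d,\ll,\le,\tau)$ is a metric space $(X,d)$ with a preorder $\le$, a transitive relation $\ll$ contained in $\le$, and a lower semicontinuous map $\tau:X\times X\to[0,\infty]$ with $\tau(x,z)\ge\tau(x,y)+\tau(y,z)$ for $x\le y\le z$, $\tau(x,y)=0$ if $x\not\le y$, and $\tau(x,y)>0\iff x\ll y$. A non-constant locally Lipschitz curve $\gamma:J\to X$ on an interval is (future-directed) *causal* (*timelike*) if $\gamma(s)\le\gamma(t)$ ($\gamma(s)\ll\gamma(t)$) whenever $s<t$. Its length on $[a,b]$ is $L_\tau(\gamma)=\inf\sum_i\tau(\gamma(t_i),\gamma(t_{i+1}))$ over all partitions $a=t_0<\dots<t_N=b$ (on other intervals: the supremum over compact subintervals); $\gamma$ is *maximal* if $L_\tau(\gamma)=\tau(\gamma(a),\gamma(b))$. It is a *Lorentzian length space* if (1) every point has a neighbourhood $U$ with $\le$ closed in $\bar U\times\bar U$; (2) $x\ll y$ (resp. $x\le y$, $x\neq y$) implies that there is a timelike (resp. causal) curve from $x$ to $y$; (3) every point has an open neighbourhood $\Omega$ such that the $d$-lengths of causal curves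 in $\Omega$ are uniformly bounded, every $y\in\Omega$ has points $z,z'\in\Omega$ with $z\ll y\ll z'$, and there is a continuous $\omega:\Omega\times\Omega\to[0,\infty)$ making $\Omega$ with the restricted $d,\ll,\le$ a Lorentzian pre-length space, such that any $p\le q$, $p\ne q$, in $\Omega$ are joined by a causal curve in $\Omega$ of maximal length among causal curves from $p$ to $q$ in $\Omega$, with length $\omega(p,q)\le\tau(p,q)$; (4) $\tau(x,y)=\sup L_\tau(\gamma)$ over causal curves $\gamma$ from $x$ to $y$ ($0$ if there are none). $(\tilde X,\tilde d,\tilde\ll,\tilde\le,\tilde\tau)$ is an *extension* of $(X,d,\ll,\le,\tau)$ if $\tilde X$ is connected and there is a distance-preserving map $\iota:X\to\tilde X$ with proper open image, preserving $\le$ and $\ll$, such that a curve $\gamma$ in $X$ is timelike (causal) iff $\iota\circ\gamma$ is, and $L_\tau(\gamma)=L_{\tilde\tau}(\iota\circ\gamma)$ for causal $\gamma$. For $K\in\mathbb R$ let $M_K$ be the simply connected two-dimensional Lorentzian model space of constant curvature $K$ (universal cover of de Sitter space, Minkowski plane, universal cover of anti-de Sitter space for $K>0$, $=0$, $<0$),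 with time separation $\bar\tau$. The space $X$ has *causal curvature bounded above (below)* by $K$ if every point has a neighbourhood $U$ such that: (i) $\tau|_{U\times U}$ is finite and continuous; (ii) if $x\le y$, $x\neq y$, in $U$ there is a causal curve in $U$ from $x$ to $y$ of length $\tau(x,y)$; (iii) for every $x\ll y\le z$ or $x\le y\ll z$ with sides realized by maximal causal curves in $U$ (or constant curves, if trivial) whose side lengths $a=\tau(x,y)$, $b=\tau(y,z)$, $c=\tau(x,z)$ satisfy the size bounds ($c<\pi/\sqrt K$ if $c=a+b$ and $K>0$; $c<\pi/\sqrt{-K}$ if $c\ne a+b$ and $K<0$), for every triangle $\bar x\bar y\bar z$ in $M_K$ with the same side lengths and sides realized by maximal causal curves (or constant curves, if trivial), and for all points $p,q$ on timelike sides of $xyz$ (sides with $\ll$-related end points) with corresponding points $\bar p,\bar q$ (a point of a side corresponds to one of the corresponding side if their time separations from the initial vertices agree), one has $\tau(p,q)\ge\bar\tau(\bar p,\bar q)$ (respectively $\le$). A *causal curvature singularity* means that the causal curvature is unbounded, i.e. is not bounded above by any $K\in\mathbb R$ or is not bounded below by any $K\in\mathbb R$. **Corollary 5.6.** Let $(M,g)$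 be a smooth, strongly causal, timelike geodesically complete spacetime (a connected, time-oriented smooth Lorentzian manifold), let $h$ be any smooth Riemannian metric on $M$ with distance $d^h$, and let $(M,d^h,\ll,\le,\tau)$ be the induced Lorentzian length space ($\ll$, $\le$ the chronological and causal relation of $(M,g)$, $\tau$ the supremum of the $g$-lengths of future-directed causal curves). If a Lorentzian length space $\tilde X$ is an extension of $(M,d^h,\ll,\le,\tau)$, then $\tilde X$ has a causal curvature singularity; specifically, there is no $K\in\mathbb R$ such that $\tilde X$ has causal curvature bounded above by $K$. -/

import Mathlib

open Set Filter Topology MeasureTheory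
open scoped ENNReal NNReal Manifold ContDiff Bundle

noncomputable section

/-! ## Lorentzian pre-length spaces and Lorentzian length spaces -/

/-- The raw data `(≪, ≤, τ)` carried by a Lorentzian pre-length space. The laws are the predicate
`CausalData.IsLorentzianPreLengthSpace`; the metric `d` is the `MetricSpace` instance of `X`. -/
structure CausalData (X : Type*) where
  /-- the timelike relation `x ≪ y` -/
  ll : X → X → Prop
  /-- the causal relation `x ≤ y` -/
  le : X → X → Prop
  /-- the time separation function -/
  τ : X → X → ℝ≥0∞

namespace CausalData

variable {X : Type*} [MetricSpace X] (S : CausalData X)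

/-- `(X, d, ≪, ≤, τ)` is a Lorentzian pre-length space. -/
structure IsLorentzianPreLengthSpace : Prop where
  le_refl : ∀ x, S.le x x
  le_trans : ∀ x y z, S.le x y → S.le y z → S.le x z
  ll_trans : ∀ x y z, S.ll x y → S.ll y z → S.ll x z
  le_of_ll : ∀ x y, S.ll x y → S.le x y
  lowerSemicontinuous : LowerSemicontinuous fun p : X × X => S.τ p.1 p.2
  reverse_triangle : ∀ x y z, S.le x y → S.le y z → S.τ x y + S.τ y z ≤ S.τ x z
  tau_eq_zero : ∀ x y, ¬ S.le x y → S.τ x y = 0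
  tau_pos_iff : ∀ x y, 0 < S.τ x y ↔ S.ll x y

/-- The restriction of `γ` to the interval `J` is a (future-directed) causal curve: non-constant,
locally Lipschitz, and `γ s ≤ γ t` for `s < t`. Curves are functions on all of `ℝ` of which only
the values on `J` matter. -/
structure IsCausalCurve (γ : ℝ → X) (J : Set ℝ) : Prop where
  ordConnected : J.OrdConnected
  nonconstant : ∃ s ∈ J, ∃ t ∈ J, γ s ≠ γ t
  locallyLipschitz : LocallyLipschitzOn J γ
  le : ∀ s ∈ J, ∀ t ∈ J, s < t → S.le (γ s) (γ t)

/-- The restriction of `γ` to the interval `J` is a (future-directed) timelike curve. -/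
structure IsTimelikeCurve (γ : ℝ → X) (J : Set ℝ) : Prop where
  ordConnected : J.OrdConnected
  nonconstant : ∃ s ∈ J, ∃ t ∈ J, γ s ≠ γ t
  locallyLipschitz : LocallyLipschitzOn J γ
  ll : ∀ s ∈ J, ∀ t ∈ J, s < t → S.ll (γ s) (γ t)

/-- The `τ`-length of `γ` on `[a, b]`: the infimum of `∑ τ (γ tᵢ) (γ tᵢ₊₁)` over all partitions
`a = t₀ < t₁ < ⋯ < t_N = b`. (A finite partition is the initial part of a strictly increasing
sequence.) -/
def length (γ : ℝ → X) (a b : ℝ) : ℝ≥0∞ :=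
  ⨅ (N : ℕ) (t : ℕ → ℝ) (_ : StrictMono t ∧ t 0 = a ∧ t N = b),
    ∑ i ∈ Finset.range N, S.τ (γ (t i)) (γ (t (i + 1)))

/-- `γ`, restricted to `[0, 1]`, is a future-directed causal curve from `x` to `y`. (A curve on any
`[a, b]` can be reparametrised affinely to `[0, 1]`.) -/
def CausalFromTo (γ : ℝ → X) (x y : X) : Prop :=
  S.IsCausalCurve γ (Icc 0 1) ∧ γ 0 = x ∧ γ 1 = y

/-- `γ`, restricted to `[0, 1]`, is a future-directed timelike curve from `x` to `y`. -/
def TimelikeFromTo (γ : ℝ → X) (x y : X) : Prop :=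
  S.IsTimelikeCurve γ (Icc 0 1) ∧ γ 0 = x ∧ γ 1 = y

/-- Causal path connectedness. -/
def IsCausallyPathConnected : Prop :=
  (∀ x y, S.ll x y → ∃ γ, S.TimelikeFromTo γ x y) ∧
  (∀ x y, S.le x y → x ≠ y → ∃ γ, S.CausalFromTo γ x y)

/-- Every point has a neighbourhood `U` such that `≤` is closed in `closure U × closure U`. -/
def IsLocallyCausallyClosed : Prop :=
  ∀ x, ∃ U ∈ 𝓝 x, IsClosed {p : X × X | p.1 ∈ closure U ∧ p.2 ∈ closure U ∧ S.le p.1 p.2}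

/-- The structure on a subset `Ω` with the restricted relations and a (finite) local time
separation function `ρ`. -/
def restrict (Ω : Set X) (ρ : Ω → Ω → ℝ≥0) : CausalData Ω where
  ll p q := S.ll p q
  le p q := S.le p q
  τ p q := ρ p q

/-- `Ω` is a localising neighbourhood (of each of its points). -/
structure IsLocalising (Ω : Set X) : Prop where
  isOpen : IsOpen Ω
  /-- the `d`-length of all causal curves contained in `Ω` is uniformly bounded -/
  length_bounded : ∃ C : ℝ≥0, ∀ (γ : ℝ → X) (J : Set ℝ), S.IsCausalCurve γ J → MapsTo γ J Ω →
    eVariationOn γ J ≤ C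
  nonempty_future : ∀ y ∈ Ω, ∃ z ∈ Ω, S.ll y z
  nonempty_past : ∀ y ∈ Ω, ∃ z ∈ Ω, S.ll z y
  /-- there is a continuous finite local time separation function which is realized by causal
  curves that are maximal in `Ω` -/
  exists_local : ∃ ρ : Ω → Ω → ℝ≥0, Continuous (fun p : Ω × Ω => ρ p.1 p.2) ∧
    (S.restrict Ω ρ).IsLorentzianPreLengthSpace ∧
    ∀ p q : Ω, S.le p q → p ≠ q → ∃ γ, S.CausalFromTo γ p q ∧ MapsTo γ (Icc 0 1) Ω ∧
      (∀ γ', S.CausalFromTo γ' p q → MapsTo γ' (Icc 0 1) Ω →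
        S.length γ' 0 1 ≤ S.length γ 0 1) ∧
      S.length γ 0 1 = ρ p q ∧ (ρ p q : ℝ≥0∞) ≤ S.τ p q

/-- Every point has a localising neighbourhood. -/
def IsLocalisable : Prop := ∀ x, ∃ Ω, x ∈ Ω ∧ S.IsLocalising Ω

/-- The supremum of the lengths of all future-directed causal curves from `x` to `y`
(zero if there are none). -/
def supLength (x y : X) : ℝ≥0∞ :=
  ⨆ (γ : ℝ → X) (_ : S.CausalFromTo γ x y), S.length γ 0 1

/-- `(X, d, ≪, ≤, τ)` is a Lorentzian length space. -/
structure IsLorentzianLengthSpace : Prop where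
  isLorentzianPreLengthSpace : S.IsLorentzianPreLengthSpace
  isLocallyCausallyClosed : S.IsLocallyCausallyClosed
  isCausallyPathConnected : S.IsCausallyPathConnected
  isLocalisable : S.IsLocalisable
  tau_eq : ∀ x y, S.τ x y = S.supLength x y

/-! ## Extensions -/

/-- `(Y, S')` is an extension of `(X, S)`. Preservation of `τ`-lengths is stated for compact
parameter intervals; on other intervals the length of a curve is the supremum of the lengths of
its compact pieces, so that it is preserved as well. -/
def IsExtension (S : CausalData X) {Y : Type*} [MetricSpace Y] (S' : CausalData Y) : Prop :=
  ConnectedSpace Y ∧ ∃ ι : X → Y, Isometry ι ∧ IsOpen (range ι) ∧ range ι ≠ univ ∧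
    (∀ x y, S.le x y → S'.le (ι x) (ι y)) ∧
    (∀ x y, S.ll x y → S'.ll (ι x) (ι y)) ∧
    (∀ (γ : ℝ → X) (J : Set ℝ), S.IsTimelikeCurve γ J ↔ S'.IsTimelikeCurve (ι ∘ γ) J) ∧
    (∀ (γ : ℝ → X) (J : Set ℝ), S.IsCausalCurve γ J ↔ S'.IsCausalCurve (ι ∘ γ) J) ∧
    (∀ (γ : ℝ → X) (a b : ℝ), a < b → S.IsCausalCurve γ (Icc a b) →
      S.length γ a b = S'.length (ι ∘ γ) a b)

end CausalData

/-! ## Spacetimes and the structure they induce -/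

/-- A smooth Lorentzian metric of signature `(-, +, …, +)` on the smooth `n`-manifold `M` together
with a time orientation, given by a continuous timelike vector field. (Connectedness and the
separation axioms of a spacetime are hypotheses on `M`.) -/
structure SpacetimeMetric (n : ℕ) (M : Type*) [TopologicalSpace M]
    [ChartedSpace (EuclideanSpace ℝ (Fin n)) M] [IsManifold (𝓡 n) ∞ M] where
  /-- the metric tensor -/
  metric (x : M) : TangentSpace (𝓡 n) x →L[ℝ] TangentSpace (𝓡 n) x →L[ℝ] ℝ
  /-- the time-orienting vector field -/
  timeField (x : M) : TangentSpace (𝓡 n) x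
  symm : ∀ x v w, metric x v w = metric x w v
  smooth : ContMDiff (𝓡 n)
    ((𝓡 n).prod 𝓘(ℝ, EuclideanSpace ℝ (Fin n) →L[ℝ] EuclideanSpace ℝ (Fin n) →L[ℝ] ℝ)) ∞
    (fun x => Bundle.TotalSpace.mk'
      (EuclideanSpace ℝ (Fin n) →L[ℝ] EuclideanSpace ℝ (Fin n) →L[ℝ] ℝ)
      (E := fun x : M => TangentSpace (𝓡 n) x →L[ℝ] TangentSpace (𝓡 n) x →L[ℝ] ℝ) x (metric x))
  continuous_timeField : Continuous
    (fun x => (⟨x, timeField x⟩ : TangentBundle (𝓡 n) M))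
  timelike_timeField : ∀ x, metric x (timeField x) (timeField x) < 0
  /-- the metric is positive definite on the orthogonal complement of the time-orienting field -/
  posDef_orthogonal : ∀ x w, metric x (timeField x) w = 0 → w ≠ 0 → 0 < metric x w w

namespace SpacetimeMetric

variable {n : ℕ} {M : Type*} [TopologicalSpace M]
  [ChartedSpace (EuclideanSpace ℝ (Fin n)) M] [IsManifold (𝓡 n) ∞ M] (g : SpacetimeMetric n M)

/-- Future-directed causal tangent vectors (automatically nonzero). -/
def FutureCausal (x : M) (v : TangentSpace (𝓡 n) x) : Prop :=
  g.metric x v v ≤ 0 ∧ g.metric x (g.timeField x) v < 0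

/-- Future-directed timelike tangent vectors. -/
def FutureTimelike (x : M) (v : TangentSpace (𝓡 n) x) : Prop :=
  g.metric x v v < 0 ∧ g.metric x (g.timeField x) v < 0

/-- The velocity of a curve at an interior parameter. -/
def velocity (γ : ℝ → M) (t : ℝ) : TangentSpace (𝓡 n) (γ t) :=
  mfderiv 𝓘(ℝ, ℝ) (𝓡 n) γ t (1 : ℝ)

/-- The velocity of a curve on `[a, b]` (one-sided at the end points). -/
def velocityWithin (γ : ℝ → M) (a b t : ℝ) : TangentSpace (𝓡 n) (γ t) :=
  mfderivWithin 𝓘(ℝ, ℝ) (𝓡 n) γ (Icc a b) t (1 : ℝ)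

/-- `γ` is a piecewise `C¹` curve on `[a, b]`, `a < b`, all of whose (one-sided) velocities
satisfy `P`. -/
def IsPiecewiseC1With (P : ∀ x : M, TangentSpace (𝓡 n) x → Prop) (γ : ℝ → M) (a b : ℝ) : Prop :=
  a < b ∧ ∃ (N : ℕ) (t : ℕ → ℝ), StrictMono t ∧ t 0 = a ∧ t N = b ∧ ∀ i < N,
    ContMDiffOn 𝓘(ℝ, ℝ) (𝓡 n) 1 γ (Icc (t i) (t (i + 1))) ∧
    ∀ s ∈ Icc (t i) (t (i + 1)), P (γ s) (velocityWithin γ (t i) (t (i + 1)) s)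

/-- `γ` is a future-directed causal curve on `[a, b]` from `x` to `y`. -/
def CausalCurve (γ : ℝ → M) (a b : ℝ) (x y : M) : Prop :=
  IsPiecewiseC1With g.FutureCausal γ a b ∧ γ a = x ∧ γ b = y

/-- `γ` is a future-directed timelike curve on `[a, b]` from `x` to `y`. -/
def TimelikeCurve (γ : ℝ → M) (a b : ℝ) (x y : M) : Prop :=
  IsPiecewiseC1With g.FutureTimelike γ a b ∧ γ a = x ∧ γ b = y

/-- The Lorentzian length `∫ √(-g(γ', γ'))` of a causal curve on `[a, b]`. (The finitely many
break points form a null set.) -/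
def curveLength (γ : ℝ → M) (a b : ℝ) : ℝ≥0∞ :=
  ∫⁻ t in Icc a b, ENNReal.ofReal √(-g.metric (γ t) (velocity γ t) (velocity γ t))

/-- The chronological relation, the causal relation and the time separation function of the
spacetime. -/
def causalData : CausalData M where
  ll x y := ∃ γ a b, g.TimelikeCurve γ a b x y
  le x y := x = y ∨ ∃ γ a b, g.CausalCurve γ a b x y
  τ x y := ⨆ (γ : ℝ → M) (a : ℝ) (b : ℝ) (_ : g.CausalCurve γ a b x y), g.curveLength γ a b

/-- Strong causality: every neighbourhood `U` of a point contains a neighbourhood `V` such that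
all causal curves with end points in `V` are contained in `U`. -/
def IsStronglyCausal : Prop :=
  ∀ x : M, ∀ U ∈ 𝓝 x, ∃ V ∈ 𝓝 x, V ⊆ U ∧ ∀ (γ : ℝ → M) (a b : ℝ) (p q : M), p ∈ V → q ∈ V →
    g.CausalCurve γ a b p q → MapsTo γ (Icc a b) U

/-- The coordinate expression of the metric in the chart around `x₀`. -/
def chartMetric (x₀ : M) (y v w : EuclideanSpace ℝ (Fin n)) : ℝ :=
  letI : ChartedSpace (EuclideanSpace ℝ (Fin n)) (EuclideanSpace ℝ (Fin n)) := chartedSpaceSelf _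
  g.metric ((extChartAt (𝓡 n) x₀).symm y)
    (mfderiv (𝓡 n) (𝓡 n) (extChartAt (𝓡 n) x₀).symm y v)
    (mfderiv (𝓡 n) (𝓡 n) (extChartAt (𝓡 n) x₀).symm y w)

/-- The Christoffel symbols of the first kind of the Levi-Civita connection in the chart around
`x₀`, as a trilinear expression:
`½ (∂ᵤ g(v, w) + ∂ᵥ g(u, w) - ∂_w g(u, v))`, i.e. `g(∇ᵤ v, w)` for constant coordinate fields. -/
def christoffel (x₀ : M) (y u v w : EuclideanSpace ℝ (Fin n)) : ℝ :=
  (fderiv ℝ (fun z => g.chartMetric x₀ z v w) y u + fderiv ℝ (fun z => g.chartMetric x₀ z u w) y v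
    - fderiv ℝ (fun z => g.chartMetric x₀ z u v) y w) / 2

/-- `γ` is an (affinely parametrised) geodesic on the open set `J ⊆ ℝ`: it is smooth and satisfies
the geodesic equation `g(c'', w) + Γ(c', c', w) = 0` for all `w` in every chart, `c` being the
coordinate expression of `γ`. -/
def IsGeodesicOn (γ : ℝ → M) (J : Set ℝ) : Prop :=
  IsOpen J ∧ ContMDiffOn 𝓘(ℝ, ℝ) (𝓡 n) ∞ γ J ∧
  ∀ t ∈ J, ∀ x₀ : M, γ t ∈ (extChartAt (𝓡 n) x₀).source → ∀ w : EuclideanSpace ℝ (Fin n),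
    let c : ℝ → EuclideanSpace ℝ (Fin n) := fun s => extChartAt (𝓡 n) x₀ (γ s)
    g.chartMetric x₀ (c t) (deriv (deriv c) t) w
      + g.christoffel x₀ (c t) (deriv c t) (deriv c t) w = 0

/-- Timelike geodesic completeness: every timelike geodesic defined on an open interval extends to
a geodesic defined on all of `ℝ`. -/
def IsTimelikeGeodesicallyComplete : Prop :=
  ∀ (γ : ℝ → M) (J : Set ℝ), J.OrdConnected → J.Nonempty → g.IsGeodesicOn γ J →
    (∀ t ∈ J, g.metric (γ t) (velocity γ t) (velocity γ t) < 0) →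
    ∃ γ' : ℝ → M, g.IsGeodesicOn γ' univ ∧ EqOn γ' γ J

end SpacetimeMetric

/-! ## The model spaces of constant curvature -/

/-- The coordinate form `-α dt² + β dx²` on `ℝ²`, with coordinates `(t, x) = (v 0, v 1)`. -/
def diagForm (α β : ℝ) :
    EuclideanSpace ℝ (Fin 2) →L[ℝ] EuclideanSpace ℝ (Fin 2) →L[ℝ] ℝ :=
  let coord (i : Fin 2) : EuclideanSpace ℝ (Fin 2) →L[ℝ] ℝ := EuclideanSpace.proj i
  (-α) • (coord 0).smulRight (coord 0) + β • (coord 1).smulRight (coord 1)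

lemma diagForm_apply (α β : ℝ) (v w : EuclideanSpace ℝ (Fin 2)) :
    diagForm α β v w = -α * (v 0 * w 0) + β * (v 1 * w 1) := by
  simp [diagForm]

/-- The metric of the model space of constant curvature `K` in global coordinates `(t, x)` on
`ℝ²`, with `r = |K|^(-1/2)`:
`-dt² + cosh²(t/r) dx²` for `K > 0` (the universal cover of de Sitter space of radius `r`),
`-dt² + dx²` for `K = 0` (Minkowski space), and
`-cosh²(x/r) dt² + dx²` for `K < 0` (the universal cover of anti-de Sitter space). -/
def modelForm (K : ℝ) (y : EuclideanSpace ℝ (Fin 2)) :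
    EuclideanSpace ℝ (Fin 2) →L[ℝ] EuclideanSpace ℝ (Fin 2) →L[ℝ] ℝ :=
  diagForm (Real.cosh (√(max (-K) 0) * y 1) ^ 2) (Real.cosh (√(max K 0) * y 0) ^ 2)

lemma modelForm_apply (K : ℝ) (y v w : EuclideanSpace ℝ (Fin 2)) :
    modelForm K y v w = -Real.cosh (√(max (-K) 0) * y 1) ^ 2 * (v 0 * w 0)
      + Real.cosh (√(max K 0) * y 0) ^ 2 * (v 1 * w 1) :=
  diagForm_apply _ _ v w

lemma contDiff_modelForm (K : ℝ) : ContDiff ℝ ∞ (modelForm K) := by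
  have h (i : Fin 2) : ContDiff ℝ ∞ (fun y : EuclideanSpace ℝ (Fin 2) => y i) := by fun_prop
  have h1 (a : ℝ) (i : Fin 2) : ContDiff ℝ ∞
      (fun y : EuclideanSpace ℝ (Fin 2) => Real.cosh (a * y i) ^ 2) :=
    (Real.contDiff_cosh.comp (contDiff_const.mul (h i))).pow 2
  rw [contDiff_clm_apply_iff]
  intro v
  rw [contDiff_clm_apply_iff]
  intro w
  simp only [modelForm_apply]
  exact ((h1 _ 1).neg.mul contDiff_const).add ((h1 _ 0).mul contDiff_const)

lemma modelForm_symm (K : ℝ) (y v w : EuclideanSpace ℝ (Fin 2)) :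
    modelForm K y v w = modelForm K y w v := by
  simp only [modelForm_apply]
  ring

lemma modelForm_timelike (K : ℝ) (y : EuclideanSpace ℝ (Fin 2)) :
    modelForm K y (EuclideanSpace.single 0 1) (EuclideanSpace.single 0 1) < 0 := by
  have hc := Real.cosh_pos (√(max (-K) 0) * y 1)
  rw [modelForm_apply]
  simp
  positivity

lemma modelForm_pos (K : ℝ) (y w : EuclideanSpace ℝ (Fin 2))
    (h : modelForm K y (EuclideanSpace.single 0 1) w = 0) (hw : w ≠ 0) :
    0 < modelForm K y w w := by
  rw [modelForm_apply] at *
  have hc := Real.cosh_pos (√(max (-K) 0) * y 1)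
  have hc' := Real.cosh_pos (√(max K 0) * y 0)
  have h0 : w 0 = 0 := by simpa [hc.ne'] using h
  have h1 : w 1 ≠ 0 := by
    intro h1
    apply hw
    ext i
    fin_cases i
    · exact h0
    · exact h1
  rw [h0]
  have : 0 < w 1 * w 1 := mul_self_pos.2 h1
  simp only [mul_zero, zero_add]
  positivity

/-- The two-dimensional model spacetime of constant curvature `K`, time oriented by `∂_t`. -/
def modelSpacetime (K : ℝ) :
    @SpacetimeMetric 2 (EuclideanSpace ℝ (Fin 2)) _ (chartedSpaceSelf _) inferInstance where
  metric y := modelForm K y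
  timeField _ := (EuclideanSpace.single 0 1 : EuclideanSpace ℝ (Fin 2))
  symm := modelForm_symm K
  smooth := by
    let _ : ChartedSpace (EuclideanSpace ℝ (Fin 2)) (EuclideanSpace ℝ (Fin 2)) := chartedSpaceSelf _
    intro y
    refine (Bundle.contMDiffAt_section _).2 ?_
    have h : ContMDiff (𝓡 2)
        𝓘(ℝ, EuclideanSpace ℝ (Fin 2) →L[ℝ] EuclideanSpace ℝ (Fin 2) →L[ℝ] ℝ) ∞
        (modelForm K) := (contDiff_modelForm K).contMDiff
    refine h.contMDiffAt.congr_of_eventuallyEq (Eventually.of_forall fun x => ?_)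
    change (trivializationAt _ _ y _).2 = modelForm K x
    rw [hom_trivializationAt_apply]
    ext v w
    refine (inCoordinates_apply_eq₂ (F₁ := EuclideanSpace ℝ (Fin 2)) (F₂ := EuclideanSpace ℝ (Fin 2))
      (F₃ := ℝ) (E₃ := fun _ : EuclideanSpace ℝ (Fin 2) => ℝ) (mem_univ _) (mem_univ _)
      (mem_univ _)).trans ?_
    have e (u : EuclideanSpace ℝ (Fin 2)) : (trivializationAt (EuclideanSpace ℝ (Fin 2))
        (TangentSpace (𝓡 2)) y).symm x u = u := by
      have := TangentBundle.symmL_model_space (𝕜 := ℝ) (b := y) (b' := x)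
        (F := EuclideanSpace ℝ (Fin 2))
      exact (Bundle.Trivialization.symmL_apply (R := ℝ) _ (mem_univ x) u).symm.trans
        (DFunLike.congr_fun this u)
    rw [e, e]
    exact congrFun (congrArg DFunLike.coe (Bundle.Trivial.linearMapAt_trivialization ℝ _ ℝ x)) _
  continuous_timeField := by
    let _ : ChartedSpace (EuclideanSpace ℝ (Fin 2)) (EuclideanSpace ℝ (Fin 2)) := chartedSpaceSelf _
    rw [continuous_iff_continuousAt]
    intro y
    refine (FiberBundle.continuousAt_totalSpace _ _).2 ⟨continuousAt_id, ?_⟩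
    convert! continuousAt_const (y := (EuclideanSpace.single 0 1 : EuclideanSpace ℝ (Fin 2)))
    simp
  timelike_timeField := modelForm_timelike K
  posDef_orthogonal := modelForm_pos K

/-- The model space `M_K` with its chronological and causal relations and its time separation. -/
def modelSpace (K : ℝ) : CausalData (EuclideanSpace ℝ (Fin 2)) := (modelSpacetime K).causalData

/-! ## Causal curvature bounds -/

/-- `(a, b, c)` satisfies timelike size bounds for `K`. -/
def TimelikeSizeBounds (K a b c : ℝ) : Prop :=
  0 ≤ a ∧ 0 ≤ b ∧ a + b ≤ c ∧
  (c = a + b → 0 < K → c < Real.pi / √K) ∧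
  (c ≠ a + b → K < 0 → c < Real.pi / √(-K))

namespace CausalData

variable {X : Type*} [MetricSpace X] (S : CausalData X)

/-- `σ` (on `[0, 1]`) realizes the side from `x` to `y` of a triangle: it is a maximal causal
curve from `x` to `y`, or constant if `x = y`. -/
def IsSide (σ : ℝ → X) (x y : X) : Prop :=
  (x = y ∧ ∀ t ∈ Icc (0 : ℝ) 1, σ t = x) ∨
  (x ≠ y ∧ S.CausalFromTo σ x y ∧ S.length σ 0 1 = S.τ x y)

/-- `(x, y, z)` is a causal geodesic triangle whose sides `xy`, `yz`, `xz` are realized by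
`α`, `β`, `γ`. -/
def IsTriangle (x y z : X) (α β γ : ℝ → X) : Prop :=
  S.IsSide α x y ∧ S.IsSide β y z ∧ S.IsSide γ x z

/-- `p` lies on the timelike side `σ` from `u` to `v` in `X`, and `p'` is the corresponding point
on the side `σ'` starting at `u'` in the comparison space. -/
def Corresponds {X' : Type*} (S : CausalData X) (S' : CausalData X')
    (u v : X) (σ : ℝ → X) (u' : X') (σ' : ℝ → X') (p : X) (p' : X') : Prop :=
  S.ll u v ∧ p ∈ σ '' Icc 0 1 ∧ p' ∈ σ' '' Icc 0 1 ∧ S.τ u p = S'.τ u' p'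

/-- `U` satisfies the conditions of a comparison neighbourhood with respect to `M_K`, where
`cmp (τ p q) (τ' p' q')` is the inequality required of corresponding points. -/
structure IsComparisonNhd (K : ℝ) (cmp : ℝ≥0∞ → ℝ≥0∞ → Prop) (U : Set X) : Prop where
  finite : ∀ x ∈ U, ∀ y ∈ U, S.τ x y ≠ ⊤
  continuous : ContinuousOn (fun p : X × X => S.τ p.1 p.2) (U ×ˢ U)
  exists_maximal : ∀ x ∈ U, ∀ y ∈ U, S.le x y → x ≠ y →
    ∃ α, S.CausalFromTo α x y ∧ MapsTo α (Icc 0 1) U ∧ S.length α 0 1 = S.τ x y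
  comparison : ∀ (x y z : X) (α β γ : ℝ → X),
    (S.ll x y ∧ S.le y z) ∨ (S.le x y ∧ S.ll y z) →
    S.IsTriangle x y z α β γ →
    MapsTo α (Icc 0 1) U → MapsTo β (Icc 0 1) U → MapsTo γ (Icc 0 1) U →
    TimelikeSizeBounds K (S.τ x y).toReal (S.τ y z).toReal (S.τ x z).toReal →
    ∀ (x' y' z' : EuclideanSpace ℝ (Fin 2)) (α' β' γ' : ℝ → EuclideanSpace ℝ (Fin 2)),
      (modelSpace K).IsTriangle x' y' z' α' β' γ' →
      (modelSpace K).τ x' y' = S.τ x y → (modelSpace K).τ y' z' = S.τ y z →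
      (modelSpace K).τ x' z' = S.τ x z →
      ∀ (p q : X) (p' q' : EuclideanSpace ℝ (Fin 2)),
        (Corresponds S (modelSpace K) x y α x' α' p p' ∨
          Corresponds S (modelSpace K) y z β y' β' p p' ∨
          Corresponds S (modelSpace K) x z γ x' γ' p p') →
        (Corresponds S (modelSpace K) x y α x' α' q q' ∨
          Corresponds S (modelSpace K) y z β y' β' q q' ∨
          Corresponds S (modelSpace K) x z γ x' γ' q q') →
        cmp (S.τ p q) ((modelSpace K).τ p' q')

/-- Causal curvature bounded below by `K`. -/
def CausalCurvatureBoundedBelow (K : ℝ) : Prop :=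
  ∀ x, ∃ U ∈ 𝓝 x, S.IsComparisonNhd K (fun s s' => s ≤ s') U

/-- Causal curvature bounded above by `K`. -/
def CausalCurvatureBoundedAbove (K : ℝ) : Prop :=
  ∀ x, ∃ U ∈ 𝓝 x, S.IsComparisonNhd K (fun s s' => s' ≤ s) U

/-- A causal curvature singularity: the causal curvature is unbounded below or unbounded above,
i.e. it is not bounded below by any `K` or not bounded above by any `K`. -/
def HasCausalCurvatureSingularity : Prop :=
  (∀ K, ¬ S.CausalCurvatureBoundedBelow K) ∨ (∀ K, ¬ S.CausalCurvatureBoundedAbove K)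

end CausalData

end

set_option synthInstance.maxHeartbeats 400000
set_option linter.unusedSectionVars false

/-! Suppose that the causal curvature of the extension is bounded above by `K`. The image of the
spacetime is open by assumption. It turns out to be closed as well, which contradicts connectedness
together with properness.

The central claim is `mem_range_iff_of_ll`: chronologically related points lie both inside or both
outside of the image. Along a timelike curve between them, nearby points share a comparison
neighbourhood and are therefore joined by a maximal curve `σ` of positive length. It is enough that
such a curve cannot cross the boundary of the image (`mem_range_iff_of_isMaximalCurve`).

The curvature bound enters through `IsMaximalCurve.strict`: a maximal curve of positive length has
no null pieces. Suppose that `σ` runs from `p` timelike to `m` and then null to `q ≠ m`. Take `y` on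
a timelike curve from `p` to `q`, close to `q`. Since `τ p m = τ p q`, in the triangle `p, y, q` the
point `m` corresponds to the comparison vertex of `q`, so the bound gives `τ y m ≥ τ y q > 0`.
Letting `y` tend to `q` yields `q ≤ m`. Together with `m ≤ q` this is a closed causal loop, and
traversing it back and forth violates the uniform length bound of a localising neighbourhood
(`IsLocalising.antisymm`). A null piece followed by a timelike one is excluded dually. The bound
speaks only about comparison triangles that exist, so the model spaces must contain triangles with
all small timelike side lengths (`exists_hasSmallTriangles_modelSpace`).

Hence `σ` can be reparametrised continuously by `f s = τ (σ 0) (σ s)`. On a parameter interval on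
which `σ` stays in the image, the pulled back curve has time separation in the spacetime equal to
the difference of parameters: at most that, because an extension does not decrease `τ`, and at least
that, because lengths are preserved. Such a curve is a timelike geodesic (`isGeodesicOn_of_tau_eq`).
Completeness extends it to all of `ℝ`, and by continuity the ends of the piece of `σ` also lie in
the image (`endpoints_mem_range`).

The geodesic statement rests on local Lorentzian geometry. The inverse function theorem applied to
the exponential map gives normal neighbourhoods, and the Gauss lemma shows that radial timelike
geodesics maximise length there. Strong causality confines causal curves to such a neighbourhood, so
`τ` is locally the radial length. If radial lengths along three consecutive points add up, equality
in the reverse Cauchy–Schwarz inequality makes the radial geodesics fit together smoothly. -/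

noncomputable section

/-! ### Differentiable dependence of flows on initial values -/

section ODEDependence

variable {E : Type*} [NormedAddCommGroup E] [NormedSpace ℝ E]

/-- Second order Grönwall estimate: the difference of two solutions of an autonomous ODE is
approximated to second order by the solution of the linearised equation. -/
lemma norm_sub_sub_le_of_linearized {F : E → E} {F' : E → E →L[ℝ] E} {K : ℝ≥0} {C T : ℝ}
    (hC : 0 ≤ C) (hF : LipschitzWith K F) (hF' : ∀ x, ‖F' x‖ ≤ K)
    (hquad : ∀ x y, ‖F y - F x - F' x (y - x)‖ ≤ C * ‖y - x‖ ^ 2)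
    {u v J : ℝ → E} (hu : ContinuousOn u (Icc 0 T)) (hv : ContinuousOn v (Icc 0 T))
    (hJ : ContinuousOn J (Icc 0 T))
    (hu' : ∀ t ∈ Ico 0 T, HasDerivWithinAt u (F (u t)) (Ici t) t)
    (hv' : ∀ t ∈ Ico 0 T, HasDerivWithinAt v (F (v t)) (Ici t) t)
    (hJ' : ∀ t ∈ Ico 0 T, HasDerivWithinAt J (F' (u t) (J t)) (Ici t) t)
    (h0 : J 0 = v 0 - u 0) {t : ℝ} (ht : t ∈ Icc 0 T) :
    ‖v t - u t - J t‖ ≤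
      C * (Real.exp (K * T)) ^ 2 / (K + 1) * Real.exp ((K + 1) * T) * ‖v 0 - u 0‖ ^ 2 := by
  have hdist : ∀ t ∈ Icc 0 T, ‖v t - u t‖ ≤ ‖v 0 - u 0‖ * Real.exp (K * T) := by
    intro t ht
    have := dist_le_of_trajectories_ODE (v := fun _ => F) (K := K) (fun _ => hF) hv hv' hu hu'
      le_rfl t ht
    rw [dist_eq_norm, dist_eq_norm, sub_zero] at this
    refine this.trans ?_
    gcongr
    exact ht.2
  -- The error `v - u - J` solves the linearised equation up to a forcing term that is quadratic in
  -- `v - u`, and `hdist` bounds that term. The rate `K + 1` instead of `K` is nonzero, as the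
  -- closed form of the Grönwall bound requires.
  have key := norm_le_gronwallBound_of_norm_deriv_right_le (f := fun t => v t - u t - J t)
    (f' := fun t => F (v t) - F (u t) - F' (u t) (J t)) (δ := 0) (K := K + 1)
    (ε := C * (‖v 0 - u 0‖ * Real.exp (K * T)) ^ 2) (a := 0) (b := T)
    ((hv.sub hu).sub hJ) (fun t ht => ((hv' t ht).sub (hu' t ht)).sub (hJ' t ht)) (by simp [h0])
    (by
      intro t ht
      have e : F (v t) - F (u t) - F' (u t) (J t)
          = F' (u t) (v t - u t - J t) + (F (v t) - F (u t) - F' (u t) (v t - u t)) := by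
        simp only [map_sub]; abel
      rw [e]
      refine (norm_add_le _ _).trans (add_le_add ?_ ?_)
      · refine ((F' (u t)).le_opNorm _).trans ?_
        gcongr
        exact (hF' _).trans (by simp)
      · refine (hquad _ _).trans ?_
        gcongr
        exact hdist t (Ico_subset_Icc_self ht)) t ht
  refine key.trans ?_
  have hK : (0 : ℝ) < K + 1 := by positivity
  rw [gronwallBound_of_K_ne_0 hK.ne']
  simp only [sub_zero, zero_mul, zero_add]
  have h1 : Real.exp ((K + 1) * t) - 1 ≤ Real.exp ((K + 1) * T) := by
    have : Real.exp ((K + 1) * t) ≤ Real.exp ((K + 1) * T) := by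
      gcongr
      exact ht.2
    linarith
  calc C * (‖v 0 - u 0‖ * Real.exp (K * T)) ^ 2 / (K + 1) * (Real.exp ((K + 1) * t) - 1)
      ≤ C * (‖v 0 - u 0‖ * Real.exp (K * T)) ^ 2 / (K + 1) * Real.exp ((K + 1) * T) := by
        gcongr
    _ = _ := by ring

/-- The derivative of a compactly supported smooth map is Lipschitz. The mean value inequality on
the segment, after subtracting the derivative at `x`, then gives a global second order Taylor
estimate. -/
lemma exists_quadratic_bound {F : E → E} (hF : ContDiff ℝ ∞ F) (hs : HasCompactSupport F) :
    ∃ C : ℝ, 0 ≤ C ∧ ∀ x y, ‖F y - F x - fderiv ℝ F x (y - x)‖ ≤ C * ‖y - x‖ ^ 2 := by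
  obtain ⟨C, hC⟩ := (hF.fderiv_right (m := ∞) (by simp)).lipschitzWith_of_hasCompactSupport
    (hs.fderiv ℝ) (by simp)
  refine ⟨C, C.2, fun x y => ?_⟩
  have := Convex.norm_image_sub_le_of_norm_fderiv_le' (𝕜 := ℝ) (f := F) (φ := fderiv ℝ F x)
    (C := C * ‖y - x‖) (s := segment ℝ x y) (x := x) (y := y)
    (fun z _ => hF.differentiable (by simp) z)
    (fun z hz => by
      have h1 := hC.dist_le_mul z x
      rw [dist_eq_norm, dist_eq_norm] at h1
      refine h1.trans ?_
      gcongr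
      obtain ⟨a, b, ha, hb, hab, rfl⟩ := hz
      have : a • x + b • y - x = b • (y - x) := by
        obtain rfl : a = 1 - b := by linarith
        module
      rw [this, norm_smul, Real.norm_of_nonneg hb]
      exact mul_le_of_le_one_left (norm_nonneg _) (by linarith))
    (convex_segment x y) (left_mem_segment _ _ _) (right_mem_segment _ _ _)
  rw [pow_two, ← mul_assoc]
  exact this

variable [FiniteDimensional ℝ E]

/-- Local flow of a compactly supported vector field, differentiable in the initial value, the
derivative being continuous and a solution of the linearised equation. -/
lemma exists_flow_of_hasCompactSupport {F : E → E} (hF : ContDiff ℝ ∞ F)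
    (hs : HasCompactSupport F) (z₀ : E) :
    ∃ r > (0 : ℝ), ∃ ε > (0 : ℝ), ∃ (φ : E → ℝ → E) (D : E → ℝ → E →L[ℝ] E),
      (∀ z ∈ Metric.ball z₀ r, φ z 0 = z ∧ D z 0 = ContinuousLinearMap.id ℝ E ∧
        ∀ t ∈ Ioo (-ε) ε, HasDerivAt (φ z) (F (φ z t)) t ∧
          HasFDerivAt (fun z => φ z t) (D z t) z ∧
          ∀ h, HasDerivAt (fun t => D z t h) (fderiv ℝ F (φ z t) (D z t h)) t) ∧
      ContinuousOn (fun p : E × ℝ => φ p.1 p.2) (Metric.ball z₀ r ×ˢ Ioo (-ε) ε) ∧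
      ContinuousOn (fun p : E × ℝ => D p.1 p.2) (Metric.ball z₀ r ×ˢ Ioo (-ε) ε) := by
  obtain ⟨C, hC0, hquad⟩ := exists_quadratic_bound hF hs
  obtain ⟨K, hK⟩ := hF.lipschitzWith_of_hasCompactSupport hs (by simp)
  have hF'K : ∀ x, ‖fderiv ℝ F x‖ ≤ K := fun x => norm_fderiv_le_of_lipschitz ℝ hK
  have hdF : ContDiff ℝ ∞ (fderiv ℝ F) := hF.fderiv_right (by simp)
  -- The equation is coupled with its linearisation, so that a single application of Picard–Lindelöf
  -- yields both the flow and the candidate for its derivative, jointly continuous and with a common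
  -- existence time.
  let F₂ : E × E → E × E := fun p => (F p.1, fderiv ℝ F p.1 p.2)
  have hF₂ : ContDiff ℝ ∞ F₂ := (hF.comp contDiff_fst).prodMk
    ((hdF.comp contDiff_fst).clm_apply contDiff_snd)
  obtain ⟨ε, hε, a, r, L, K₂, hr, hpl⟩ := IsPicardLindelof.of_contDiffAt_one
    (x₀ := (z₀, (0 : E))) (hF₂.contDiffAt.of_le (by simp))
  obtain ⟨α, hα, hαc⟩ := (hpl 0).exists_forall_mem_closedBall_eq_hasDerivWithinAt_continuousOn
  simp only [zero_sub, zero_add] at hα hαc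
  have hr' : (0 : ℝ) < r := hr
  have hmem : ∀ z ∈ Metric.ball z₀ r, ∀ h : E, ‖h‖ ≤ r → (z, h) ∈ Metric.closedBall (z₀, (0 : E)) r := by
    intro z hz h hh
    rw [Metric.mem_closedBall, Prod.dist_eq, max_le_iff]
    exact ⟨(Metric.mem_ball.1 hz).le, by simpa using hh⟩
  have hder : ∀ z ∈ Metric.ball z₀ r, ∀ h : E, ‖h‖ ≤ r → ∀ t ∈ Ioo (-ε) ε,
      HasDerivAt (fun t => α ((z, h), t)) (F₂ (α ((z, h), t))) t := fun z hz h hh t ht =>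
    ((hα _ (hmem z hz h hh)).2 t (Ioo_subset_Icc_self ht)).hasDerivAt (Icc_mem_nhds ht.1 ht.2)
  have h00 : (0 : ℝ) ∈ Ioo (-ε) ε := ⟨by linarith, hε⟩
  -- the first component does not depend on `h`
  set φ : E → ℝ → E := fun z t => (α ((z, 0), t)).1 with hφ
  have hφd : ∀ z ∈ Metric.ball z₀ r, ∀ t ∈ Ioo (-ε) ε, HasDerivAt (φ z) (F (φ z t)) t :=
    fun z hz t ht => (hder z hz 0 (by simp) t ht).fst
  have hfst : ∀ z ∈ Metric.ball z₀ r, ∀ h : E, ‖h‖ ≤ r → ∀ t ∈ Ioo (-ε) ε,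
      (α ((z, h), t)).1 = φ z t := by
    intro z hz h hh
    refine ODE_solution_unique_of_mem_Ioo (v := fun _ => F) (s := fun _ => univ) (K := K)
      (fun _ _ => hK.lipschitzOnWith) h00 (fun t ht => ⟨(hder z hz h hh t ht).fst, trivial⟩)
      (fun t ht => ⟨hφd z hz t ht, trivial⟩) ?_
    simp only [hφ, (hα _ (hmem z hz h hh)).1, (hα _ (hmem z hz 0 (by simp))).1]
  -- The linearised solutions are available only for initial vectors of norm at most `r`. The
  -- operator `D z t` is therefore prescribed on a basis scaled down by `s` and extended linearly.
  let b := Module.finBasis ℝ E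
  obtain ⟨s, hs0, hsb⟩ : ∃ s : ℝ, 0 < s ∧ ∀ i, ‖s • b i‖ ≤ r := by
    refine ⟨r / (1 + ∑ i, ‖b i‖), by positivity, fun i => ?_⟩
    have h1 : ‖b i‖ ≤ 1 + ∑ i, ‖b i‖ :=
      (Finset.single_le_sum (f := fun i => ‖b i‖) (fun _ _ => norm_nonneg _)
        (Finset.mem_univ i)).trans (by linarith)
    rw [norm_smul, Real.norm_of_nonneg (by positivity), div_mul_eq_mul_div,
      div_le_iff₀ (by positivity)]
    gcongr
  let cf (i) : E →L[ℝ] ℝ := LinearMap.toContinuousLinearMap (b.coord i)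
  set D : E → ℝ → E →L[ℝ] E := fun z t =>
    ∑ i, (cf i).smulRight (s⁻¹ • (α ((z, s • b i), t)).2) with hD
  have hDa : ∀ z t h, D z t h = ∑ i, b.repr h i • s⁻¹ • (α ((z, s • b i), t)).2 := by
    intro z t h
    simp [hD, cf]
  have hD0 : ∀ z ∈ Metric.ball z₀ r, D z 0 = ContinuousLinearMap.id ℝ E := by
    intro z hz
    ext h
    rw [hDa]
    simp only [(hα _ (hmem z hz _ (hsb _))).1, inv_smul_smul₀ hs0.ne']
    exact b.sum_repr h
  have hDd : ∀ z ∈ Metric.ball z₀ r, ∀ t ∈ Ioo (-ε) ε, ∀ h,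
      HasDerivAt (fun t => D z t h) (fderiv ℝ F (φ z t) (D z t h)) t := by
    intro z hz t ht h
    simp only [hDa, map_sum, map_smul]
    refine HasDerivAt.fun_sum fun i _ => ?_
    have : HasDerivAt (fun t => (α ((z, s • b i), t)).2)
        (fderiv ℝ F (φ z t) (α ((z, s • b i), t)).2) t := by
      rw [← hfst z hz _ (hsb i) t ht]
      exact (hder z hz _ (hsb i) t ht).snd
    exact (this.const_smul (s⁻¹ : ℝ)).const_smul (b.repr h i)
  have hcont0 : ∀ h : E, ‖h‖ ≤ r →
      ContinuousOn (fun p : E × ℝ => α ((p.1, h), p.2)) (Metric.ball z₀ r ×ˢ Ioo (-ε) ε) := by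
    intro h hh
    refine hαc.comp (f := fun p : E × ℝ => ((p.1, h), p.2)) (by fun_prop) ?_
    rintro ⟨z, t⟩ ⟨hz, ht⟩
    exact ⟨hmem z hz h hh, Ioo_subset_Icc_self ht⟩
  have hφ0 : ∀ z ∈ Metric.ball z₀ r, φ z 0 = z := fun z hz => by
    simp only [hφ, (hα _ (hmem z hz 0 (by simp))).1]
  refine ⟨r, hr', ε, hε, φ, D, fun z hz => ⟨hφ0 z hz, hD0 z hz, fun t ht => ⟨hφd z hz t ht, ?_,
    hDd z hz t ht⟩⟩, continuous_fst.comp_continuousOn (hcont0 0 (by simp)), ?_⟩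
  · -- differentiability in the initial value
    obtain ⟨B, hB⟩ : ∃ B : ℝ, ∀ y ∈ Metric.ball z₀ r,
        ‖φ y t - φ z t - D z t (y - z)‖ ≤ B * ‖y - z‖ ^ 2 := by
      refine ⟨C * (Real.exp (K * |t|)) ^ 2 / (K + 1) * Real.exp ((K + 1) * |t|),
        fun y hy => ?_⟩
      rcases le_total 0 t with h0t | h0t
      · have hsub : Icc 0 t ⊆ Ioo (-ε) ε := fun x hx => ⟨by linarith [hx.1], hx.2.trans_lt ht.2⟩
        have := norm_sub_sub_le_of_linearized (F := F) (F' := fderiv ℝ F) (K := K) (T := |t|) hC0 hK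
          hF'K hquad (u := φ z) (v := φ y) (J := fun t => D z t (y - z))
          (by
            rw [abs_of_nonneg h0t]
            exact fun x hx => (hφd z hz x (hsub hx)).continuousAt.continuousWithinAt)
          (by
            rw [abs_of_nonneg h0t]
            exact fun x hx => (hφd y hy x (hsub hx)).continuousAt.continuousWithinAt)
          (by
            rw [abs_of_nonneg h0t]
            exact fun x hx => (hDd z hz x (hsub hx) _).continuousAt.continuousWithinAt)
          (by
            rw [abs_of_nonneg h0t]
            exact fun x hx => (hφd z hz x (hsub (Ico_subset_Icc_self hx))).hasDerivWithinAt)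
          (by
            rw [abs_of_nonneg h0t]
            exact fun x hx => (hφd y hy x (hsub (Ico_subset_Icc_self hx))).hasDerivWithinAt)
          (by
            rw [abs_of_nonneg h0t]
            exact fun x hx => (hDd z hz x (hsub (Ico_subset_Icc_self hx)) _).hasDerivWithinAt)
          (by simp [hφ0 z hz, hφ0 y hy, hD0 z hz]) (t := |t|) ⟨abs_nonneg t, le_rfl⟩
        rw [hφ0 z hz, hφ0 y hy] at this
        rwa [abs_of_nonneg h0t] at this ⊢
      · have hsub : ∀ x ∈ Icc 0 |t|, -x ∈ Ioo (-ε) ε := fun x hx => by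
          rw [abs_of_nonpos h0t] at hx
          exact ⟨by linarith [hx.2, ht.1], by linarith [hx.1]⟩
        have hneg : ∀ {u : ℝ → E} {u' : E} {x : ℝ}, HasDerivAt u u' (-x) →
            HasDerivAt (fun x => u (-x)) (-u') x := by
          intro u u' x h
          have h2 := h.scomp x (hasDerivAt_neg x)
          simp only [neg_smul, one_smul] at h2
          exact h2
        -- Negative times reduce to positive ones by reversing time, which replaces the field by its
        -- negative.
        have := norm_sub_sub_le_of_linearized (F := fun x => -F x) (F' := fun x => -fderiv ℝ F x)
          (K := K) (T := |t|) hC0 hK.neg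
          (by simpa using hF'K) (fun x y => by
            rw [← norm_neg]
            convert! hquad x y using 2
            simp only [neg_apply]
            abel) (u := fun t => φ z (-t)) (v := fun t => φ y (-t))
          (J := fun t => D z (-t) (y - z))
          (fun x hx => (hneg (hφd z hz _ (hsub x hx))).continuousAt.continuousWithinAt)
          (fun x hx => (hneg (hφd y hy _ (hsub x hx))).continuousAt.continuousWithinAt)
          (fun x hx => (hneg (hDd z hz _ (hsub x hx) _)).continuousAt.continuousWithinAt)
          (fun x hx => (hneg (hφd z hz _ (hsub x (Ico_subset_Icc_self hx)))).hasDerivWithinAt)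
          (fun x hx => (hneg (hφd y hy _ (hsub x (Ico_subset_Icc_self hx)))).hasDerivWithinAt)
          (fun x hx => (hneg (hDd z hz _ (hsub x (Ico_subset_Icc_self hx)) _)).hasDerivWithinAt)
          (by simp [hφ0 z hz, hφ0 y hy, hD0 z hz]) (t := |t|) ⟨abs_nonneg t, le_rfl⟩
        simpa only [hφ0 z hz, hφ0 y hy, abs_of_nonpos h0t, neg_neg, neg_zero] using this
    have hO : (fun y => φ y t - φ z t - D z t (y - z)) =O[𝓝 z] fun y => ‖y - z‖ ^ 2 := by
      refine Asymptotics.IsBigO.of_bound B ?_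
      filter_upwards [Metric.isOpen_ball.mem_nhds hz] with y hy
      simpa using hB y hy
    rw [hasFDerivAt_iff_isLittleO]
    refine hO.trans_isLittleO ?_
    exact (Asymptotics.isLittleO_pow_sub_sub z one_lt_two).congr_left (fun _ => rfl)
  · refine continuousOn_finsetSum _ fun i _ => ?_
    have h1 : ContinuousOn (fun p : E × ℝ => s⁻¹ • (α ((p.1, s • b i), p.2)).2)
        (Metric.ball z₀ r ×ˢ Ioo (-ε) ε) :=
      (continuous_snd.comp_continuousOn (hcont0 _ (hsb i))).const_smul _
    exact ((ContinuousLinearMap.smulRightL ℝ E E (cf i)).continuous.comp_continuousOn h1)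

/-- Local flow of a smooth vector field defined on an open set, differentiable in the initial
value. -/
theorem exists_local_flow {F : E → E} {Ω : Set E} (hΩ : IsOpen Ω) (hF : ContDiffOn ℝ ∞ F Ω)
    {z₀ : E} (hz₀ : z₀ ∈ Ω) :
    ∃ r > (0 : ℝ), ∃ ε > (0 : ℝ), ∃ (φ : E → ℝ → E) (D : E → ℝ → E →L[ℝ] E),
      (∀ z ∈ Metric.ball z₀ r, φ z 0 = z ∧ D z 0 = ContinuousLinearMap.id ℝ E ∧
        ∀ t ∈ Ioo (-ε) ε, φ z t ∈ Ω ∧ HasDerivAt (φ z) (F (φ z t)) t ∧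
          HasFDerivAt (fun z => φ z t) (D z t) z ∧
          ∀ h, HasDerivAt (fun t => D z t h) (fderiv ℝ F (φ z t) (D z t h)) t) ∧
      ContinuousOn (fun p : E × ℝ => φ p.1 p.2) (Metric.ball z₀ r ×ˢ Ioo (-ε) ε) ∧
      ContinuousOn (fun p : E × ℝ => D p.1 p.2) (Metric.ball z₀ r ×ˢ Ioo (-ε) ε) := by
  obtain ⟨R, hR, hRΩ⟩ := Metric.isOpen_iff.1 hΩ z₀ hz₀
  let χ : ContDiffBump z₀ := ⟨R / 4, R / 2, by positivity, by linarith⟩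
  have hcl : Metric.closedBall z₀ (R / 2) ⊆ Ω :=
    (Metric.closedBall_subset_ball (by linarith)).trans hRΩ
  -- The cut-off field agrees with `F` on the ball of radius `R / 4` and vanishes outside a compact
  -- subset of `Ω`.
  let F₁ : E → E := fun x => χ x • F x
  have hsupp : Function.support F₁ ⊆ Metric.closedBall z₀ (R / 2) := by
    intro x hx
    have : χ x ≠ 0 := fun h => hx (by simp [F₁, h])
    exact Metric.ball_subset_closedBall (by rw [← χ.support_eq]; exact this)
  have hF₁ : ContDiff ℝ ∞ F₁ := by
    rw [contDiff_iff_contDiffAt]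
    intro x
    by_cases hx : x ∈ Ω
    · exact χ.contDiff.contDiffAt.smul (hF.contDiffAt (hΩ.mem_nhds hx))
    · have : F₁ =ᶠ[𝓝 x] fun _ => 0 := by
        filter_upwards [Metric.isClosed_closedBall.isOpen_compl.mem_nhds
          (fun h => hx (hcl h) : x ∉ Metric.closedBall z₀ (R / 2))] with y hy
        by_contra h
        exact hy (hsupp h)
      exact contDiffAt_const.congr_of_eventuallyEq this
  have hcs : HasCompactSupport F₁ :=
    HasCompactSupport.intro (isCompact_closedBall z₀ (R / 2)) fun x hx => by
      by_contra h
      exact hx (hsupp h)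
  obtain ⟨r, hr, ε, hε, φ, D, h, hφc, hDc⟩ := exists_flow_of_hasCompactSupport hF₁ hcs z₀
  have heq : ∀ x ∈ Metric.ball z₀ (R / 4), F₁ =ᶠ[𝓝 x] F := by
    intro x hx
    filter_upwards [Metric.isOpen_ball.mem_nhds hx] with y hy
    simp [F₁, χ.one_of_mem_closedBall (Metric.ball_subset_closedBall hy)]
  -- By continuity, short orbits starting near `z₀` stay where the cut-off is inactive, so they are
  -- orbits of `F` itself.
  have hnhds : ∀ᶠ p : E × ℝ in 𝓝 (z₀, 0), φ p.1 p.2 ∈ Metric.ball z₀ (R / 4) := by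
    have hmem : Metric.ball z₀ r ×ˢ Ioo (-ε) ε ∈ 𝓝 (z₀, (0 : ℝ)) :=
      prod_mem_nhds (Metric.ball_mem_nhds _ hr) (Ioo_mem_nhds (by linarith) hε)
    refine (hφc.continuousAt hmem).eventually (Metric.isOpen_ball.mem_nhds ?_)
    simp only [(h z₀ (Metric.mem_ball_self hr)).1]
    exact Metric.mem_ball_self (by positivity)
  obtain ⟨δ, hδ, hδs⟩ := Metric.eventually_nhds_iff_ball.1 hnhds
  have hsub : Metric.ball z₀ (min r δ) ×ˢ Ioo (-(min ε δ)) (min ε δ) ⊆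
      Metric.ball z₀ r ×ˢ Ioo (-ε) ε :=
    prod_mono (Metric.ball_subset_ball (min_le_left _ _))
      (Ioo_subset_Ioo (neg_le_neg (min_le_left _ _)) (min_le_left _ _))
  refine ⟨min r δ, by positivity, min ε δ, by positivity, φ, D, fun z hz => ?_, hφc.mono hsub,
    hDc.mono hsub⟩
  obtain ⟨h0, hD0, ht⟩ := h z (Metric.ball_subset_ball (min_le_left _ _) hz)
  refine ⟨h0, hD0, fun t htε => ?_⟩
  obtain ⟨h1, h2, h3⟩ := ht t
    ⟨(neg_le_neg (min_le_left _ _)).trans_lt htε.1, htε.2.trans_le (min_le_left _ _)⟩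
  have hin : φ z t ∈ Metric.ball z₀ (R / 4) := by
    refine hδs (z, t) ?_
    rw [Metric.mem_ball, Prod.dist_eq, max_lt_iff]
    refine ⟨(Metric.mem_ball.1 hz).trans_le (min_le_right _ _), ?_⟩
    rw [Real.dist_eq, sub_zero, abs_lt]
    exact ⟨(neg_le_neg (min_le_right _ _)).trans_lt htε.1, htε.2.trans_le (min_le_right _ _)⟩
  refine ⟨hRΩ (Metric.ball_subset_ball (by linarith) hin), ?_, h2, fun k => ?_⟩
  · rwa [(heq _ hin).eq_of_nhds] at h1
  · have := h3 k
    rwa [(heq _ hin).fderiv_eq] at this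

end ODEDependence

/-! ### Instance shortcuts for spaces of multilinear forms -/

section Shortcuts

instance realSMulCommClass : SMulCommClass ℝ ℝ ℝ := Algebra.to_smulCommClass

variable {E : Type*} [NormedAddCommGroup E] [NormedSpace ℝ E]

instance dualNormedAddCommGroup : NormedAddCommGroup (E →L[ℝ] ℝ) :=
  ContinuousLinearMap.toNormedAddCommGroup
instance dualNormedSpace : NormedSpace ℝ (E →L[ℝ] ℝ) := ContinuousLinearMap.toNormedSpace
instance bilinNormedAddCommGroup : NormedAddCommGroup (E →L[ℝ] E →L[ℝ] ℝ) :=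
  ContinuousLinearMap.toNormedAddCommGroup
instance bilinNormedSpace : NormedSpace ℝ (E →L[ℝ] E →L[ℝ] ℝ) := ContinuousLinearMap.toNormedSpace
instance trilinNormedAddCommGroup : NormedAddCommGroup (E →L[ℝ] E →L[ℝ] E →L[ℝ] ℝ) :=
  ContinuousLinearMap.toNormedAddCommGroup
instance trilinNormedSpace : NormedSpace ℝ (E →L[ℝ] E →L[ℝ] E →L[ℝ] ℝ) :=
  ContinuousLinearMap.toNormedSpace

end Shortcuts

/-! ### Linear algebra of Lorentzian forms -/

section LorentzAlgebra

variable {E : Type*} [NormedAddCommGroup E] [NormedSpace ℝ E]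

/-- A symmetric bilinear form of Lorentzian signature, time oriented by the timelike vector `T`. -/
structure IsLorentzForm (B : E →L[ℝ] E →L[ℝ] ℝ) (T : E) : Prop where
  symm : ∀ v w, B v w = B w v
  timelike : B T T < 0
  posDef : ∀ w, B T w = 0 → w ≠ 0 → 0 < B w w

/-- Future-directed causal vectors of a Lorentzian form. -/
def IsFutureCausal (B : E →L[ℝ] E →L[ℝ] ℝ) (T v : E) : Prop := B v v ≤ 0 ∧ B T v < 0

/-- Future-directed timelike vectors of a Lorentzian form. -/
def IsFutureTimelike (B : E →L[ℝ] E →L[ℝ] ℝ) (T v : E) : Prop := B v v < 0 ∧ B T v < 0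

lemma IsFutureTimelike.isFutureCausal {B : E →L[ℝ] E →L[ℝ] ℝ} {T v : E}
    (h : IsFutureTimelike B T v) : IsFutureCausal B T v := ⟨h.1.le, h.2⟩

lemma IsFutureTimelike.smul {B : E →L[ℝ] E →L[ℝ] ℝ} {T v : E}
    (h : IsFutureTimelike B T v) {a : ℝ} (ha : 0 < a) : IsFutureTimelike B T (a • v) := by
  refine ⟨?_, ?_⟩
  · simp only [map_smul, smul_apply, smul_eq_mul]
    have := h.1
    have h2 : 0 < a * a := by positivity
    nlinarith
  · simp only [map_smul, smul_eq_mul]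
    exact mul_neg_of_pos_of_neg ha h.2

namespace IsLorentzForm

variable {B : E →L[ℝ] E →L[ℝ] ℝ} {T : E}

lemma injective (h : IsLorentzForm B T) : Function.Injective B := by
  rw [injective_iff_map_eq_zero]
  intro v hv
  by_contra hne
  have h1 : B T v = 0 := by rw [h.symm, hv]; rfl
  have h2 := h.posDef v h1 hne
  rw [hv] at h2
  exact lt_irrefl _ h2

lemma neg_of_nonpos (h : IsLorentzForm B T) {v : E} (hv : B v v < 0) (hT : B T v ≤ 0) :
    B T v < 0 := by
  refine lt_of_le_of_ne hT fun h0 => ?_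
  have hne : v ≠ 0 := by
    rintro rfl
    simp at hv
  exact (h.posDef v h0 hne).not_gt hv

/-- The combination of `v` and `w` that is orthogonal to `T`. -/
lemma comb_nonneg (h : IsLorentzForm B T) (v w : E) :
    0 ≤ (B T v) ^ 2 * B w w - 2 * (B T v * B T w) * B v w + (B T w) ^ 2 * B v v := by
  set u := B T v • w - B T w • v with hu
  have hTu : B T u = 0 := by simp [hu]; ring
  have h0 : 0 ≤ B u u := by
    by_cases hu0 : u = 0
    · simp [hu0]
    · exact (h.posDef u hTu hu0).le
  have e : B u u = (B T v) ^ 2 * B w w - 2 * (B T v * B T w) * B v w + (B T w) ^ 2 * B v v := by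
    simp only [hu, map_sub, map_smul, sub_apply, smul_apply, smul_eq_mul, h.symm w v]
    ring
  rwa [e] at h0

/-- If `B v w` were nonnegative, every term of `comb_nonneg` would be nonpositive and the one
containing `B v v` negative. -/
lemma inner_neg (h : IsLorentzForm B T) {v w : E} (hv : IsFutureTimelike B T v)
    (hw : IsFutureCausal B T w) : B v w < 0 := by
  have h1 := h.comb_nonneg v w
  have h2 : 0 < B T v * B T w := mul_pos_of_neg_of_neg hv.2 hw.2
  have h3 : (B T v) ^ 2 * B w w ≤ 0 := mul_nonpos_of_nonneg_of_nonpos (sq_nonneg _) hw.1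
  have h4 : (B T w) ^ 2 * B v v < 0 := mul_neg_of_pos_of_neg (sq_pos_of_neg hw.2) hv.1
  by_contra h5
  push Not at h5
  have := mul_nonneg h2.le h5
  linarith

/-- Any timelike vector can play the role of `T`. If `B w w ≤ 0`, then `comb_nonneg` with vanishing
mixed term forces `B T w = 0`, and the assumption on the complement of `T` applies. -/
lemma posDef_of_timelike (h : IsLorentzForm B T) {v w : E} (hv : B v v < 0) (hvw : B v w = 0)
    (hw : w ≠ 0) : 0 < B w w := by
  by_contra hneg
  push Not at hneg
  have h1 := h.comb_nonneg v w
  rw [hvw] at h1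
  have hv0 : v ≠ 0 := by
    rintro rfl
    simp at hv
  have hTw : B T w = 0 := by
    by_contra hne
    have : 0 < (B T w) ^ 2 := by positivity
    have := mul_neg_of_pos_of_neg this hv
    have := mul_nonpos_of_nonneg_of_nonpos (sq_nonneg (B T v)) hneg
    linarith
  exact (h.posDef w hTw hw).not_ge hneg

/-- Reverse Cauchy–Schwarz inequality. -/
lemma mul_le_sq (h : IsLorentzForm B T) {v : E} (hv : B v v < 0) (w : E) :
    B v v * B w w ≤ (B v w) ^ 2 := by
  -- The component of `w` orthogonal to `v` is spacelike or zero.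
  set u := w - (B v w / B v v) • v with hu
  have hvu : B v u = 0 := by
    simp only [hu, map_sub, map_smul, smul_eq_mul]
    field_simp [hv.ne]
    ring
  have h0 : 0 ≤ B u u := by
    by_cases hu0 : u = 0
    · simp [hu0]
    · exact (h.posDef_of_timelike hv hvu hu0).le
  have e : B v v * B u u = B v v * B w w - (B v w) ^ 2 := by
    simp only [hu, map_sub, map_smul, sub_apply, smul_apply, smul_eq_mul, h.symm w v]
    field_simp [hv.ne]
    ring
  have := mul_nonpos_of_nonpos_of_nonneg hv.le h0
  linarith

/-- The equality case of the reverse Cauchy–Schwarz inequality. -/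
lemma eq_smul_of_sq_eq (h : IsLorentzForm B T) {v w : E} (hv : B v v < 0)
    (he : (B v w) ^ 2 = B v v * B w w) : w = (B v w / B v v) • v := by
  set u := w - (B v w / B v v) • v with hu
  have hvu : B v u = 0 := by
    simp only [hu, map_sub, map_smul, smul_eq_mul]
    field_simp [hv.ne]
    ring
  have e : B v v * B u u = B v v * B w w - (B v w) ^ 2 := by
    simp only [hu, map_sub, map_smul, sub_apply, smul_apply, smul_eq_mul, h.symm w v]
    field_simp [hv.ne]
    ring
  by_contra hne
  have hu0 : u ≠ 0 := sub_ne_zero.2 hne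
  have := h.posDef_of_timelike hv hvu hu0
  have := mul_neg_of_neg_of_pos hv this
  linarith

lemma sqrt_mul_sqrt_le (h : IsLorentzForm B T) {v w : E} (hv : IsFutureTimelike B T v)
    (hw : IsFutureCausal B T w) : √(-B v v) * √(-B w w) ≤ -B v w := by
  rw [← Real.sqrt_mul (by linarith [hv.1])]
  refine Real.sqrt_le_iff.2 ⟨by linarith [h.inner_neg hv hw], ?_⟩
  have := h.mul_le_sq hv.1 w
  linarith

end IsLorentzForm

end LorentzAlgebra

/-! ### The geodesic equation of a metric on an open set -/

section Spray

variable {E : Type*} [NormedAddCommGroup E] [NormedSpace ℝ E]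

/-- A smooth time-oriented Lorentzian metric on an open subset of a vector space. -/
structure IsLorentzOn (G : E → E →L[ℝ] E →L[ℝ] ℝ) (T : E → E) (D : Set E) : Prop where
  isOpen : IsOpen D
  smooth : ContDiffOn ℝ ∞ G D
  continuousOn : ContinuousOn T D
  form : ∀ x ∈ D, IsLorentzForm (G x) (T x)

/-- The functional `w ↦ -Γ(v, v, w)`, `Γ` being the Christoffel symbols of the first kind. -/
def geodesicForce (G : E → E →L[ℝ] E →L[ℝ] ℝ) (x v : E) : E →L[ℝ] ℝ :=
  (1 / 2 : ℝ) • ((fderiv ℝ G x).flip v).flip v - fderiv ℝ G x v v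

lemma geodesicForce_apply (G : E → E →L[ℝ] E →L[ℝ] ℝ) (x v w : E) :
    geodesicForce G x v w = 1 / 2 * fderiv ℝ G x w v v - fderiv ℝ G x v v w := by
  simp [geodesicForce]

/-- The acceleration of the geodesic with position `x` and velocity `v`. -/
def geodesicAccel (G : E → E →L[ℝ] E →L[ℝ] ℝ) (x v : E) : E :=
  (G x).inverse (geodesicForce G x v)

/-- Quadratic homogeneity in the velocity is what makes affine reparametrisations of geodesics
geodesics, hence what allows existence time to be traded for speed. -/
lemma geodesicAccel_smul (G : E → E →L[ℝ] E →L[ℝ] ℝ) (x v : E) (s : ℝ) :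
    geodesicAccel G x (s • v) = (s ^ 2) • geodesicAccel G x v := by
  have : geodesicForce G x (s • v) = (s ^ 2) • geodesicForce G x v := by
    ext w
    simp only [geodesicForce_apply, map_smul, smul_apply, smul_eq_mul]
    ring
  rw [geodesicAccel, this, map_smul]
  rfl

variable [FiniteDimensional ℝ E] {G : E → E →L[ℝ] E →L[ℝ] ℝ} {T : E → E} {D : Set E}

/-- A nondegenerate form is injective into the dual space, which has the same finite dimension. On
`D` the operator `inverse` in `geodesicAccel` is therefore the true inverse, and it depends smoothly
on the point. -/
lemma IsLorentzForm.exists_equiv {B : E →L[ℝ] E →L[ℝ] ℝ} {T : E} (h : IsLorentzForm B T) :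
    ∃ e : E ≃L[ℝ] (E →L[ℝ] ℝ), (e : E →L[ℝ] E →L[ℝ] ℝ) = B := by
  have hdim : Module.finrank ℝ E = Module.finrank ℝ (E →L[ℝ] ℝ) := by
    rw [← Subspace.dual_finrank_eq (K := ℝ) (V := E)]
    exact (LinearMap.toContinuousLinearMap (𝕜 := ℝ) (E := E) (F' := ℝ)).finrank_eq
  let e := LinearMap.linearEquivOfInjective (B : E →ₗ[ℝ] E →L[ℝ] ℝ) h.injective hdim
  refine ⟨e.toContinuousLinearEquiv, ?_⟩
  ext v w
  rfl

lemma IsLorentzOn.accel_eq (h : IsLorentzOn G T D) {x : E} (hx : x ∈ D) (v w : E) :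
    G x (geodesicAccel G x v) w = 1 / 2 * fderiv ℝ G x w v v - fderiv ℝ G x v v w := by
  obtain ⟨e, he⟩ := (h.form x hx).exists_equiv
  rw [← geodesicForce_apply, geodesicAccel, ← he, ContinuousLinearMap.inverse_equiv]
  exact DFunLike.congr_fun (e.apply_symm_apply (geodesicForce G x v)) w

lemma IsLorentzOn.contDiffOn_fderiv (h : IsLorentzOn G T D) : ContDiffOn ℝ ∞ (fderiv ℝ G) D :=
  h.smooth.fderiv_of_isOpen h.isOpen (by simp)

lemma IsLorentzOn.contDiffOn_accel (h : IsLorentzOn G T D) :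
    ContDiffOn ℝ ∞ (fun p : E × E => geodesicAccel G p.1 p.2) (D ×ˢ univ) := by
  have hfst : MapsTo (Prod.fst : E × E → E) (D ×ˢ univ) D := fun p hp => hp.1
  have h1 : ContDiffOn ℝ ∞ (fun p : E × E => fderiv ℝ G p.1) (D ×ˢ univ) :=
    h.contDiffOn_fderiv.comp contDiff_fst.contDiffOn hfst
  have hinv : ContDiffOn ℝ ∞ (fun p : E × E => (G p.1).inverse) (D ×ˢ univ) := by
    intro p hp
    obtain ⟨e, he⟩ := (h.form p.1 hp.1).exists_equiv
    have h2 : ContDiffAt ℝ ∞ ContinuousLinearMap.inverse (G p.1) := by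
      rw [← he]
      exact contDiffAt_map_inverse e
    exact h2.comp_contDiffWithinAt p
      ((h.smooth.comp contDiff_fst.contDiffOn hfst) p hp)
  refine hinv.clm_apply ?_
  rw [contDiffOn_clm_apply]
  intro w
  simp only [geodesicForce_apply]
  have h3 : ContDiffOn ℝ ∞ (fun p : E × E => fderiv ℝ G p.1 p.2 p.2 w) (D ×ˢ univ) :=
    ((h1.clm_apply contDiff_snd.contDiffOn).clm_apply contDiff_snd.contDiffOn).clm_apply
      contDiffOn_const
  have h4 : ContDiffOn ℝ ∞ (fun p : E × E => fderiv ℝ G p.1 w p.2 p.2) (D ×ˢ univ) :=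
    ((h1.clm_apply contDiffOn_const).clm_apply contDiff_snd.contDiffOn).clm_apply
      contDiff_snd.contDiffOn
  exact (contDiffOn_const.mul h4).sub h3

/-- The geodesic vector field on the tangent bundle. -/
def geodesicField (G : E → E →L[ℝ] E →L[ℝ] ℝ) (z : E × E) : E × E :=
  (z.2, geodesicAccel G z.1 z.2)

lemma IsLorentzOn.contDiffOn_geodesicField (h : IsLorentzOn G T D) :
    ContDiffOn ℝ ∞ (geodesicField G) (D ×ˢ univ) :=
  contDiff_snd.contDiffOn.prodMk h.contDiffOn_accel

/-- Derivative of `G (c t) (u t) (w t)` along a curve. -/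
lemma IsLorentzOn.hasDerivAt_form (h : IsLorentzOn G T D) {c u w : ℝ → E} {c' u' w' : E} {t : ℝ}
    (hc : HasDerivAt c c' t) (hu : HasDerivAt u u' t) (hw : HasDerivAt w w' t) (hD : c t ∈ D) :
    HasDerivAt (fun t => G (c t) (u t) (w t))
      (fderiv ℝ G (c t) c' (u t) (w t) + G (c t) u' (w t) + G (c t) (u t) w') t := by
  have hG : HasFDerivAt G (fderiv ℝ G (c t)) (c t) :=
    ((h.smooth.contDiffAt (h.isOpen.mem_nhds hD)).differentiableAt (by simp)).hasFDerivAt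
  have h1 : HasDerivAt (fun t => G (c t)) (fderiv ℝ G (c t) c') t := hG.comp_hasDerivAt t hc
  have h2 := (h1.clm_apply hu).clm_apply hw
  simpa using h2

/-- The energy of a geodesic is constant. -/
lemma IsLorentzOn.hasDerivAt_energy (h : IsLorentzOn G T D) {c d : ℝ → E} {t : ℝ}
    (hc : HasDerivAt c (d t) t) (hd : HasDerivAt d (geodesicAccel G (c t) (d t)) t)
    (hD : c t ∈ D) : HasDerivAt (fun t => G (c t) (d t) (d t)) 0 t := by
  have := h.hasDerivAt_form hc hd hd hD
  convert! this using 1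
  rw [(h.form _ hD).symm (d t) (geodesicAccel G (c t) (d t)), h.accel_eq hD]
  ring

end Spray

/-! ### The geodesic flow and the Gauss lemma -/

section NormalNeighbourhood

variable {E : Type*} [NormedAddCommGroup E] [NormedSpace ℝ E]

lemma HasDerivAt.comp_const_mul {u : ℝ → E} {u' : E} {s t : ℝ} (h : HasDerivAt u u' (s * t)) :
    HasDerivAt (fun t => u (s * t)) (s • u') t := by
  have h1 : HasDerivAt (fun t : ℝ => s * t) s t := by
    simpa using (hasDerivAt_id t).const_mul s
  exact h.scomp t h1

variable [FiniteDimensional ℝ E] {G : E → E →L[ℝ] E →L[ℝ] ℝ} {T : E → E} {D : Set E}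

/-- The flow `(c, d)` (position and velocity) of the geodesic equation near `(x₀, 0)`, defined for
times in `(-2, 2)`, with its derivative `J` in the initial values. -/
structure IsGeodesicFlow (G : E → E →L[ℝ] E →L[ℝ] ℝ) (D : Set E) (x₀ : E) (ρ : ℝ)
    (c d : E → E → ℝ → E) (J : E × E → ℝ → E × E →L[ℝ] E × E) : Prop where
  pos : 0 < ρ
  c_zero : ∀ z ∈ Metric.ball (x₀, (0 : E)) ρ, c z.1 z.2 0 = z.1
  d_zero : ∀ z ∈ Metric.ball (x₀, (0 : E)) ρ, d z.1 z.2 0 = z.2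
  J_zero : ∀ z ∈ Metric.ball (x₀, (0 : E)) ρ, J z 0 = ContinuousLinearMap.id ℝ (E × E)
  mem : ∀ z ∈ Metric.ball (x₀, (0 : E)) ρ, ∀ t ∈ Ioo (-2 : ℝ) 2, c z.1 z.2 t ∈ D
  hasDerivAt_c : ∀ z ∈ Metric.ball (x₀, (0 : E)) ρ, ∀ t ∈ Ioo (-2 : ℝ) 2,
    HasDerivAt (c z.1 z.2) (d z.1 z.2 t) t
  hasDerivAt_d : ∀ z ∈ Metric.ball (x₀, (0 : E)) ρ, ∀ t ∈ Ioo (-2 : ℝ) 2,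
    HasDerivAt (d z.1 z.2) (geodesicAccel G (c z.1 z.2 t) (d z.1 z.2 t)) t
  hasFDerivAt : ∀ z ∈ Metric.ball (x₀, (0 : E)) ρ, ∀ t ∈ Ioo (-2 : ℝ) 2,
    HasFDerivAt (fun z : E × E => (c z.1 z.2 t, d z.1 z.2 t)) (J z t) z
  hasDerivAt_J : ∀ z ∈ Metric.ball (x₀, (0 : E)) ρ, ∀ t ∈ Ioo (-2 : ℝ) 2, ∀ k,
    HasDerivAt (fun t => (J z t k).1) (J z t k).2 t
  homog : ∀ z ∈ Metric.ball (x₀, (0 : E)) ρ, ∀ t ∈ Ioo (-2 : ℝ) 2, ∀ s ∈ Icc (0 : ℝ) 1,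
    c z.1 (s • z.2) t = c z.1 z.2 (s * t) ∧ d z.1 (s • z.2) t = s • d z.1 z.2 (s * t)
  back : ∀ z ∈ Metric.ball (x₀, (0 : E)) ρ,
    (c z.1 z.2 (-1), d z.1 z.2 (-1)) ∈ Metric.ball (x₀, (0 : E)) ρ →
    c (c z.1 z.2 (-1)) (d z.1 z.2 (-1)) 1 = z.1
  continuousOn : ContinuousOn (fun p : (E × E) × ℝ => (c p.1.1 p.1.2 p.2, d p.1.1 p.1.2 p.2))
    (Metric.ball (x₀, (0 : E)) ρ ×ˢ Ioo (-2 : ℝ) 2)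
  continuousOn_J : ContinuousOn (fun p : (E × E) × ℝ => J p.1 p.2)
    (Metric.ball (x₀, (0 : E)) ρ ×ˢ Ioo (-2 : ℝ) 2)

lemma mem_ball_prod_zero {x₀ o v : E} {ρ : ℝ} :
    (o, v) ∈ Metric.ball (x₀, (0 : E)) ρ ↔ o ∈ Metric.ball x₀ ρ ∧ ‖v‖ < ρ := by
  rw [Metric.mem_ball, Prod.dist_eq, max_lt_iff, Metric.mem_ball, dist_zero_right]

lemma smul_mem_ball_prod_zero {x₀ o v : E} {ρ s : ℝ}
    (h : (o, v) ∈ Metric.ball (x₀, (0 : E)) ρ) (hs : s ∈ Icc (0 : ℝ) 1) :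
    (o, s • v) ∈ Metric.ball (x₀, (0 : E)) ρ := by
  rw [mem_ball_prod_zero] at h ⊢
  refine ⟨h.1, ?_⟩
  rw [norm_smul, Real.norm_of_nonneg hs.1]
  exact (mul_le_of_le_one_left (norm_nonneg v) hs.2).trans_lt h.2

/-- The local flow of the geodesic field exists for some time `ε`. Slowing down the initial
velocities extends it beyond `[-1, 1]`, so that the exponential map and its reversal are both
defined. Homogeneity and reversibility follow from uniqueness of solutions. -/
theorem IsLorentzOn.exists_geodesicFlow (h : IsLorentzOn G T D) {x₀ : E} (hx₀ : x₀ ∈ D) :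
    ∃ ρ c d J, IsGeodesicFlow G D x₀ ρ c d J := by
  have hopen : IsOpen (D ×ˢ (univ : Set E)) := h.isOpen.prod isOpen_univ
  have hz₀ : (x₀, (0 : E)) ∈ D ×ˢ (univ : Set E) := ⟨hx₀, trivial⟩
  have hF := h.contDiffOn_geodesicField
  obtain ⟨K, s, hs, hK⟩ := ((hF.contDiffAt (hopen.mem_nhds hz₀)).of_le
    (by simp)).exists_lipschitzOnWith
  obtain ⟨R, hR, hRs⟩ := Metric.mem_nhds_iff.1 (inter_mem hs (hopen.mem_nhds hz₀))
  have hRD : Metric.ball (x₀, (0 : E)) R ⊆ D ×ˢ univ := fun z hz => (hRs hz).2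
  have hKR : LipschitzOnWith K (geodesicField G) (Metric.ball (x₀, (0 : E)) R) :=
    hK.mono fun z hz => (hRs hz).1
  obtain ⟨r, hr, ε, hε, φ, Dφ, hφ, hφc, hDc⟩ := exists_local_flow Metric.isOpen_ball (hF.mono hRD)
    (Metric.mem_ball_self hR)
  have hε0 : (0 : ℝ) ∈ Ioo (-ε) ε := ⟨by linarith, hε⟩
  have hcomp : ∀ z ∈ Metric.ball (x₀, (0 : E)) r, ∀ t ∈ Ioo (-ε) ε,
      HasDerivAt (fun t => (φ z t).1) (φ z t).2 t ∧
      HasDerivAt (fun t => (φ z t).2) (geodesicAccel G (φ z t).1 (φ z t).2) t := by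
    intro z hz t ht
    have := ((hφ z hz).2.2 t ht).2.1
    exact ⟨this.fst, this.snd⟩
  -- The slowed-down geodesic solves the same equation with the scaled initial velocity; the ball on
  -- which the field is Lipschitz is stable under shrinking the velocity.
  have hhom : ∀ o v, (o, v) ∈ Metric.ball (x₀, (0 : E)) r → ∀ s ∈ Icc (0 : ℝ) 1, ∀ t ∈ Ioo (-ε) ε,
      φ (o, s • v) t = ((φ (o, v) (s * t)).1, s • (φ (o, v) (s * t)).2) := by
    intro o v hz s hs
    have hst : ∀ t ∈ Ioo (-ε) ε, s * t ∈ Ioo (-ε) ε := by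
      intro t ht
      replace ht : |t| < ε := abs_lt.2 ht
      refine abs_lt.1 ?_
      rw [abs_mul, abs_of_nonneg hs.1]
      exact (mul_le_of_le_one_left (abs_nonneg t) hs.2).trans_lt ht
    have hz' := smul_mem_ball_prod_zero hz hs
    refine ODE_solution_unique_of_mem_Ioo (v := fun _ => geodesicField G)
      (s := fun _ => Metric.ball (x₀, (0 : E)) R) (K := K) (fun _ _ => hKR) hε0
      (fun t ht => ⟨((hφ _ hz').2.2 t ht).2.1, ((hφ _ hz').2.2 t ht).1⟩) (fun t ht => ⟨?_, ?_⟩) ?_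
    · have h1 := (hcomp _ hz _ (hst t ht)).1.comp_const_mul
      have h2 := (hcomp _ hz _ (hst t ht)).2.comp_const_mul
      have h3 := h1.prodMk (h2.const_smul s)
      rw [geodesicField]
      simp only [geodesicAccel_smul]
      rw [pow_two, mul_smul]
      exact h3
    · exact smul_mem_ball_prod_zero (v := (φ (o, v) (s * t)).2) ((hφ _ hz).2.2 _ (hst t ht)).1 hs
    · simp only [mul_zero, (hφ _ hz).1, (hφ _ hz').1]
  -- rescale time
  set l : ℝ := min 1 (ε / 2) with hl
  have hl0 : 0 < l := by positivity
  have hl1 : l ≤ 1 := min_le_left _ _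
  have hlt : ∀ t ∈ Ioo (-2 : ℝ) 2, l * t ∈ Ioo (-ε) ε := by
    intro t ht
    replace ht : |t| < 2 := abs_lt.2 ht
    refine abs_lt.1 ?_
    rw [abs_mul, abs_of_pos hl0]
    calc l * |t| < l * 2 := by gcongr
      _ ≤ ε / 2 * 2 := by gcongr; exact min_le_right _ _
      _ = ε := by ring
  -- The new flow is `L ∘ φ (l * t) ∘ L'`. The bound `l ≤ ε / 2` gives times in `(-2, 2)`, and `l ≤
  -- 1` keeps the position inside the original ball when the radius becomes `l * r`.
  let L : E × E →L[ℝ] E × E :=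
    (ContinuousLinearMap.fst ℝ E E).prod (l • ContinuousLinearMap.snd ℝ E E)
  let L' : E × E →L[ℝ] E × E :=
    (ContinuousLinearMap.fst ℝ E E).prod (l⁻¹ • ContinuousLinearMap.snd ℝ E E)
  have hL' : ∀ z ∈ Metric.ball (x₀, (0 : E)) (l * r), L' z ∈ Metric.ball (x₀, (0 : E)) r := by
    rintro ⟨o, v⟩ hz
    rw [mem_ball_prod_zero] at hz
    refine mem_ball_prod_zero.2 ⟨Metric.ball_subset_ball ?_ hz.1, ?_⟩
    · exact mul_le_of_le_one_left hr.le hl1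
    · change ‖l⁻¹ • v‖ < r
      rw [norm_smul, norm_inv, Real.norm_of_nonneg hl0.le, inv_mul_lt_iff₀ hl0]
      exact hz.2
  refine ⟨l * r, fun o v t => (φ (L' (o, v)) (l * t)).1, fun o v t => l • (φ (L' (o, v)) (l * t)).2,
    fun z t => L ∘L Dφ (L' z) (l * t) ∘L L', ⟨by positivity, ?_, ?_, ?_, ?_, ?_, ?_, ?_, ?_, ?_, ?_, ?_,
      ?_⟩⟩
  · intro z hz
    simp only [mul_zero, (hφ _ (hL' z hz)).1]
    rfl
  · intro z hz
    simp only [mul_zero, (hφ _ (hL' z hz)).1]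
    exact smul_inv_smul₀ hl0.ne' z.2
  · intro z hz
    simp only [mul_zero, (hφ _ (hL' z hz)).2.1]
    ext k
    · simp [L, L']
    · simp [L, L']
    · simp [L, L']
    · simp [L, L', smul_inv_smul₀ hl0.ne']
  · intro z hz t ht
    exact (hRD ((hφ _ (hL' z hz)).2.2 _ (hlt t ht)).1).1
  · intro z hz t ht
    exact (hcomp _ (hL' z hz) _ (hlt t ht)).1.comp_const_mul
  · intro z hz t ht
    have h1 := ((hcomp _ (hL' z hz) _ (hlt t ht)).2.comp_const_mul).const_smul l
    rw [geodesicAccel_smul, pow_two, mul_smul]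
    exact h1
  · intro z hz t ht
    have h1 := ((hφ _ (hL' z hz)).2.2 _ (hlt t ht)).2.2.1
    exact (L.hasFDerivAt.comp _ (h1.comp z L'.hasFDerivAt))
  · intro z hz t ht k
    have h0 := (hφ _ (hL' z hz)).2.2 _ (hlt t ht)
    have h1' : HasDerivAt (fun t => (Dφ (L' z) t (L' k)).1)
        (fderiv ℝ (geodesicField G) (φ (L' z) (l * t)) (Dφ (L' z) (l * t) (L' k))).1 (l * t) :=
      (h0.2.2.2 (L' k)).fst
    have h1 := h1'.comp_const_mul
    -- The position component of the geodesic field is the velocity, so in the linearised flow the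
    -- variation of the position has the variation of the velocity as its derivative.
    have h2 : ∀ q, (fderiv ℝ (geodesicField G) (φ (L' z) (l * t)) q).1 = q.2 := by
      intro q
      have hd := ((hF.contDiffAt (hopen.mem_nhds (hRD h0.1))).differentiableAt
        (by simp)).hasFDerivAt
      have e := hd.fst.unique (hasFDerivAt_snd (𝕜 := ℝ) (p := φ (L' z) (l * t)))
      exact DFunLike.congr_fun e q
    simp only [h2] at h1
    exact h1
  · intro z hz t ht s hs
    have h1 := hhom z.1 (l⁻¹ • z.2) (hL' z hz) s hs _ (hlt t ht)
    have e : L' (z.1, s • z.2) = (z.1, s • l⁻¹ • z.2) := by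
      rw [smul_comm]
      rfl
    simp only [e, h1]
    rw [mul_left_comm s l t]
    exact ⟨rfl, smul_comm _ _ _⟩
  · intro z hz hz'
    have hlε : 2 * l ≤ ε := by
      have : l ≤ ε / 2 := min_le_right _ _
      linarith
    have hw : L' ((φ (L' z) (l * -1)).1, l • (φ (L' z) (l * -1)).2) = φ (L' z) (l * -1) :=
      Prod.ext rfl (inv_smul_smul₀ hl0.ne' _)
    have hz2 : φ (L' z) (l * -1) ∈ Metric.ball (x₀, (0 : E)) r := hw ▸ hL' _ hz'
    -- Going back by time `l` and then forward by time `l` returns to the start: the two solutions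
    -- agree at time `0`, and `(l - ε, ε)` is a common interval of definition that contains `0` and
    -- `l`.
    have key := ODE_solution_unique_of_mem_Ioo (v := fun _ => geodesicField G)
      (s := fun _ => Metric.ball (x₀, (0 : E)) R) (K := K) (a := l - ε) (b := ε) (t₀ := 0)
      (f := fun t => φ (φ (L' z) (l * -1)) t) (g := fun t => φ (L' z) (t - l)) (fun _ _ => hKR)
      ⟨by linarith, hε⟩
      (fun t ht => by
        have h1 := (hφ _ hz2).2.2 t ⟨by linarith [ht.1], ht.2⟩
        exact ⟨h1.2.1, h1.1⟩)
      (fun t ht => by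
        have h1 := (hφ _ (hL' z hz)).2.2 (t - l) ⟨by linarith [ht.1], by linarith [ht.2]⟩
        exact ⟨h1.2.1.comp_sub_const t l, h1.1⟩)
      (by
        rw [(hφ _ hz2).1]
        congr 1
        ring) (show l ∈ Ioo (l - ε) ε from ⟨by linarith, by linarith⟩)
    simp only [sub_self, (hφ _ (hL' z hz)).1] at key
    change (φ (L' ((φ (L' z) (l * -1)).1, l • (φ (L' z) (l * -1)).2)) (l * 1)).1 = z.1
    rw [hw, mul_one, key]
    rfl
  · have h1 : ContinuousOn (fun p : (E × E) × ℝ => φ (L' p.1) (l * p.2))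
        (Metric.ball (x₀, (0 : E)) (l * r) ×ˢ Ioo (-2 : ℝ) 2) :=
      hφc.comp (f := fun p : (E × E) × ℝ => (L' p.1, l * p.2))
        (Continuous.continuousOn (by fun_prop)) fun p hp => ⟨hL' _ hp.1, hlt _ hp.2⟩
    exact L.continuous.comp_continuousOn h1
  · have h1 : ContinuousOn (fun p : (E × E) × ℝ => Dφ (L' p.1) (l * p.2))
        (Metric.ball (x₀, (0 : E)) (l * r) ×ˢ Ioo (-2 : ℝ) 2) :=
      hDc.comp (f := fun p : (E × E) × ℝ => (L' p.1, l * p.2))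
        (Continuous.continuousOn (by fun_prop)) fun p hp => ⟨hL' _ hp.1, hlt _ hp.2⟩
    exact continuousOn_const.clm_comp (h1.clm_comp continuousOn_const)

namespace IsGeodesicFlow

variable {x₀ : E} {ρ : ℝ} {c d : E → E → ℝ → E} {J : E × E → ℝ → E × E →L[ℝ] E × E}

lemma energy_eq (h : IsLorentzOn G T D) (hf : IsGeodesicFlow G D x₀ ρ c d J) {z : E × E}
    (hz : z ∈ Metric.ball (x₀, (0 : E)) ρ) {t : ℝ} (ht : t ∈ Ioo (-2 : ℝ) 2) :
    G (c z.1 z.2 t) (d z.1 z.2 t) (d z.1 z.2 t) = G z.1 z.2 z.2 := by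
  have h1 : ∀ t ∈ Ioo (-2 : ℝ) 2,
      HasDerivAt (fun t => G (c z.1 z.2 t) (d z.1 z.2 t) (d z.1 z.2 t)) 0 t := fun t ht =>
    h.hasDerivAt_energy (hf.hasDerivAt_c z hz t ht) (hf.hasDerivAt_d z hz t ht) (hf.mem z hz t ht)
  have h2 := isOpen_Ioo.is_const_of_deriv_eq_zero isPreconnected_Ioo
    (fun t ht => (h1 t ht).differentiableAt.differentiableWithinAt) (fun t ht => (h1 t ht).deriv)
    ht (show (0 : ℝ) ∈ Ioo (-2 : ℝ) 2 by simp)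
  simpa only [hf.c_zero z hz, hf.d_zero z hz] using h2

/-- The Gauss lemma. -/
lemma gauss (h : IsLorentzOn G T D) (hf : IsGeodesicFlow G D x₀ ρ c d J) {z : E × E}
    (hz : z ∈ Metric.ball (x₀, (0 : E)) ρ) (w : E) :
    G (c z.1 z.2 1) (d z.1 z.2 1) (J z 1 (0, w)).1 = G z.1 z.2 w := by
  have hopen := (Metric.isOpen_ball (x := (x₀, (0 : E))) (ε := ρ)).mem_nhds hz
  have hzD : z.1 ∈ D := by
    simpa only [hf.c_zero z hz] using hf.mem z hz 0 (by simp)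
  -- variation of the energy
  have hvar : ∀ t ∈ Ioo (-2 : ℝ) 2,
      fderiv ℝ G (c z.1 z.2 t) (J z t (0, w)).1 (d z.1 z.2 t) (d z.1 z.2 t)
        + 2 * G (c z.1 z.2 t) (d z.1 z.2 t) (J z t (0, w)).2 = 2 * G z.1 z.2 w := by
    intro t ht
    have hline : HasDerivAt (fun s : ℝ => z + s • ((0 : E), w)) ((0 : E), w) 0 := by
      simpa using ((hasDerivAt_id (0 : ℝ)).smul_const ((0 : E), w)).const_add z
    have h0 : z + (0 : ℝ) • ((0 : E), w) = z := by simp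
    have h1 := (h0.symm ▸ hf.hasFDerivAt z hz t ht :
      HasFDerivAt (fun z : E × E => (c z.1 z.2 t, d z.1 z.2 t)) (J z t)
        (z + (0 : ℝ) • ((0 : E), w))).comp_hasDerivAt 0 hline
    have hc := h1.fst
    have hd := h1.snd
    have h2 := h.hasDerivAt_form hc hd hd (by simpa using hf.mem z hz t ht)
    have h3 := h.hasDerivAt_form (hline.fst) (hline.snd) hline.snd (by simpa using hzD)
    have h4 : (fun s : ℝ => G (c (z + s • ((0 : E), w)).1 (z + s • ((0 : E), w)).2 t)
        (d (z + s • ((0 : E), w)).1 (z + s • ((0 : E), w)).2 t)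
        (d (z + s • ((0 : E), w)).1 (z + s • ((0 : E), w)).2 t)) =ᶠ[𝓝 0]
        fun s => G (z + s • ((0 : E), w)).1 (z + s • ((0 : E), w)).2 (z + s • ((0 : E), w)).2 := by
      have : ∀ᶠ s : ℝ in 𝓝 0, z + s • ((0 : E), w) ∈ Metric.ball (x₀, (0 : E)) ρ :=
        hline.continuousAt.eventually_mem (by simpa only [h0] using hopen)
      filter_upwards [this] with s hs using hf.energy_eq h hs ht
    have h5 := h2.unique (h3.congr_of_eventuallyEq h4)
    simp only [Function.comp_apply, h0, map_zero, zero_apply, zero_add] at h5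
    rw [(h.form _ (hf.mem z hz t ht)).symm (J z t (0, w)).2, (h.form _ hzD).symm w] at h5
    linarith
  -- By the geodesic equation the derivative of `G (c') (∂c)` is half the variation of the energy,
  -- which is constantly `G v w` by `hvar`. At `t = 0` the position is not varied, so the difference
  -- vanishes identically.
  have hm : ∀ t ∈ Ioo (-2 : ℝ) 2, HasDerivAt
      (fun t => G (c z.1 z.2 t) (d z.1 z.2 t) (J z t (0, w)).1 - t * G z.1 z.2 w) 0 t := by
    intro t ht
    have h1 := h.hasDerivAt_form (hf.hasDerivAt_c z hz t ht) (hf.hasDerivAt_d z hz t ht)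
      (hf.hasDerivAt_J z hz t ht (0, w)) (hf.mem z hz t ht)
    have h2 := h1.sub ((hasDerivAt_id t).mul_const (G z.1 z.2 w))
    convert! h2 using 1
    rw [h.accel_eq (hf.mem z hz t ht)]
    have := hvar t ht
    linarith
  have h2 := isOpen_Ioo.is_const_of_deriv_eq_zero isPreconnected_Ioo
    (fun t ht => (hm t ht).differentiableAt.differentiableWithinAt) (fun t ht => (hm t ht).deriv)
    (show (1 : ℝ) ∈ Ioo (-2 : ℝ) 2 by norm_num) (show (0 : ℝ) ∈ Ioo (-2 : ℝ) 2 by simp)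
  simp only [hf.J_zero z hz, ContinuousLinearMap.id_apply, map_zero, zero_mul, sub_zero,
    one_mul] at h2
  linarith

end IsGeodesicFlow

end NormalNeighbourhood

/-! ### Existence of normal neighbourhoods -/

section NormalNeighbourhood

variable {E : Type*} [NormedAddCommGroup E] [NormedSpace ℝ E] [FiniteDimensional ℝ E]
  {G : E → E →L[ℝ] E →L[ℝ] ℝ} {T : E → E} {D : Set E} {x₀ : E} {ρ : ℝ}
  {c d : E → E → ℝ → E} {J : E × E → ℝ → E × E →L[ℝ] E × E}

lemma IsGeodesicFlow.mono (hf : IsGeodesicFlow G D x₀ ρ c d J) {ρ' : ℝ} (h0 : 0 < ρ')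
    (h : ρ' ≤ ρ) : IsGeodesicFlow G D x₀ ρ' c d J :=
  have hs := Metric.ball_subset_ball h
  ⟨h0, fun z hz => hf.c_zero z (hs hz), fun z hz => hf.d_zero z (hs hz),
    fun z hz => hf.J_zero z (hs hz), fun z hz => hf.mem z (hs hz),
    fun z hz => hf.hasDerivAt_c z (hs hz), fun z hz => hf.hasDerivAt_d z (hs hz),
    fun z hz => hf.hasFDerivAt z (hs hz), fun z hz => hf.hasDerivAt_J z (hs hz),
    fun z hz => hf.homog z (hs hz), fun z hz hz' => hf.back z (hs hz) (hs hz'),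
    hf.continuousOn.mono (prod_mono_left hs),
    hf.continuousOn_J.mono (prod_mono_left hs)⟩

/-- `N` is an open neighbourhood of `x₀` such that `o, y ∈ N` are joined by the geodesic with
initial velocity `V o y` at `o`, which depends continuously on `(o, y)`. -/
structure IsNormalNhd (G : E → E →L[ℝ] E →L[ℝ] ℝ) (D : Set E) (x₀ : E) (ρ : ℝ)
    (c d : E → E → ℝ → E) (J : E × E → ℝ → E × E →L[ℝ] E × E) (V : E → E → E) (N : Set E) :
    Prop where
  flow : IsGeodesicFlow G D x₀ ρ c d J
  isOpen : IsOpen N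
  mem : x₀ ∈ N
  V_mem : ∀ o ∈ N, ∀ y ∈ N, (o, V o y) ∈ Metric.ball (x₀, (0 : E)) ρ
  c_V : ∀ o ∈ N, ∀ y ∈ N, c o (V o y) 1 = y
  V_c : ∀ o v, (o, v) ∈ Metric.ball (x₀, (0 : E)) ρ → V o (c o v 1) = v
  continuousOn_V : ContinuousOn (fun p : E × E => V p.1 p.2) (N ×ˢ N)
  hasFDerivAt : ∀ o ∈ N, ∀ y ∈ N, HasFDerivAt (fun y => G o (V o y) (V o y))
    ((2 : ℝ) • G y (d o (V o y) 1)) y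

/-- The derivative of the exponential map at the zero vector. -/
lemma IsGeodesicFlow.J_one_center (hf : IsGeodesicFlow G D x₀ ρ c d J) (h k : E) :
    (J (x₀, 0) 1 (h, k)).1 = h + k := by
  have hz : (x₀, (0 : E)) ∈ Metric.ball (x₀, (0 : E)) ρ := Metric.mem_ball_self hf.pos
  have h1t : (1 : ℝ) ∈ Ioo (-2 : ℝ) 2 := by norm_num
  have hd := (hf.hasFDerivAt _ hz 1 h1t).fst
  -- Geodesics with zero velocity are constant, so moving the base point moves the end point
  -- equally.
  have hh : (J (x₀, 0) 1 (h, 0)).1 = h := by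
    have hline : HasDerivAt (fun s : ℝ => (x₀, (0 : E)) + s • (h, (0 : E))) (h, (0 : E)) 0 := by
      simpa using ((hasDerivAt_id (0 : ℝ)).smul_const (h, (0 : E))).const_add (x₀, (0 : E))
    have h0 : (x₀, (0 : E)) + (0 : ℝ) • (h, (0 : E)) = (x₀, 0) := by simp
    have h1 : HasDerivAt (fun s : ℝ => c (x₀ + s • h) 0 1) (J (x₀, 0) 1 (h, 0)).1 0 := by
      have := (h0.symm ▸ hd : HasFDerivAt (fun z : E × E => c z.1 z.2 1) _
        ((x₀, (0 : E)) + (0 : ℝ) • (h, (0 : E)))).comp_hasDerivAt 0 hline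
      simpa [Function.comp_def] using this
    have h2 : HasDerivAt (fun s : ℝ => x₀ + s • h) h 0 := by
      simpa using ((hasDerivAt_id (0 : ℝ)).smul_const h).const_add x₀
    refine h1.unique (h2.congr_of_eventuallyEq ?_)
    have : ∀ᶠ s : ℝ in 𝓝 0, (x₀, (0 : E)) + s • (h, (0 : E)) ∈ Metric.ball (x₀, (0 : E)) ρ :=
      hline.continuousAt.eventually_mem (by
        simpa only [h0] using Metric.isOpen_ball.mem_nhds hz)
    filter_upwards [this] with s hs
    have e := (hf.homog _ hs 1 h1t 0 (by simp)).1
    have e2 := hf.c_zero _ hs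
    simp only [Prod.fst_add, Prod.smul_fst, Prod.snd_add, Prod.smul_snd, smul_zero, add_zero,
      zero_mul] at e e2
    rw [e, e2]
  have hk : (J (x₀, 0) 1 (0, k)).1 = k := by
    obtain ⟨a, ha, hak⟩ : ∃ a : ℝ, 0 < a ∧ ‖a • k‖ < ρ := by
      refine ⟨ρ / (‖k‖ + 1), by have := hf.pos; positivity, ?_⟩
      have := hf.pos
      rw [norm_smul, Real.norm_of_nonneg (by positivity), div_mul_eq_mul_div,
        div_lt_iff₀ (by positivity)]
      nlinarith [norm_nonneg k]
    have hz' : (x₀, a • k) ∈ Metric.ball (x₀, (0 : E)) ρ :=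
      mem_ball_prod_zero.2 ⟨Metric.mem_ball_self hf.pos, hak⟩
    have hline : HasDerivAt (fun s : ℝ => (x₀, s • a • k)) ((0 : E), a • k) 0 :=
      (hasDerivAt_const _ _).prodMk (by simpa using (hasDerivAt_id (0 : ℝ)).smul_const (a • k))
    have h0 : (x₀, (0 : ℝ) • a • k) = (x₀, 0) := by simp
    have hd' : HasFDerivAt (fun z : E × E => c z.1 z.2 1)
        (ContinuousLinearMap.fst ℝ E E ∘L J (x₀, 0) 1) (x₀, (0 : ℝ) • a • k) := by
      rw [h0]
      exact hd
    have h1 : HasDerivAt (fun s : ℝ => c x₀ (s • a • k) 1) (J (x₀, 0) 1 (0, a • k)).1 0 := by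
      have := HasFDerivAt.comp_hasDerivAt (0 : ℝ) hd' hline
      exact this
    have h2 := hf.hasDerivAt_c _ hz' 0 (by simp)
    rw [hf.d_zero _ hz'] at h2
    have h3 : (J (x₀, 0) 1 (0, a • k)).1 = a • k := by
      -- Homogeneity is known only for factors in `[0, 1]`, so the derivatives are compared from the
      -- right.
      refine (uniqueDiffWithinAt_Ici (0 : ℝ)).eq_deriv _ h1.hasDerivWithinAt
        (h2.hasDerivWithinAt.congr_of_eventuallyEq ?_ ?_)
      · have : ∀ᶠ s : ℝ in 𝓝[≥] 0, s ∈ Icc (0 : ℝ) 1 := Icc_mem_nhdsGE one_pos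
        filter_upwards [this] with s hs
        simpa using (hf.homog _ hz' 1 h1t s hs).1
      · simpa using (hf.homog _ hz' 1 h1t 0 (by simp)).1
    have e : ((0 : E), a • k) = a • ((0 : E), k) := by simp
    rw [e, map_smul, Prod.smul_fst] at h3
    exact smul_right_injective E ha.ne' h3
  have : (h, k) = (h, (0 : E)) + ((0 : E), k) := by simp
  rw [this, map_add, Prod.fst_add, hh, hk]

/-- The inverse function theorem is applied to `(o, v) ↦ (o, exp_o v)` at `(x₀, 0)`, where the
derivative is `(h, k) ↦ (h, h + k)`. Varying the base point together with the vector makes one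
neighbourhood normal for all of its points simultaneously. -/
theorem IsLorentzOn.exists_normalNhd (h : IsLorentzOn G T D) (hx₀ : x₀ ∈ D) :
    ∃ ρ c d J V N, IsNormalNhd G D x₀ ρ c d J V N := by
  obtain ⟨ρ, c, d, J, hf⟩ := h.exists_geodesicFlow hx₀
  have hz₀ : (x₀, (0 : E)) ∈ Metric.ball (x₀, (0 : E)) ρ := Metric.mem_ball_self hf.pos
  have h1t : (1 : ℝ) ∈ Ioo (-2 : ℝ) 2 := by norm_num
  let f : E × E → E × E := fun z => (z.1, c z.1 z.2 1)
  let f' : E × E → E × E →L[ℝ] E × E := fun z =>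
    (ContinuousLinearMap.fst ℝ E E).prod ((ContinuousLinearMap.fst ℝ E E) ∘L J z 1)
  have hff' : ∀ z ∈ Metric.ball (x₀, (0 : E)) ρ, HasFDerivAt f (f' z) z := fun z hz =>
    hasFDerivAt_fst.prodMk (hf.hasFDerivAt z hz 1 h1t).fst
  have hJc : ContinuousOn (fun z => J z 1) (Metric.ball (x₀, (0 : E)) ρ) :=
    hf.continuousOn_J.comp (f := fun z => (z, (1 : ℝ))) (by fun_prop) fun z hz => ⟨hz, h1t⟩
  have hf'c : ContinuousOn f' (Metric.ball (x₀, (0 : E)) ρ) := by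
    have h1 : ContinuousOn (fun z => (ContinuousLinearMap.fst ℝ E E) ∘L J z 1)
        (Metric.ball (x₀, (0 : E)) ρ) := continuousOn_const.clm_comp hJc
    exact (ContinuousLinearMap.prodₗᵢ ℝ).continuous.comp_continuousOn
      ((continuousOn_const (c := ContinuousLinearMap.fst ℝ E E)).prodMk h1)
  have hC1 : ∀ z ∈ Metric.ball (x₀, (0 : E)) ρ, ContDiffAt ℝ 1 f z := fun z hz =>
    contDiffAt_one_iff.2 ⟨f', _, Metric.isOpen_ball.mem_nhds hz, hf'c, hff'⟩
  let e : (E × E) ≃L[ℝ] (E × E) := ContinuousLinearEquiv.equivOfInverse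
    ((ContinuousLinearMap.fst ℝ E E).prod
      (ContinuousLinearMap.fst ℝ E E + ContinuousLinearMap.snd ℝ E E))
    ((ContinuousLinearMap.fst ℝ E E).prod
      (ContinuousLinearMap.snd ℝ E E - ContinuousLinearMap.fst ℝ E E))
    (fun p => by ext <;> simp) (fun p => by ext <;> simp)
  have he : f' (x₀, 0) = (e : E × E →L[ℝ] E × E) := by
    refine ContinuousLinearMap.ext fun p => ?_
    exact Prod.ext rfl (hf.J_one_center p.1 p.2)
  have hfe : HasFDerivAt f (e : E × E →L[ℝ] E × E) (x₀, 0) := he ▸ hff' _ hz₀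
  have hfz₀ : f (x₀, 0) = (x₀, x₀) := by
    have h1 := (hf.homog _ hz₀ 1 h1t 0 (by simp)).1
    have h2 := hf.c_zero _ hz₀
    simp only [smul_zero, zero_mul] at h1 h2
    simp only [f, h1, h2]
  have hst : HasStrictFDerivAt f (e : E × E →L[ℝ] E × E) (x₀, 0) :=
    (hC1 _ hz₀).hasStrictFDerivAt' hfe one_ne_zero
  set g := (hC1 _ hz₀).localInverse hfe one_ne_zero with hg
  have hgC : ContDiffAt ℝ 1 g (x₀, x₀) := by
    have := (hC1 _ hz₀).to_localInverse hfe one_ne_zero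
    rwa [hfz₀] at this
  have hgl : ∀ᶠ z in 𝓝 (x₀, (0 : E)), g (f z) = z := hst.eventually_left_inverse
  have hgr : ∀ᶠ p in 𝓝 (x₀, x₀), f (g p) = p := by
    have := hst.eventually_right_inverse
    rwa [hfz₀] at this
  have hg0 : g (x₀, x₀) = (x₀, 0) := by
    have := hgl.self_of_nhds
    rwa [hfz₀] at this
  obtain ⟨ρ₁, hρ₁, hρ₁s⟩ := Metric.eventually_nhds_iff_ball.1 hgl
  -- On the smaller ball the local inverse is a left inverse throughout, which is the field `V_c`.
  set ρ₂ := min ρ ρ₁ with hρ₂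
  have hρ₂0 : 0 < ρ₂ := lt_min hf.pos hρ₁
  have hf₂ := hf.mono hρ₂0 (min_le_left ρ ρ₁)
  have hgm : ∀ᶠ p in 𝓝 (x₀, x₀), g p ∈ Metric.ball (x₀, (0 : E)) ρ₂ :=
    hgC.continuousAt.eventually_mem (by
      rw [hg0]
      exact Metric.ball_mem_nhds _ hρ₂0)
  obtain ⟨η, hη, hηs⟩ := Metric.eventually_nhds_iff_ball.1
    (hgr.and (hgm.and (hgC.eventually (by simp))))
  have hin : ∀ o ∈ Metric.ball x₀ η, ∀ y ∈ Metric.ball x₀ η,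
      f (g (o, y)) = (o, y) ∧ g (o, y) ∈ Metric.ball (x₀, (0 : E)) ρ₂ ∧ ContDiffAt ℝ 1 g (o, y) := by
    intro o ho y hy
    refine hηs (o, y) ?_
    rw [Metric.mem_ball, Prod.dist_eq]
    exact max_lt ho hy
  have hg1 : ∀ o ∈ Metric.ball x₀ η, ∀ y ∈ Metric.ball x₀ η, g (o, y) = (o, (g (o, y)).2) :=
    fun o ho y hy => by
      have h1 : (g (o, y)).1 = o := congrArg Prod.fst (hin o ho y hy).1
      exact Prod.ext h1 rfl
  have hVm : ∀ o ∈ Metric.ball x₀ η, ∀ y ∈ Metric.ball x₀ η,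
      (o, (g (o, y)).2) ∈ Metric.ball (x₀, (0 : E)) ρ₂ := fun o ho y hy => by
    rw [← hg1 o ho y hy]
    exact (hin o ho y hy).2.1
  have hcV : ∀ o ∈ Metric.ball x₀ η, ∀ y ∈ Metric.ball x₀ η, c o (g (o, y)).2 1 = y := by
    intro o ho y hy
    have h1 := congrArg Prod.snd (hin o ho y hy).1
    rw [hg1 o ho y hy] at h1
    exact h1
  refine ⟨ρ₂, c, d, J, fun o y => (g (o, y)).2, Metric.ball x₀ η, hf₂, Metric.isOpen_ball,
    Metric.mem_ball_self hη, hVm, hcV, ?_, ?_, ?_⟩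
  · intro o v hz
    have := hρ₁s (o, v) (Metric.ball_subset_ball (min_le_right _ _) hz)
    exact congrArg Prod.snd this
  · rintro ⟨o, y⟩ ⟨ho, hy⟩
    exact (continuous_snd.continuousAt.comp (hin o ho y hy).2.2.continuousAt).continuousWithinAt
  · intro o ho y hy
    have hgd := ((hin o ho y hy).2.2.differentiableAt one_ne_zero).hasFDerivAt
    set A : E →L[ℝ] E := (ContinuousLinearMap.snd ℝ E E) ∘L fderiv ℝ g (o, y) ∘L
      ContinuousLinearMap.inr ℝ E E with hA
    have hV : HasFDerivAt (fun y => (g (o, y)).2) A y :=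
      (hgd.comp y (hasFDerivAt_prodMk_right o y)).snd
    have hz := hVm o ho y hy
    -- Differentiating `exp_o ∘ V o = id` shows that `A` is a right inverse of the differential of
    -- `exp_o`. The Gauss lemma with `w = A k` then identifies the gradient of the radial energy as
    -- twice the radial velocity.
    have hcA : ∀ k, (J (o, (g (o, y)).2) 1 (0, A k)).1 = k := by
      intro k
      have h1 : HasFDerivAt (fun y' => c o (g (o, y')).2 1)
          ((ContinuousLinearMap.fst ℝ E E ∘L J (o, (g (o, y)).2) 1) ∘L
            (ContinuousLinearMap.inr ℝ E E) ∘L A) y := by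
        have h2 : HasFDerivAt (fun y' => (o, (g (o, y')).2))
            (ContinuousLinearMap.inr ℝ E E ∘L A) y :=
          (hasFDerivAt_prodMk_right o (g (o, y)).2).comp y hV
        have h3 : HasFDerivAt (fun z : E × E => c z.1 z.2 1)
          (ContinuousLinearMap.fst ℝ E E ∘L J (o, (g (o, y)).2) 1) (o, (g (o, y)).2) :=
          (hf₂.hasFDerivAt _ hz 1 h1t).fst
        exact HasFDerivAt.comp (f := fun y' => (o, (g (o, y')).2)) y h3 h2
      have h2 : HasFDerivAt (fun y' => c o (g (o, y')).2 1) (ContinuousLinearMap.id ℝ E) y := by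
        refine (hasFDerivAt_id y).congr_of_eventuallyEq ?_
        filter_upwards [Metric.isOpen_ball.mem_nhds hy] with y' hy' using hcV o ho y' hy'
      exact DFunLike.congr_fun (h1.unique h2) k
    have h3 : HasFDerivAt (fun y => G o (g (o, y)).2 (g (o, y)).2) _ y :=
      ((G o).hasFDerivAt.comp y hV).clm_apply hV
    convert! h3 using 1
    ext k
    have h4 := hf₂.gauss h hz (A k)
    rw [hcA k, hcV o ho y hy] at h4
    have hoD : o ∈ D := by
      have := hf₂.mem _ hz 0 (by simp)
      rwa [hf₂.c_zero _ hz] at this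
    simp only [smul_apply, smul_eq_mul, h4, add_apply, ContinuousLinearMap.comp_apply,
      ContinuousLinearMap.flip_apply, Function.comp_apply]
    rw [(h.form o hoD).symm (A k)]
    ring

end NormalNeighbourhood

/-! ### Causal curves in a normal neighbourhood -/

section LocalCausality

variable {E : Type*} [NormedAddCommGroup E] [NormedSpace ℝ E] [FiniteDimensional ℝ E]
  {G : E → E →L[ℝ] E →L[ℝ] ℝ} {T : E → E} {D : Set E} {x₀ : E} {ρ : ℝ}
  {c d : E → E → ℝ → E} {J : E × E → ℝ → E × E →L[ℝ] E × E} {V : E → E → E} {N : Set E}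

/-- The length of the radial geodesic from `o` to `y`. -/
def radialLength (G : E → E →L[ℝ] E →L[ℝ] ℝ) (V : E → E → E) (o y : E) : ℝ :=
  √(-G o (V o y) (V o y))

lemma radialLength_nonneg (G : E → E →L[ℝ] E →L[ℝ] ℝ) (V : E → E → E) (o y : E) :
    0 ≤ radialLength G V o y := Real.sqrt_nonneg _

lemma IsGeodesicFlow.contDiffOn_c (h : IsLorentzOn G T D) (hf : IsGeodesicFlow G D x₀ ρ c d J)
    {z : E × E} (hz : z ∈ Metric.ball (x₀, (0 : E)) ρ) :
    ContDiffOn ℝ ∞ (c z.1 z.2) (Ioo (-2 : ℝ) 2) := by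
  intro t ht
  obtain ⟨a, ha⟩ := exists_between ht.1
  obtain ⟨b, hb⟩ := exists_between ht.2
  have hI : Icc a b ⊆ Ioo (-2 : ℝ) 2 := fun s hs => ⟨ha.1.trans_le hs.1, hs.2.trans_lt hb.2⟩
  have key : ContDiffOn ℝ ∞ (fun t => (c z.1 z.2 t, d z.1 z.2 t)) (Icc a b) := by
    refine ODE.contDiffOn_enat_Icc_of_hasDerivWithinAt (n := ⊤) (f := fun _ => geodesicField G)
      (u := D ×ˢ univ) ?_ (fun t ht => ?_) fun t ht => ⟨hf.mem z hz t (hI ht), trivial⟩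
    · exact h.contDiffOn_geodesicField.comp contDiffOn_snd fun p hp => hp.2
    · exact ((hf.hasDerivAt_c z hz t (hI ht)).prodMk
        (hf.hasDerivAt_d z hz t (hI ht))).hasDerivWithinAt
  exact (key.fst.contDiffAt (Icc_mem_nhds ha.2 hb.1)).contDiffWithinAt

lemma IsLorentzOn.continuousOn_apply (h : IsLorentzOn G T D) {X : Type*} [TopologicalSpace X]
    {s : Set X} {p u w : X → E} (hp : ContinuousOn p s) (hu : ContinuousOn u s)
    (hw : ContinuousOn w s) (hD : MapsTo p s D) :
    ContinuousOn (fun x => G (p x) (u x) (w x)) s :=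
  ((h.smooth.continuousOn.comp hp hD).clm_apply hu).clm_apply hw

/-- Timelike geodesics that are future directed at one point are future directed. -/
lemma IsGeodesicFlow.isFutureTimelike (h : IsLorentzOn G T D)
    (hf : IsGeodesicFlow G D x₀ ρ c d J) {o v : E}
    (hz : (o, v) ∈ Metric.ball (x₀, (0 : E)) ρ) (hv : IsFutureTimelike (G o) (T o) v)
    {t : ℝ} (ht : t ∈ Ioo (-2 : ℝ) 2) :
    IsFutureTimelike (G (c o v t)) (T (c o v t)) (d o v t) := by
  have hen : ∀ t ∈ Ioo (-2 : ℝ) 2, G (c o v t) (d o v t) (d o v t) < 0 := fun t ht =>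
    (hf.energy_eq h hz ht).trans_lt hv.1
  refine ⟨hen t ht, ?_⟩
  by_contra hneg
  push Not at hneg
  have hcc : ContinuousOn (c o v) (Ioo (-2 : ℝ) 2) := fun t ht =>
    (hf.hasDerivAt_c _ hz t ht).continuousAt.continuousWithinAt
  have hdc : ContinuousOn (d o v) (Ioo (-2 : ℝ) 2) := fun t ht =>
    (hf.hasDerivAt_d _ hz t ht).continuousAt.continuousWithinAt
  have hD : MapsTo (c o v) (Ioo (-2 : ℝ) 2) D := hf.mem _ hz
  have hcont : ContinuousOn (fun t => G (c o v t) (T (c o v t)) (d o v t)) (Ioo (-2 : ℝ) 2) :=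
    h.continuousOn_apply hcc (h.continuousOn.comp hcc hD) hdc hD
  have h0 : (0 : ℝ) ∈ Ioo (-2 : ℝ) 2 := by simp
  have hneg0 : G (c o v 0) (T (c o v 0)) (d o v 0) ≤ 0 := by
    have e1 := hf.c_zero _ hz
    have e2 := hf.d_zero _ hz
    simp only at e1 e2
    rw [e1, e2]
    exact hv.2.le
  -- A change of time orientation would produce a timelike velocity orthogonal to `T`, which is
  -- impossible.
  obtain ⟨s, hs, hs0⟩ := isPreconnected_Ioo.intermediate_value h0 ht hcont ⟨hneg0, hneg⟩
  exact ((h.form _ (hD hs)).neg_of_nonpos (hen s hs) hs0.le).ne hs0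

namespace IsNormalNhd

lemma subset (hN : IsNormalNhd G D x₀ ρ c d J V N) : N ⊆ D := by
  intro o ho
  have hz := hN.V_mem o ho o ho
  have := hN.flow.mem _ hz 0 (by simp)
  rwa [hN.flow.c_zero _ hz] at this

lemma radial_energy (h : IsLorentzOn G T D) (hN : IsNormalNhd G D x₀ ρ c d J V N) {o y : E}
    (ho : o ∈ N) (hy : y ∈ N) : G y (d o (V o y) 1) (d o (V o y) 1) = G o (V o y) (V o y) := by
  have := hN.flow.energy_eq h (hN.V_mem o ho y hy) (t := 1) (by norm_num)
  simpa only [hN.c_V o ho y hy] using this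

lemma radial_future (h : IsLorentzOn G T D) (hN : IsNormalNhd G D x₀ ρ c d J V N) {o y : E}
    (ho : o ∈ N) (hy : y ∈ N) (hv : IsFutureTimelike (G o) (T o) (V o y)) :
    IsFutureTimelike (G y) (T y) (d o (V o y) 1) := by
  have := hN.flow.isFutureTimelike h (hN.V_mem o ho y hy) hv (t := 1) (by norm_num)
  rwa [hN.c_V o ho y hy] at this

lemma radialLength_pos {o y : E} (hv : IsFutureTimelike (G o) (T o) (V o y)) :
    0 < radialLength G V o y := Real.sqrt_pos.2 (by linarith [hv.1])

lemma radialLength_sq {o y : E} (hv : IsFutureTimelike (G o) (T o) (V o y)) :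
    G o (V o y) (V o y) = -(radialLength G V o y) ^ 2 := by
  rw [radialLength, Real.sq_sqrt (by linarith [hv.1]), neg_neg]

lemma continuousOn_radial (hN : IsNormalNhd G D x₀ ρ c d J V N) {o : E} (ho : o ∈ N) :
    ContinuousOn (V o) N :=
  hN.continuousOn_V.comp (f := fun y => (o, y)) (by fun_prop) fun _ hy => ⟨ho, hy⟩

lemma hasDerivWithinAt_radial (hN : IsNormalNhd G D x₀ ρ c d J V N) {o : E} (ho : o ∈ N)
    {e : ℝ → E} {e' : E} {s : ℝ} {S : Set ℝ} (he : HasDerivWithinAt e e' S s) (hs : e s ∈ N) :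
    HasDerivWithinAt (fun s => G o (V o (e s)) (V o (e s)))
      (2 * G (e s) (d o (V o (e s)) 1) e') S s := by
  exact (hN.hasFDerivAt o ho _ hs).comp_hasDerivWithinAt s he

variable {e e' : ℝ → E} {a b : ℝ}

/-- A future directed causal curve that starts in the cone of `o` stays there. -/
lemma inCone_of_curve (h : IsLorentzOn G T D) (hN : IsNormalNhd G D x₀ ρ c d J V N)
    (he : ∀ s ∈ Icc a b, HasDerivWithinAt e (e' s) (Icc a b) s) (heN : MapsTo e (Icc a b) N)
    (hc : ∀ s ∈ Icc a b, IsFutureCausal (G (e s)) (T (e s)) (e' s)) {o : E} (ho : o ∈ N)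
    (h0 : IsFutureTimelike (G o) (T o) (V o (e a))) :
    ∀ s ∈ Icc a b, IsFutureTimelike (G o) (T o) (V o (e s)) := by
  rcases lt_or_ge b a with hab | hab
  · simp [Icc_eq_empty hab.not_ge]
  set f : ℝ → ℝ := fun s => G o (V o (e s)) (V o (e s)) with hf
  set k : ℝ → ℝ := fun s => G o (T o) (V o (e s)) with hk
  have hoD := hN.subset ho
  have hec : ContinuousOn e (Icc a b) := fun s hs => (he s hs).continuousWithinAt
  have hVc : ContinuousOn (fun s => V o (e s)) (Icc a b) := (hN.continuousOn_radial ho).comp hec heN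
  have hfc : ContinuousOn f (Icc a b) :=
    ((continuousOn_const (c := G o)).clm_apply hVc).clm_apply hVc
  have hkc : ContinuousOn k (Icc a b) := (G o (T o)).continuous.comp_continuousOn hVc
  -- The closed conditions `k ≤ 0` and `f ≤ f a` already imply the open cone condition because `f a
  -- < 0`. This drives a continuous induction: inside the cone `f` has nonpositive derivative by
  -- `inner_neg`, so the closed conditions persist a little further.
  have hup : ∀ s, k s ≤ 0 → f s ≤ f a → IsFutureTimelike (G o) (T o) (V o (e s)) :=
    fun s hs1 hs2 => ⟨hs2.trans_lt h0.1, (h.form o hoD).neg_of_nonpos (hs2.trans_lt h0.1) hs1⟩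
  have hsub : Icc a b ⊆ {s | s ∈ Icc a b ∧ k s ≤ 0 ∧ f s ≤ f a} := by
    refine IsClosed.Icc_subset_of_forall_exists_gt ?_ ?_ ?_
    · have h1 : IsClosed (Icc a b ∩ (fun s => (k s, f s)) ⁻¹' (Iic 0 ×ˢ Iic (f a))) :=
        (hkc.prodMk hfc).preimage_isClosed_of_isClosed isClosed_Icc (isClosed_Iic.prod isClosed_Iic)
      convert! h1 using 1
      ext s
      simp only [mem_inter_iff, mem_ofPred_eq, mem_preimage, mem_prod, mem_Iic]
      tauto
    · exact ⟨⟨le_rfl, hab⟩, h0.2.le, le_rfl⟩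
    · rintro s ⟨⟨hs, hks, hfs⟩, hsab⟩ y hy
      have hcone := hup s hks hfs
      have hnhds : ∀ᶠ t in 𝓝[Icc a b] s, f t < 0 ∧ k t < 0 :=
        ((hfc s hs).eventually_lt_const hcone.1).and ((hkc s hs).eventually_lt_const hcone.2)
      have h1 : ∀ᶠ t in 𝓝[≥] s, f t < 0 ∧ k t < 0 :=
        nhdsWithin_le_of_mem (Icc_mem_nhdsGE_of_mem hsab) hnhds
      obtain ⟨u, hu, hus⟩ := (mem_nhdsGE_iff_exists_Icc_subset).1 h1
      set t := min (min u y) b with ht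
      have hst : s < t := lt_min (lt_min hu hy) hsab.2
      have htu : t ≤ u := (min_le_left _ _).trans (min_le_left _ _)
      have hty : t ≤ y := (min_le_left _ _).trans (min_le_right _ _)
      have htb : t ≤ b := min_le_right _ _
      have hIcc : Icc s t ⊆ Icc a b := Icc_subset_Icc hs.1 htb
      have hanti : AntitoneOn f (Icc s t) := by
        refine antitoneOn_of_hasDerivWithinAt_nonpos (convex_Icc s t) (hfc.mono hIcc)
          (f' := fun r => 2 * G (e r) (d o (V o (e r)) 1) (e' r)) ?_ ?_
        · intro r hr
          have hr' := interior_subset hr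
          exact (hN.hasDerivWithinAt_radial ho (he r (hIcc hr')) (heN (hIcc hr'))).mono
            (interior_subset.trans hIcc)
        · intro r hr
          have hr' := interior_subset hr
          have hrN := heN (hIcc hr')
          have h2 := hus ⟨hr'.1, hr'.2.trans htu⟩
          have h3 := (h.form _ (hN.subset hrN)).inner_neg
            (hN.radial_future h ho hrN ⟨h2.1, h2.2⟩) (hc r (hIcc hr'))
          linarith
      have htI : t ∈ Icc s t := ⟨hst.le, le_rfl⟩
      refine ⟨t, ⟨hIcc htI, (hus ⟨hst.le, htu⟩).2.le, ?_⟩, hst, hty⟩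
      exact (hanti ⟨le_rfl, hst.le⟩ htI hst.le).trans hfs
  intro s hs
  exact hup s (hsub hs).2.1 (hsub hs).2.2

/-- The length of a causal curve in the cone of `o` is at most the increase of the radial
length. -/
lemma lintegral_le_of_curve (h : IsLorentzOn G T D) (hN : IsNormalNhd G D x₀ ρ c d J V N)
    (hab : a ≤ b)
    (he : ∀ s ∈ Icc a b, HasDerivWithinAt e (e' s) (Icc a b) s) (he' : ContinuousOn e' (Icc a b))
    (heN : MapsTo e (Icc a b) N)
    (hc : ∀ s ∈ Icc a b, IsFutureCausal (G (e s)) (T (e s)) (e' s)) {o : E} (ho : o ∈ N)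
    (h0 : IsFutureTimelike (G o) (T o) (V o (e a))) :
    ENNReal.ofReal (radialLength G V o (e a)) +
      ∫⁻ s in Icc a b, ENNReal.ofReal √(-G (e s) (e' s) (e' s)) ≤
      ENNReal.ofReal (radialLength G V o (e b)) := by
  have hcone := hN.inCone_of_curve h he heN hc ho h0
  have hec : ContinuousOn e (Icc a b) := fun s hs => (he s hs).continuousWithinAt
  have hVc : ContinuousOn (fun s => V o (e s)) (Icc a b) := (hN.continuousOn_radial ho).comp hec heN
  have hfc : ContinuousOn (fun s => radialLength G V o (e s)) (Icc a b) :=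
    (((continuousOn_const (c := G o)).clm_apply hVc).clm_apply hVc).neg.sqrt
  have hint : IntegrableOn (fun s => √(-G (e s) (e' s) (e' s))) (Icc a b) :=
    (h.continuousOn_apply hec he' he' (heN.mono_right hN.subset)).neg.sqrt.integrableOn_Icc
  -- The derivative of the radial length is `-G P e' / r`, where the radial velocity `P` satisfies
  -- `G P P = -r ^ 2`. Reverse Cauchy–Schwarz bounds it below by `√(-G e' e')`.
  have key := intervalIntegral.integral_le_sub_of_hasDeriv_right_of_le hab hfc
    (φ := fun s => √(-G (e s) (e' s) (e' s)))
    (g' := fun s => -(2 * G (e s) (d o (V o (e s)) 1) (e' s)) / (2 * radialLength G V o (e s)))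
    (fun s hs => by
      have hs' := Ioo_subset_Icc_self hs
      have h1 := hN.hasDerivWithinAt_radial ho (he s hs') (heN hs')
      have h2 := (h1.neg.sqrt (by have := (hcone s hs').1; simp only [Pi.neg_apply]; linarith))
      have h3 := h2.hasDerivAt (Icc_mem_nhds hs.1 hs.2)
      exact h3.hasDerivWithinAt)
    hint
    (fun s hs => by
      have hs' := Ioo_subset_Icc_self hs
      have hsN := heN hs'
      have h1 := (h.form _ (hN.subset hsN)).sqrt_mul_sqrt_le
        (hN.radial_future h ho hsN (hcone s hs')) (hc s hs')
      rw [hN.radial_energy h ho hsN] at h1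
      have h2 := radialLength_pos (hcone s hs')
      rw [le_div_iff₀ (by positivity)]
      change radialLength G V o (e s) * _ ≤ _ at h1
      linarith)
  rw [← ofReal_integral_eq_lintegral_ofReal hint (Eventually.of_forall fun _ => Real.sqrt_nonneg _),
    integral_Icc_eq_integral_Ioc, ← intervalIntegral.integral_of_le hab,
    ← ENNReal.ofReal_add (radialLength_nonneg G V _ _)
      (intervalIntegral.integral_nonneg hab fun _ _ => Real.sqrt_nonneg _)]
  exact ENNReal.ofReal_le_ofReal (by linarith)

/-- Points slightly in the past of `o`, from which `o` is in the cone. -/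
lemma eventually_exists_past (h : IsLorentzOn G T D) (hN : IsNormalNhd G D x₀ ρ c d J V N) {o : E}
    (ho : o ∈ N) : ∃ u : ℝ → E, Tendsto u (𝓝[>] 0) (𝓝 o) ∧
      ∀ᶠ s in 𝓝[>] 0, u s ∈ N ∧ IsFutureTimelike (G (u s)) (T (u s)) (V (u s) o) := by
  have hm1 : (-1 : ℝ) ∈ Ioo (-2 : ℝ) 2 := by norm_num
  have hz : (o, (0 : E)) ∈ Metric.ball (x₀, (0 : E)) ρ :=
    mem_ball_prod_zero.2 ⟨(mem_ball_prod_zero.1 (hN.V_mem o ho o ho)).1, by simpa using hN.flow.pos⟩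
  have hline : Tendsto (fun s : ℝ => ((o, s • T o), (-1 : ℝ))) (𝓝[>] 0) (𝓝 ((o, 0), -1)) := by
    have : Continuous fun s : ℝ => ((o, s • T o), (-1 : ℝ)) := by fun_prop
    have h1 := this.tendsto 0
    rw [zero_smul] at h1
    exact h1.mono_left nhdsWithin_le_nhds
  have hball : ∀ᶠ s : ℝ in 𝓝[>] 0, (o, s • T o) ∈ Metric.ball (x₀, (0 : E)) ρ :=
    (continuous_fst.tendsto _ |>.comp hline).eventually_mem (Metric.isOpen_ball.mem_nhds hz)
  have e0 : c o 0 (-1) = o ∧ d o 0 (-1) = 0 := by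
    have h1 := hN.flow.homog _ hz (-1) hm1 0 (by simp)
    have h2 := hN.flow.c_zero _ hz
    simp only [smul_zero, zero_mul, zero_smul] at h1 h2
    exact ⟨h1.1.trans h2, h1.2⟩
  have hcd := (hN.flow.continuousOn.continuousAt (x := ((o, 0), -1))
    ((Metric.isOpen_ball.prod isOpen_Ioo).mem_nhds ⟨hz, hm1⟩)).tendsto.comp hline
  simp only [e0.1, e0.2] at hcd
  have hc1 := (continuous_fst.tendsto _).comp hcd
  -- The past points lie on the geodesic through `o` with velocity `s • T o`, followed backwards for
  -- unit time. By `back` and `V_c` its velocity there is the radial vector pointing to `o`, and it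
  -- is still future timelike.
  refine ⟨fun s => c o (s • T o) (-1), hc1, ?_⟩
  filter_upwards [hball, hc1.eventually_mem (hN.isOpen.mem_nhds ho),
    hcd.eventually_mem (Metric.isOpen_ball.mem_nhds hz), self_mem_nhdsWithin] with s hs hsN hsb hs0
  refine ⟨hsN, ?_⟩
  have hb := hN.flow.back _ hs hsb
  have hV := hN.V_c _ _ hsb
  simp only [Function.comp_apply] at hb hV hsN
  rw [hb] at hV
  have hF : IsFutureTimelike (G o) (T o) (s • T o) :=
    IsFutureTimelike.smul ⟨(h.form o (hN.subset ho)).timelike, (h.form o (hN.subset ho)).timelike⟩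
      hs0
  have := hN.flow.isFutureTimelike h hs hF hm1
  rwa [← hV] at this

/-- If the radial lengths of consecutive radial geodesics add up, then they fit together to one
geodesic. -/
lemma smul_eq_of_add_eq (h : IsLorentzOn G T D) (hN : IsNormalNhd G D x₀ ρ c d J V N) {o y q : E}
    (ho : o ∈ N) (hy : y ∈ N) (hq : q ∈ N) (h1 : IsFutureTimelike (G o) (T o) (V o y))
    (h2 : IsFutureTimelike (G y) (T y) (V y q))
    (hseg : ∀ s ∈ Icc (0 : ℝ) 1, c y (V y q) s ∈ N)
    (hadd : radialLength G V o q = radialLength G V o y + radialLength G V y q) :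
    (radialLength G V y q)⁻¹ • V y q = (radialLength G V o y)⁻¹ • d o (V o y) 1 := by
  set α := radialLength G V o y with hα
  set β := radialLength G V y q with hβ
  have hα0 : 0 < α := radialLength_pos h1
  have hβ0 : 0 < β := radialLength_pos h2
  have hz := hN.V_mem y hy q hq
  have hsub : Icc (0 : ℝ) 1 ⊆ Ioo (-2 : ℝ) 2 := fun s hs => ⟨by linarith [hs.1], by linarith [hs.2]⟩
  set e := c y (V y q) with he
  set e' := d y (V y q) with he'
  have e0 : e 0 = y := hN.flow.c_zero _ hz
  have e1 : e 1 = q := hN.c_V y hy q hq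
  have ed : ∀ s ∈ Icc (0 : ℝ) 1, HasDerivAt e (e' s) s := fun s hs =>
    hN.flow.hasDerivAt_c _ hz s (hsub hs)
  have hft : ∀ s ∈ Icc (0 : ℝ) 1, IsFutureTimelike (G (e s)) (T (e s)) (e' s) := fun s hs =>
    hN.flow.isFutureTimelike h hz h2 (hsub hs)
  have hen : ∀ s ∈ Icc (0 : ℝ) 1, √(-G (e s) (e' s) (e' s)) = β := fun s hs => by
    have := hN.flow.energy_eq h hz (hsub hs)
    simp only at this
    rw [he, he', this]
    rfl
  have e'c : ContinuousOn e' (Icc 0 1) := fun s hs =>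
    (hN.flow.hasDerivAt_d _ hz s (hsub hs)).continuousAt.continuousWithinAt
  have hcone : ∀ s ∈ Icc (0 : ℝ) 1, IsFutureTimelike (G o) (T o) (V o (e s)) :=
    hN.inCone_of_curve h (fun s hs => (ed s hs).hasDerivWithinAt) hseg
      (fun s hs => (hft s hs).isFutureCausal) ho (by rwa [e0])
  -- Along the second geodesic, the radial length measured from `o` grows at least at rate `β`. Its
  -- total growth is exactly `β` by `hadd`, so it grows linearly.
  have hlen : ∀ r ∈ Icc (0 : ℝ) 1, ∀ s ∈ Icc (0 : ℝ) 1, r ≤ s →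
      (s - r) * β ≤ radialLength G V o (e s) - radialLength G V o (e r) := by
    intro r hr s hs hrs
    have hI : Icc r s ⊆ Icc 0 1 := Icc_subset_Icc hr.1 hs.2
    have h3 := hN.lintegral_le_of_curve h hrs (fun s hs => (ed s (hI hs)).hasDerivWithinAt)
      (e'c.mono hI) (fun s hs => hseg s (hI hs)) (fun s hs => (hft s (hI hs)).isFutureCausal) ho
      (hcone r hr)
    rw [setLIntegral_congr_fun (g := fun _ => ENNReal.ofReal β) measurableSet_Icc
      (fun s hs => by simp only; rw [hen s (hI hs)]), setLIntegral_const, Real.volume_Icc,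
      ← ENNReal.ofReal_mul hβ0.le] at h3
    rw [← ENNReal.ofReal_add (radialLength_nonneg G V _ _) (mul_nonneg hβ0.le (sub_nonneg.2 hrs)),
      ENNReal.ofReal_le_ofReal_iff (radialLength_nonneg G V _ _)] at h3
    linarith
  have heq : ∀ s ∈ Icc (0 : ℝ) 1, radialLength G V o (e s) = α + s * β := by
    intro s hs
    have h3 := hlen 0 (by simp) s hs hs.1
    have h4 := hlen s hs 1 (by simp) hs.2
    rw [e0] at h3
    rw [e1, hadd] at h4
    linarith
  have h0I : (0 : ℝ) ∈ Icc (0 : ℝ) 1 := by simp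
  have hd1 := (hN.hasDerivWithinAt_radial ho (ed 0 h0I).hasDerivWithinAt (hseg 0 h0I)
    (S := Icc 0 1))
  have hd2 := (hd1.neg.sqrt (by have := (hcone 0 h0I).1; simp only [Pi.neg_apply]; linarith))
  have hd3 : HasDerivWithinAt (fun s => α + s * β) β (Icc 0 1) 0 := by
    simpa using (((hasDerivAt_id (0 : ℝ)).mul_const β).const_add α).hasDerivWithinAt
  -- Comparing derivatives at the junction gives equality in the reverse Cauchy–Schwarz inequality
  -- between the arriving and the departing velocity, so they are parallel.
  have hd4 := (uniqueDiffOn_Icc_zero_one 0 h0I).eq_deriv _ hd2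
    (hd3.congr (fun s hs => heq s hs) (heq 0 h0I))
  have hP : G y (d o (V o y) 1) (d o (V o y) 1) = -α ^ 2 := by
    rw [hN.radial_energy h ho hy, radialLength_sq h1]
  have hV : G y (V y q) (V y q) = -β ^ 2 := radialLength_sq h2
  have e'0 : e' 0 = V y q := hN.flow.d_zero _ hz
  have hsq : √((-fun s => G o (V o (e s)) (V o (e s))) 0) = α := by
    simp only [Pi.neg_apply, e0]
    rfl
  rw [hsq, e0, e'0] at hd4
  have hPV : G y (d o (V o y) 1) (V y q) = -(α * β) := by
    field_simp at hd4
    linarith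
  have h5 := (h.form y (hN.subset hy)).eq_smul_of_sq_eq (v := d o (V o y) 1) (w := V y q)
    (by rw [hP]; nlinarith) (by rw [hP, hV, hPV]; ring)
  rw [h5, hPV, hP, smul_smul]
  congr 1
  field_simp

/-- Geodesics between points near `x₀` stay in `N`. -/
lemma eventually_segment (hN : IsNormalNhd G D x₀ ρ c d J V N) :
    ∀ᶠ p in 𝓝 (x₀, x₀), p.1 ∈ N ∧ p.2 ∈ N ∧ ∀ s ∈ Icc (0 : ℝ) 1, c p.1 (V p.1 p.2) s ∈ N := by
  have hz : (x₀, (0 : E)) ∈ Metric.ball (x₀, (0 : E)) ρ := Metric.mem_ball_self hN.flow.pos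
  have e0 : ∀ t ∈ Ioo (-2 : ℝ) 2, c x₀ 0 t = x₀ := by
    intro t ht
    have h1 := hN.flow.homog _ hz t ht 0 (by simp)
    have h2 := hN.flow.c_zero _ hz
    simp only [smul_zero, zero_mul, zero_smul] at h1 h2
    exact h1.1.trans h2
  have hV0 : V x₀ x₀ = 0 := by
    have := hN.V_c _ _ hz
    rwa [e0 1 (by norm_num)] at this
  have hopen : IsOpen ((N ×ˢ N) ×ˢ Ioo (-2 : ℝ) 2) := (hN.isOpen.prod hN.isOpen).prod isOpen_Ioo
  have hcont : ContinuousOn (fun p : (E × E) × ℝ => c p.1.1 (V p.1.1 p.1.2) p.2)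
      ((N ×ˢ N) ×ˢ Ioo (-2 : ℝ) 2) := by
    have h1 : ContinuousOn (fun p : (E × E) × ℝ => ((p.1.1, V p.1.1 p.1.2), p.2))
        ((N ×ˢ N) ×ˢ Ioo (-2 : ℝ) 2) := by
      refine ContinuousOn.prodMk (ContinuousOn.prodMk (by fun_prop) ?_) (by fun_prop)
      exact hN.continuousOn_V.comp (f := fun p : (E × E) × ℝ => p.1) (by fun_prop) fun p hp => hp.1
    exact continuous_fst.comp_continuousOn (hN.flow.continuousOn.comp h1
      fun p hp => ⟨hN.V_mem _ hp.1.1 _ hp.1.2, hp.2⟩)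
  have hNN : N ×ˢ N ∈ 𝓝 (x₀, x₀) := (hN.isOpen.prod hN.isOpen).mem_nhds ⟨hN.mem, hN.mem⟩
  -- At `(x₀, x₀)` the geodesic is constant. Compactness of `[0, 1]` makes the neighbourhood uniform
  -- in `s`.
  have key : ∀ᶠ p in 𝓝 (x₀, x₀), ∀ s ∈ Icc (0 : ℝ) 1, c p.1 (V p.1 p.2) s ∈ N := by
    refine isCompact_Icc.eventually_forall_of_forall_eventually fun s hs => ?_
    have hs' : s ∈ Ioo (-2 : ℝ) 2 := ⟨by linarith [hs.1], by linarith [hs.2]⟩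
    refine (hcont.continuousAt (hopen.mem_nhds (x := ((x₀, x₀), s))
      ⟨⟨hN.mem, hN.mem⟩, hs'⟩)).eventually_mem (hN.isOpen.mem_nhds ?_)
    simp only [hV0, e0 s hs', hN.mem]
  filter_upwards [hNN, key] with p hp hk using ⟨hp.1, hp.2, hk⟩

end IsNormalNhd

end LocalCausality

/-! ### The spacetime metric in a chart -/

namespace SpacetimeMetric

variable {n : ℕ} {M : Type*} [TopologicalSpace M]
  [ChartedSpace (EuclideanSpace ℝ (Fin n)) M] [IsManifold (𝓡 n) ∞ M] (g : SpacetimeMetric n M)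
  (x₁ : M)

/-- The derivative of the inverse of the chart around `x₁`. -/
def chartDeriv (x₁ : M) (y : EuclideanSpace ℝ (Fin n)) : EuclideanSpace ℝ (Fin n) →L[ℝ]
    EuclideanSpace ℝ (Fin n) :=
  letI : ChartedSpace (EuclideanSpace ℝ (Fin n)) (EuclideanSpace ℝ (Fin n)) := chartedSpaceSelf _
  mfderiv (𝓡 n) (𝓡 n) (extChartAt (𝓡 n) x₁).symm y

/-- The coordinate expression of the metric as a bilinear form. -/
def chartForm (y : EuclideanSpace ℝ (Fin n)) :
    EuclideanSpace ℝ (Fin n) →L[ℝ] EuclideanSpace ℝ (Fin n) →L[ℝ] ℝ :=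
  let B : EuclideanSpace ℝ (Fin n) →L[ℝ] EuclideanSpace ℝ (Fin n) →L[ℝ] ℝ :=
    g.metric ((extChartAt (𝓡 n) x₁).symm y)
  B.bilinearComp (chartDeriv x₁ y) (chartDeriv x₁ y)

/-- The coordinate expression of the time-orienting vector field. -/
def chartTime (y : EuclideanSpace ℝ (Fin n)) : EuclideanSpace ℝ (Fin n) :=
  (trivializationAt (EuclideanSpace ℝ (Fin n)) (TangentSpace (𝓡 n)) x₁
    ⟨(extChartAt (𝓡 n) x₁).symm y, g.timeField ((extChartAt (𝓡 n) x₁).symm y)⟩).2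

lemma chartForm_apply (y v w : EuclideanSpace ℝ (Fin n)) :
    g.chartForm x₁ y v w = g.metric ((extChartAt (𝓡 n) x₁).symm y) (chartDeriv x₁ y v)
      (chartDeriv x₁ y w) := rfl

lemma chartForm_eq_chartMetric (y v w : EuclideanSpace ℝ (Fin n)) :
    g.chartForm x₁ y v w = g.chartMetric x₁ y v w := rfl

variable {x₁} {y : EuclideanSpace ℝ (Fin n)}

/-- The derivative of the inverse chart is the inverse of the tangent bundle trivialisation. This
links the coordinate expressions of the statement to the bundle formulation in which smoothness of
the metric and continuity of the time field are given. -/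
lemma chartDeriv_eq_symmL (hy : y ∈ (extChartAt (𝓡 n) x₁).target) :
    chartDeriv x₁ y = (trivializationAt (EuclideanSpace ℝ (Fin n)) (TangentSpace (𝓡 n)) x₁).symmL ℝ
      ((extChartAt (𝓡 n) x₁).symm y) := by
  have hs := (extChartAt (𝓡 n) x₁).map_target hy
  rw [extChartAt_source] at hs
  rw [TangentBundle.symmL_trivializationAt hs, (extChartAt (𝓡 n) x₁).right_inv hy,
    ModelWithCorners.range_eq_univ, mfderivWithin_univ]
  rfl

lemma mem_baseSet_of_mem_target (hy : y ∈ (extChartAt (𝓡 n) x₁).target) :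
    (extChartAt (𝓡 n) x₁).symm y ∈ 
      (trivializationAt (EuclideanSpace ℝ (Fin n)) (TangentSpace (𝓡 n) (M := M)) x₁).baseSet := by
  have hs := (extChartAt (𝓡 n) x₁).map_target hy
  rwa [extChartAt_source] at hs

lemma chartDeriv_apply_eq_symm (hy : y ∈ (extChartAt (𝓡 n) x₁).target)
    (v : EuclideanSpace ℝ (Fin n)) : chartDeriv x₁ y v =
      (trivializationAt (EuclideanSpace ℝ (Fin n)) (TangentSpace (𝓡 n)) x₁).symm
      ((extChartAt (𝓡 n) x₁).symm y) v :=
  (DFunLike.congr_fun (chartDeriv_eq_symmL hy) v).trans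
    (Bundle.Trivialization.symmL_apply (R := ℝ) _ (mem_baseSet_of_mem_target hy) v)

lemma chartDeriv_chartTime (hy : y ∈ (extChartAt (𝓡 n) x₁).target) :
    chartDeriv x₁ y (g.chartTime x₁ y) = g.timeField ((extChartAt (𝓡 n) x₁).symm y) := by
  rw [chartDeriv_apply_eq_symm hy, chartTime]
  exact Bundle.Trivialization.symm_apply_apply_mk _ (mem_baseSet_of_mem_target hy) _

/-- The derivative of the inverse of the chart as a linear isomorphism. -/
lemma exists_chartDeriv_equiv (hy : y ∈ (extChartAt (𝓡 n) x₁).target) :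
    ∃ L : EuclideanSpace ℝ (Fin n) ≃L[ℝ] EuclideanSpace ℝ (Fin n),
      (L : EuclideanSpace ℝ (Fin n) →L[ℝ] EuclideanSpace ℝ (Fin n)) = chartDeriv x₁ y := by
  refine ⟨Bundle.Trivialization.continuousLinearEquivAt ℝ (trivializationAt
    (EuclideanSpace ℝ (Fin n)) (TangentSpace (𝓡 n)) x₁) _ (mem_baseSet_of_mem_target hy) |>.symm, ?_⟩
  ext1 v
  exact (chartDeriv_apply_eq_symm hy v).symm

lemma contDiffOn_chartForm (x₁ : M) :
    ContDiffOn ℝ ∞ (g.chartForm x₁) (extChartAt (𝓡 n) x₁).target := by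
  have h1 : ContMDiffOn (𝓡 n)
      𝓘(ℝ, EuclideanSpace ℝ (Fin n) →L[ℝ] EuclideanSpace ℝ (Fin n) →L[ℝ] ℝ) ∞
      (fun x : M => (trivializationAt
        (EuclideanSpace ℝ (Fin n) →L[ℝ] EuclideanSpace ℝ (Fin n) →L[ℝ] ℝ)
        (fun x : M => TangentSpace (𝓡 n) x →L[ℝ] TangentSpace (𝓡 n) x →L[ℝ] ℝ) x₁
        ⟨x, g.metric x⟩).2) (chartAt (EuclideanSpace ℝ (Fin n)) x₁).source :=
    (Bundle.Trivialization.contMDiffOn_section_iff (IB := 𝓡 n) (n := ∞)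
      (e := trivializationAt (EuclideanSpace ℝ (Fin n) →L[ℝ] EuclideanSpace ℝ (Fin n) →L[ℝ] ℝ)
        (fun x : M => TangentSpace (𝓡 n) x →L[ℝ] TangentSpace (𝓡 n) x →L[ℝ] ℝ) x₁) (s := g.metric)
      (a := (chartAt (EuclideanSpace ℝ (Fin n)) x₁).source) (chartAt _ x₁).open_source
      (fun x hx => ⟨hx, hx, trivial⟩)).1 g.smooth.contMDiffOn
  have h2 := (h1.comp (contMDiffOn_extChartAt_symm x₁)
    (fun y hy => mem_baseSet_of_mem_target hy)).contDiffOn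
  refine h2.congr fun y hy => ?_
  have hb := mem_baseSet_of_mem_target hy
  refine ContinuousLinearMap.ext fun v => ContinuousLinearMap.ext fun w => ?_
  refine Eq.symm ((inCoordinates_apply_eq₂ (F₁ := EuclideanSpace ℝ (Fin n))
    (F₂ := EuclideanSpace ℝ (Fin n)) (F₃ := ℝ) (E₃ := fun _ : M => ℝ) hb hb (mem_univ _)).trans ?_)
  refine (congrFun (congrArg DFunLike.coe
    (Bundle.Trivial.linearMapAt_trivialization ℝ _ ℝ _)) _).trans ?_
  rw [chartForm_apply, chartDeriv_apply_eq_symm hy, chartDeriv_apply_eq_symm hy]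
  rfl

lemma continuousOn_chartTime (x₁ : M) :
    ContinuousOn (g.chartTime x₁) (extChartAt (𝓡 n) x₁).target := by
  have h1 := g.continuous_timeField.continuousOn
    (s := (chartAt (EuclideanSpace ℝ (Fin n)) x₁).source)
  have h2 := (trivializationAt (EuclideanSpace ℝ (Fin n))
    (TangentSpace (𝓡 n)) x₁).continuousOn.comp h1 (fun x hx => by
      rw [Bundle.Trivialization.mem_source]; exact hx)
  exact continuous_snd.comp_continuousOn (h2.comp (continuousOn_extChartAt_symm (I := 𝓡 n) x₁)
    (fun y hy => mem_baseSet_of_mem_target hy))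

lemma eq_zero_of_chartDeriv_eq_zero (hy : y ∈ (extChartAt (𝓡 n) x₁).target)
    {w : EuclideanSpace ℝ (Fin n)} (hw : chartDeriv x₁ y w = 0) : w = 0 := by
  obtain ⟨L, hL⟩ := exists_chartDeriv_equiv hy
  rw [← hL] at hw
  exact L.injective (hw.trans (map_zero L).symm)

lemma chartForm_chartTime (hy : y ∈ (extChartAt (𝓡 n) x₁).target)
    (w : EuclideanSpace ℝ (Fin n)) : g.chartForm x₁ y (g.chartTime x₁ y) w =
      g.metric ((extChartAt (𝓡 n) x₁).symm y) (g.timeField ((extChartAt (𝓡 n) x₁).symm y))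
        (chartDeriv x₁ y w) := by
  rw [chartForm_apply, g.chartDeriv_chartTime hy]

lemma isLorentzForm_chart (hy : y ∈ (extChartAt (𝓡 n) x₁).target) :
    IsLorentzForm (g.chartForm x₁ y) (g.chartTime x₁ y) := by
  refine ⟨?_, ?_, ?_⟩
  · intro v w
    rw [chartForm_apply, chartForm_apply]
    exact g.symm _ _ _
  · rw [g.chartForm_chartTime hy, g.chartDeriv_chartTime hy]
    exact g.timelike_timeField _
  · intro w h0 hw
    rw [g.chartForm_chartTime hy] at h0
    rw [chartForm_apply]
    exact g.posDef_orthogonal _ _ h0 fun h => hw (eq_zero_of_chartDeriv_eq_zero hy h)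

lemma isLorentzOn_chart (x₁ : M) :
    IsLorentzOn (g.chartForm x₁) (g.chartTime x₁) (extChartAt (𝓡 n) x₁).target :=
  ⟨isOpen_extChartAt_target x₁, g.contDiffOn_chartForm x₁, g.continuousOn_chartTime x₁,
    fun _ hy => g.isLorentzForm_chart hy⟩

end SpacetimeMetric

/-! ### Velocities of curves in a chart -/

namespace SpacetimeMetric

variable {n : ℕ} {M : Type*} [TopologicalSpace M]
  [ChartedSpace (EuclideanSpace ℝ (Fin n)) M] [IsManifold (𝓡 n) ∞ M] (g : SpacetimeMetric n M)
  {x₁ : M}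

lemma hasMFDerivWithinAt_of_chart {γ : ℝ → M} {S : Set ℝ} {s : ℝ} {e' : EuclideanSpace ℝ (Fin n)}
    (hγ : ContinuousWithinAt γ S s) (hs : γ s ∈ (extChartAt (𝓡 n) x₁).source)
    (he : HasDerivWithinAt (fun s => extChartAt (𝓡 n) x₁ (γ s)) e' S s) :
    HasMFDerivWithinAt 𝓘(ℝ, ℝ) (𝓡 n) γ S s
      ((chartDeriv x₁ (extChartAt (𝓡 n) x₁ (γ s))).comp (ContinuousLinearMap.toSpanSingleton ℝ e')) := by
  let _ : ChartedSpace (EuclideanSpace ℝ (Fin n)) (EuclideanSpace ℝ (Fin n)) := chartedSpaceSelf _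
  have h1 : HasMFDerivWithinAt 𝓘(ℝ, ℝ) (𝓡 n) (fun s => extChartAt (𝓡 n) x₁ (γ s)) S s
      (ContinuousLinearMap.toSpanSingleton ℝ e') := he.hasFDerivWithinAt.hasMFDerivWithinAt
  have ht := (extChartAt (𝓡 n) x₁).map_source hs
  have h2 : HasMFDerivAt (𝓡 n) (𝓡 n) (extChartAt (𝓡 n) x₁).symm (extChartAt (𝓡 n) x₁ (γ s))
      (chartDeriv x₁ (extChartAt (𝓡 n) x₁ (γ s))) := by
    have := (contMDiffOn_extChartAt_symm (I := 𝓡 n) (n := ∞) x₁).contMDiffAt ((isOpen_extChartAt_target x₁).mem_nhds ht)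
    exact (this.mdifferentiableAt (by simp)).hasMFDerivAt
  have h3 := h2.comp_hasMFDerivWithinAt s h1
  refine h3.congr_of_eventuallyEq ?_ ?_
  · have := hγ.eventually_mem ((isOpen_extChartAt_source (I := 𝓡 n) x₁).mem_nhds hs)
    filter_upwards [this] with r hr
    exact ((extChartAt (𝓡 n) x₁).left_inv hr).symm
  · exact ((extChartAt (𝓡 n) x₁).left_inv hs).symm

lemma velocityWithin_eq_chartDeriv {γ : ℝ → M} {a b s : ℝ} {e' : EuclideanSpace ℝ (Fin n)}
    (hab : a < b) (hsI : s ∈ Icc a b)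
    (hγ : ContinuousWithinAt γ (Icc a b) s) (hs : γ s ∈ (extChartAt (𝓡 n) x₁).source)
    (he : HasDerivWithinAt (fun s => extChartAt (𝓡 n) x₁ (γ s)) e' (Icc a b) s) :
    (velocityWithin γ a b s : EuclideanSpace ℝ (Fin n)) =
      chartDeriv x₁ (extChartAt (𝓡 n) x₁ (γ s)) e' := by
  have h1 := (hasMFDerivWithinAt_of_chart hγ hs he).mfderivWithin
    ((uniqueDiffOn_Icc hab s hsI).uniqueMDiffWithinAt)
  have h2 := DFunLike.congr_fun h1 (1 : ℝ)
  refine h2.trans ?_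
  change chartDeriv x₁ (extChartAt (𝓡 n) x₁ (γ s)) ((1 : ℝ) • e') = _
  rw [one_smul]

lemma velocity_eq_chartDeriv {γ : ℝ → M} {s : ℝ} {e' : EuclideanSpace ℝ (Fin n)}
    (hγ : ContinuousAt γ s) (hs : γ s ∈ (extChartAt (𝓡 n) x₁).source)
    (he : HasDerivAt (fun s => extChartAt (𝓡 n) x₁ (γ s)) e' s) :
    (velocity γ s : EuclideanSpace ℝ (Fin n)) =
      chartDeriv x₁ (extChartAt (𝓡 n) x₁ (γ s)) e' := by
  have h1 := (hasMFDerivWithinAt_of_chart hγ.continuousWithinAt hs he.hasDerivWithinAt).hasMFDerivAt univ_mem |>.mfderiv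
  have h2 := DFunLike.congr_fun h1 (1 : ℝ)
  refine h2.trans ?_
  change chartDeriv x₁ (extChartAt (𝓡 n) x₁ (γ s)) ((1 : ℝ) • e') = _
  rw [one_smul]

lemma velocity_eq_velocityWithin {γ : ℝ → M} {a b s : ℝ} (hs : s ∈ Ioo a b) :
    velocity γ s = velocityWithin (n := n) γ a b s := by
  rw [velocity, velocityWithin, mfderivWithin_of_mem_nhds (Icc_mem_nhds hs.1 hs.2)]

lemma metric_eq_chartForm {x : M} (hx : x ∈ (extChartAt (𝓡 n) x₁).source)
    {v : TangentSpace (𝓡 n) x} {e' : EuclideanSpace ℝ (Fin n)}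
    (hv : (v : EuclideanSpace ℝ (Fin n)) = chartDeriv x₁ (extChartAt (𝓡 n) x₁ x) e') :
    g.metric x v v = g.chartForm x₁ (extChartAt (𝓡 n) x₁ x) e' e' := by
  rw [chartForm_apply, ← hv, (extChartAt (𝓡 n) x₁).left_inv hx]

lemma timeField_eq_chartForm {x : M} (hx : x ∈ (extChartAt (𝓡 n) x₁).source)
    {v : TangentSpace (𝓡 n) x} {e' : EuclideanSpace ℝ (Fin n)}
    (hv : (v : EuclideanSpace ℝ (Fin n)) = chartDeriv x₁ (extChartAt (𝓡 n) x₁ x) e') :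
    g.metric x (g.timeField x) v = g.chartForm x₁ (extChartAt (𝓡 n) x₁ x)
      (g.chartTime x₁ (extChartAt (𝓡 n) x₁ x)) e' := by
  rw [g.chartForm_chartTime ((extChartAt (𝓡 n) x₁).map_source hx), ← hv,
    (extChartAt (𝓡 n) x₁).left_inv hx]

section Piecewise

variable {P : ∀ x : M, TangentSpace (𝓡 n) x → Prop} {γ : ℝ → M} {a b : ℝ}

/-- `γ` is a `C¹` curve on `[a, b]` all of whose velocities satisfy `P`. -/
def IsC1With (P : ∀ x : M, TangentSpace (𝓡 n) x → Prop) (γ : ℝ → M) (a b : ℝ) : Prop :=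
  a < b ∧ ContMDiffOn 𝓘(ℝ, ℝ) (𝓡 n) 1 γ (Icc a b) ∧
    ∀ s ∈ Icc a b, P (γ s) (velocityWithin γ a b s)

lemma IsC1With.mono (h : IsC1With P γ a b) {c d : ℝ} (hac : a ≤ c) (hcd : c < d) (hdb : d ≤ b) :
    IsC1With P γ c d := by
  have hsub : Icc c d ⊆ Icc a b := Icc_subset_Icc hac hdb
  refine ⟨hcd, h.2.1.mono hsub, fun s hs => ?_⟩
  have e : velocityWithin (n := n) γ c d s = velocityWithin γ a b s := by
    rw [velocityWithin, velocityWithin, mfderivWithin_subset hsub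
      (uniqueDiffOn_Icc hcd s hs).uniqueMDiffWithinAt ((h.2.1 s (hsub hs)).mdifferentiableWithinAt one_ne_zero)]
  rw [e]
  exact h.2.2 s (hsub hs)

lemma IsC1With.isPiecewiseC1With (h : IsC1With P γ a b) : IsPiecewiseC1With P γ a b := by
  refine ⟨h.1, 1, fun i => a + i * (b - a), ?_, by simp, by simp, ?_⟩
  · intro i j hij
    have : (i : ℝ) < j := by exact_mod_cast hij
    have := mul_lt_mul_of_pos_right this (sub_pos.2 h.1)
    simp only
    linarith
  · intro i hi
    obtain rfl : i = 0 := by omega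
    simpa using h.2

end Piecewise

end SpacetimeMetric

/-! ### Concatenation of partitions -/

section Partition

/-- Partitions are initial parts of infinite sequences, so whatever `t₁` does beyond `N` is
discarded and replaced by the shifted `t₂`. -/
lemma exists_partition_append {t₁ t₂ : ℕ → ℝ} {N : ℕ} (h₁ : StrictMono t₁) (h₂ : StrictMono t₂)
    (h : t₁ N = t₂ 0) : ∃ t : ℕ → ℝ, StrictMono t ∧ (∀ i ≤ N, t i = t₁ i) ∧
      ∀ i, t (N + i) = t₂ i := by
  refine ⟨fun i => if i ≤ N then t₁ i else t₂ (i - N), strictMono_nat_of_lt_succ fun i => ?_,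
    fun i hi => if_pos hi, fun i => ?_⟩
  · rcases lt_trichotomy i N with hi | rfl | hi
    · simp only [hi.le, if_true, Nat.succ_le_of_lt hi]
      exact h₁ (Nat.lt_succ_self i)
    · simp only [le_refl, if_true, Nat.not_succ_le_self, if_false, h]
      exact h₂ (by omega)
    · simp only [hi.not_ge, if_false, (hi.trans (Nat.lt_succ_self i)).not_ge]
      exact h₂ (by omega)
  · rcases Nat.eq_zero_or_pos i with rfl | hi
    · simp [h]
    · have : ¬ N + i ≤ N := by omega
      simp [this]

end Partition

/-! ### Piecewise `C¹` curves and their lengths -/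

namespace SpacetimeMetric

section Piecewise

variable {n : ℕ} {M : Type*} [TopologicalSpace M]
  [ChartedSpace (EuclideanSpace ℝ (Fin n)) M] [IsManifold (𝓡 n) ∞ M]
  {P : ∀ x : M, TangentSpace (𝓡 n) x → Prop} {γ : ℝ → M} {a b : ℝ}

lemma IsPiecewiseC1With.trans {m : ℝ} (h₁ : IsPiecewiseC1With P γ a m)
    (h₂ : IsPiecewiseC1With P γ m b) : IsPiecewiseC1With P γ a b := by
  obtain ⟨ham, N₁, t₁, ht₁, ha, hm₁, hp₁⟩ := h₁
  obtain ⟨hmb, N₂, t₂, ht₂, hm₂, hb, hp₂⟩ := h₂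
  obtain ⟨t, ht, hl, hr⟩ := exists_partition_append ht₁ ht₂ (hm₁.trans hm₂.symm)
  refine ⟨ham.trans hmb, N₁ + N₂, t, ht, by rw [hl 0 (Nat.zero_le _), ha], by rw [hr, hb], ?_⟩
  intro i hi
  rcases lt_or_ge i N₁ with hiN | hiN
  · rw [hl i hiN.le, hl (i + 1) hiN]
    exact hp₁ i hiN
  · obtain ⟨j, rfl⟩ := Nat.exists_eq_add_of_le hiN
    rw [hr, add_assoc, hr]
    exact hp₂ j (by omega)

/-- Induction on the number of pieces, adding one `C¹` piece at the right end. Estimates proved for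
`C¹` curves in a chart pass to piecewise curves in this way. -/
lemma IsPiecewiseC1With.induction {Q : ℝ → ℝ → Prop} (h : IsPiecewiseC1With P γ a b)
    (piece : ∀ a b, IsC1With P γ a b → Q a b)
    (trans : ∀ a m b, IsPiecewiseC1With P γ a m → IsC1With P γ m b → Q a m → Q m b → Q a b) :
    Q a b := by
  obtain ⟨hab, N, t, ht, rfl, rfl, hp⟩ := h
  have hpc : ∀ i < N, IsC1With P γ (t i) (t (i + 1)) := fun i hi => ⟨ht (Nat.lt_succ_self i), hp i hi⟩
  have key : ∀ k, k + 1 ≤ N → IsPiecewiseC1With P γ (t 0) (t (k + 1)) ∧ Q (t 0) (t (k + 1)) := by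
    intro k
    induction k with
    | zero => exact fun h1 => ⟨(hpc 0 h1).isPiecewiseC1With, piece _ _ (hpc 0 h1)⟩
    | succ k ih =>
      intro h1
      have h2 := ih (by omega)
      have h3 := hpc (k + 1) h1
      exact ⟨h2.1.trans h3.isPiecewiseC1With, trans _ _ _ h2.1 h3 h2.2 (piece _ _ h3)⟩
  rcases Nat.eq_zero_or_pos N with rfl | hN
  · exact absurd hab (lt_irrefl _)
  · obtain ⟨k, rfl⟩ : ∃ k, N = k + 1 := ⟨N - 1, by omega⟩
    exact (key k le_rfl).2

lemma IsPiecewiseC1With.lt (h : IsPiecewiseC1With P γ a b) : a < b := h.1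

lemma IsPiecewiseC1With.mono (h : IsPiecewiseC1With P γ a b) :
    ∀ {c d : ℝ}, a ≤ c → c < d → d ≤ b → IsPiecewiseC1With P γ c d := by
  refine h.induction (Q := fun a b => ∀ {c d : ℝ}, a ≤ c → c < d → d ≤ b →
    IsPiecewiseC1With P γ c d) ?_ ?_
  · intro a b h c d hac hcd hdb
    exact (h.mono hac hcd hdb).isPiecewiseC1With
  · intro a m b _ _ h1 h2 c d hac hcd hdb
    rcases le_or_gt d m with hdm | hdm
    · exact h1 hac hcd hdm
    rcases le_or_gt m c with hmc | hmc
    · exact h2 hmc hcd hdb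
    · exact (h1 hac hmc le_rfl).trans (h2 le_rfl hdm hdb)

lemma IsPiecewiseC1With.imp {P' : ∀ x : M, TangentSpace (𝓡 n) x → Prop}
    (h : IsPiecewiseC1With P γ a b) (hP : ∀ x v, P x v → P' x v) : IsPiecewiseC1With P' γ a b := by
  obtain ⟨hab, N, t, ht, h0, hN, hp⟩ := h
  exact ⟨hab, N, t, ht, h0, hN, fun i hi => ⟨(hp i hi).1, fun s hs => hP _ _ ((hp i hi).2 s hs)⟩⟩

end Piecewise

section Length

variable {n : ℕ} {M : Type*} [TopologicalSpace M]
  [ChartedSpace (EuclideanSpace ℝ (Fin n)) M] [IsManifold (𝓡 n) ∞ M] (g : SpacetimeMetric n M)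
  {γ : ℝ → M} {a b : ℝ}

lemma curveLength_add {m : ℝ} (ham : a ≤ m) (hmb : m ≤ b) :
    g.curveLength γ a m + g.curveLength γ m b = g.curveLength γ a b := by
  simp only [curveLength, ← restrict_Ioc_eq_restrict_Icc]
  rw [← Ioc_union_Ioc_eq_Ioc ham hmb, lintegral_union measurableSet_Ioc (Ioc_disjoint_Ioc_of_le le_rfl)]

/-- For every partition, each `τ` term dominates the length of the corresponding piece, which
competes in the supremum defining `τ`. -/
lemma curveLength_le_length (h : IsPiecewiseC1With g.FutureCausal γ a b) :
    g.curveLength γ a b ≤ g.causalData.length γ a b := by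
  rw [CausalData.length]
  refine le_iInf fun N => le_iInf fun t => le_iInf fun ht => ?_
  obtain ⟨ht, rfl, rfl⟩ := ht
  have hτ : ∀ i < N, g.curveLength γ (t i) (t (i + 1)) ≤ g.causalData.τ (γ (t i)) (γ (t (i + 1))) := by
    intro i hi
    refine le_iSup_of_le γ (le_iSup_of_le (t i) (le_iSup_of_le (t (i + 1)) (le_iSup_of_le ⟨?_, rfl, rfl⟩ le_rfl)))
    exact h.mono (ht.monotone (Nat.zero_le i)) (ht (Nat.lt_succ_self i)) (ht.monotone hi)
  have key : ∀ k ≤ N, g.curveLength γ (t 0) (t k) ≤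
      ∑ i ∈ Finset.range k, g.causalData.τ (γ (t i)) (γ (t (i + 1))) := by
    intro k
    induction k with
    | zero => simp [curveLength]
    | succ k ih =>
      intro hk
      rw [← g.curveLength_add (ht.monotone (Nat.zero_le k)) (ht.monotone (Nat.le_succ k)),
        Finset.sum_range_succ]
      exact add_le_add (ih (by omega)) (hτ k hk)
  exact key N le_rfl

end Length

end SpacetimeMetric

/-! ### Length estimates carried from charts to the spacetime -/

namespace SpacetimeMetric

variable {n : ℕ} {M : Type*} [TopologicalSpace M]
  [ChartedSpace (EuclideanSpace ℝ (Fin n)) M] [IsManifold (𝓡 n) ∞ M] (g : SpacetimeMetric n M)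
  {x₁ : M} {γ : ℝ → M} {a b : ℝ}

lemma futureCausal_iff_chart {x : M} (hx : x ∈ (extChartAt (𝓡 n) x₁).source)
    {v : TangentSpace (𝓡 n) x} {e' : EuclideanSpace ℝ (Fin n)}
    (hv : (v : EuclideanSpace ℝ (Fin n)) = chartDeriv x₁ (extChartAt (𝓡 n) x₁ x) e') :
    g.FutureCausal x v ↔ IsFutureCausal (g.chartForm x₁ (extChartAt (𝓡 n) x₁ x))
      (g.chartTime x₁ (extChartAt (𝓡 n) x₁ x)) e' := by
  rw [FutureCausal, IsFutureCausal, g.metric_eq_chartForm hx hv, g.timeField_eq_chartForm hx hv]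

lemma futureTimelike_iff_chart {x : M} (hx : x ∈ (extChartAt (𝓡 n) x₁).source)
    {v : TangentSpace (𝓡 n) x} {e' : EuclideanSpace ℝ (Fin n)}
    (hv : (v : EuclideanSpace ℝ (Fin n)) = chartDeriv x₁ (extChartAt (𝓡 n) x₁ x) e') :
    g.FutureTimelike x v ↔ IsFutureTimelike (g.chartForm x₁ (extChartAt (𝓡 n) x₁ x))
      (g.chartTime x₁ (extChartAt (𝓡 n) x₁ x)) e' := by
  rw [FutureTimelike, IsFutureTimelike, g.metric_eq_chartForm hx hv, g.timeField_eq_chartForm hx hv]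

lemma contDiffOn_extChartAt_comp {k : WithTop ℕ∞} (hk : k ≤ ((⊤ : ℕ∞) : WithTop ℕ∞)) {S : Set ℝ}
    (h : ContMDiffOn 𝓘(ℝ, ℝ) (𝓡 n) k γ S) (hs : MapsTo γ S (extChartAt (𝓡 n) x₁).source) :
    ContDiffOn ℝ k (fun s => extChartAt (𝓡 n) x₁ (γ s)) S := by
  rw [extChartAt_source] at hs
  have : ContMDiffOn (𝓡 n) 𝓘(ℝ, EuclideanSpace ℝ (Fin n)) k (extChartAt (𝓡 n) x₁)
      (chartAt (EuclideanSpace ℝ (Fin n)) x₁).source := contMDiffOn_extChartAt.of_le hk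
  exact (this.comp h hs).contDiffOn

lemma contMDiffOn_extChartAt_symm_comp {k : WithTop ℕ∞} (hk : k ≤ ((⊤ : ℕ∞) : WithTop ℕ∞)) {S : Set ℝ}
    {e : ℝ → EuclideanSpace ℝ (Fin n)} (h : ContDiffOn ℝ k e S)
    (hs : MapsTo e S (extChartAt (𝓡 n) x₁).target) :
    ContMDiffOn 𝓘(ℝ, ℝ) (𝓡 n) k (fun s => (extChartAt (𝓡 n) x₁).symm (e s)) S := by
  have : ContMDiffOn 𝓘(ℝ, EuclideanSpace ℝ (Fin n)) (𝓡 n) k (extChartAt (𝓡 n) x₁).symm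
      (extChartAt (𝓡 n) x₁).target := (contMDiffOn_extChartAt_symm x₁).of_le hk
  exact this.comp h.contMDiffOn hs

lemma IsC1With.chart {P : ∀ x : M, TangentSpace (𝓡 n) x → Prop} (h : IsC1With P γ a b)
    (hs : MapsTo γ (Icc a b) (extChartAt (𝓡 n) x₁).source) :
    ∃ e' : ℝ → EuclideanSpace ℝ (Fin n), ContinuousOn e' (Icc a b) ∧ ∀ s ∈ Icc a b,
      HasDerivWithinAt (fun s => extChartAt (𝓡 n) x₁ (γ s)) (e' s) (Icc a b) s ∧
      (velocityWithin γ a b s : EuclideanSpace ℝ (Fin n)) =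
        chartDeriv x₁ (extChartAt (𝓡 n) x₁ (γ s)) (e' s) := by
  have h1 := contDiffOn_extChartAt_comp (x₁ := x₁) (by simp) h.2.1 hs
  refine ⟨derivWithin (fun s => extChartAt (𝓡 n) x₁ (γ s)) (Icc a b),
    h1.continuousOn_derivWithin (uniqueDiffOn_Icc h.1) le_rfl, fun s hsI => ?_⟩
  have h2 := ((h1.differentiableOn one_ne_zero) s hsI).hasDerivWithinAt
  exact ⟨h2, velocityWithin_eq_chartDeriv h.1 hsI (h.2.1.continuousOn s hsI) (hs hsI) h2⟩

lemma curveLength_eq_chart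
    (hs : MapsTo γ (Icc a b) (extChartAt (𝓡 n) x₁).source) {e' : ℝ → EuclideanSpace ℝ (Fin n)}
    (he : ∀ s ∈ Icc a b, (velocityWithin γ a b s : EuclideanSpace ℝ (Fin n)) =
        chartDeriv x₁ (extChartAt (𝓡 n) x₁ (γ s)) (e' s)) :
    g.curveLength γ a b = ∫⁻ s in Icc a b, ENNReal.ofReal
      √(-g.chartForm x₁ (extChartAt (𝓡 n) x₁ (γ s)) (e' s) (e' s)) := by
  -- Only in the interior do the two-sided and the one-sided velocity agree; the end points form a
  -- null set.
  rw [curveLength, ← restrict_Ioo_eq_restrict_Icc]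
  refine setLIntegral_congr_fun measurableSet_Ioo fun s hsI => ?_
  have hsI' := Ioo_subset_Icc_self hsI
  rw [g.metric_eq_chartForm (hs hsI') ((velocity_eq_velocityWithin hsI).trans (he s hsI'))]

section Normal

variable {p₀ : EuclideanSpace ℝ (Fin n)} {ρ : ℝ}
  {c d : EuclideanSpace ℝ (Fin n) → EuclideanSpace ℝ (Fin n) → ℝ → EuclideanSpace ℝ (Fin n)}
  {J : EuclideanSpace ℝ (Fin n) × EuclideanSpace ℝ (Fin n) → ℝ →
    EuclideanSpace ℝ (Fin n) × EuclideanSpace ℝ (Fin n) →L[ℝ]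
    EuclideanSpace ℝ (Fin n) × EuclideanSpace ℝ (Fin n)}
  {V : EuclideanSpace ℝ (Fin n) → EuclideanSpace ℝ (Fin n) → EuclideanSpace ℝ (Fin n)}
  {N : Set (EuclideanSpace ℝ (Fin n))}

/-- The cone condition at the right end is part of the conclusion so that the estimate can be
chained over the pieces of a curve. -/
lemma add_curveLength_le_of_isC1With
    (hN : IsNormalNhd (g.chartForm x₁) (extChartAt (𝓡 n) x₁).target p₀ ρ c d J V N)
    (h : IsC1With g.FutureCausal γ a b)
    (hs : MapsTo γ (Icc a b) ((extChartAt (𝓡 n) x₁).source ∩ extChartAt (𝓡 n) x₁ ⁻¹' N))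
    {o : EuclideanSpace ℝ (Fin n)} (ho : o ∈ N)
    (h0 : IsFutureTimelike (g.chartForm x₁ o) (g.chartTime x₁ o) (V o (extChartAt (𝓡 n) x₁ (γ a)))) :
    IsFutureTimelike (g.chartForm x₁ o) (g.chartTime x₁ o) (V o (extChartAt (𝓡 n) x₁ (γ b))) ∧
    ENNReal.ofReal (radialLength (g.chartForm x₁) V o (extChartAt (𝓡 n) x₁ (γ a))) +
      g.curveLength γ a b ≤
      ENNReal.ofReal (radialLength (g.chartForm x₁) V o (extChartAt (𝓡 n) x₁ (γ b))) := by
  have hs1 : MapsTo γ (Icc a b) (extChartAt (𝓡 n) x₁).source := fun s hsI => (hs hsI).1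
  obtain ⟨e', he'c, he'⟩ := h.chart hs1
  have hcausal : ∀ s ∈ Icc a b, IsFutureCausal (g.chartForm x₁ (extChartAt (𝓡 n) x₁ (γ s)))
      (g.chartTime x₁ (extChartAt (𝓡 n) x₁ (γ s))) (e' s) := fun s hsI =>
    (g.futureCausal_iff_chart (hs1 hsI) (he' s hsI).2).1 (h.2.2 s hsI)
  rw [g.curveLength_eq_chart hs1 fun s hsI => (he' s hsI).2]
  exact ⟨hN.inCone_of_curve (e := fun s => extChartAt (𝓡 n) x₁ (γ s)) (g.isLorentzOn_chart x₁)
    (fun s hsI => (he' s hsI).1) (fun s hsI => (hs hsI).2) hcausal ho h0 b ⟨h.1.le, le_rfl⟩,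
    hN.lintegral_le_of_curve (e := fun s => extChartAt (𝓡 n) x₁ (γ s)) (g.isLorentzOn_chart x₁)
    h.1.le (fun s hsI => (he' s hsI).1) he'c (fun s hsI => (hs hsI).2) hcausal ho h0⟩

lemma add_curveLength_le
    (hN : IsNormalNhd (g.chartForm x₁) (extChartAt (𝓡 n) x₁).target p₀ ρ c d J V N)
    (h : IsPiecewiseC1With g.FutureCausal γ a b) {o : EuclideanSpace ℝ (Fin n)} (ho : o ∈ N) :
    MapsTo γ (Icc a b) ((extChartAt (𝓡 n) x₁).source ∩ extChartAt (𝓡 n) x₁ ⁻¹' N) →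
    IsFutureTimelike (g.chartForm x₁ o) (g.chartTime x₁ o) (V o (extChartAt (𝓡 n) x₁ (γ a))) →
    IsFutureTimelike (g.chartForm x₁ o) (g.chartTime x₁ o) (V o (extChartAt (𝓡 n) x₁ (γ b))) ∧
    ENNReal.ofReal (radialLength (g.chartForm x₁) V o (extChartAt (𝓡 n) x₁ (γ a))) +
      g.curveLength γ a b ≤
      ENNReal.ofReal (radialLength (g.chartForm x₁) V o (extChartAt (𝓡 n) x₁ (γ b))) := by
  refine h.induction (Q := fun a b => 
    MapsTo γ (Icc a b) ((extChartAt (𝓡 n) x₁).source ∩ extChartAt (𝓡 n) x₁ ⁻¹' N) →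
    IsFutureTimelike (g.chartForm x₁ o) (g.chartTime x₁ o) (V o (extChartAt (𝓡 n) x₁ (γ a))) →
    IsFutureTimelike (g.chartForm x₁ o) (g.chartTime x₁ o) (V o (extChartAt (𝓡 n) x₁ (γ b))) ∧
    ENNReal.ofReal (radialLength (g.chartForm x₁) V o (extChartAt (𝓡 n) x₁ (γ a))) +
      g.curveLength γ a b ≤
      ENNReal.ofReal (radialLength (g.chartForm x₁) V o (extChartAt (𝓡 n) x₁ (γ b)))) ?_ ?_
  · exact fun a b h hs h0 => g.add_curveLength_le_of_isC1With hN h hs ho h0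
  · intro a m b h1 h2 ih1 ih2 hs h0
    obtain ⟨h3, h4⟩ := ih1 (hs.mono_left (Icc_subset_Icc le_rfl h2.1.le)) h0
    obtain ⟨h5, h6⟩ := ih2 (hs.mono_left (Icc_subset_Icc h1.lt.le le_rfl)) h3
    refine ⟨h5, le_trans ?_ h6⟩
    rw [← g.curveLength_add h1.lt.le h2.1.le, ← add_assoc]
    exact add_le_add h4 le_rfl

/-- In a normal neighbourhood causal curves are not longer than the radial geodesic. -/
lemma curveLength_le_radialLength
    (hN : IsNormalNhd (g.chartForm x₁) (extChartAt (𝓡 n) x₁).target p₀ ρ c d J V N)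
    (h : IsPiecewiseC1With g.FutureCausal γ a b)
    (hs : MapsTo γ (Icc a b) ((extChartAt (𝓡 n) x₁).source ∩ extChartAt (𝓡 n) x₁ ⁻¹' N)) :
    g.curveLength γ a b ≤ ENNReal.ofReal (radialLength (g.chartForm x₁) V
      (extChartAt (𝓡 n) x₁ (γ a)) (extChartAt (𝓡 n) x₁ (γ b))) ∧
    (0 < g.curveLength γ a b → IsFutureTimelike (g.chartForm x₁ (extChartAt (𝓡 n) x₁ (γ a)))
      (g.chartTime x₁ (extChartAt (𝓡 n) x₁ (γ a)))
      (V (extChartAt (𝓡 n) x₁ (γ a)) (extChartAt (𝓡 n) x₁ (γ b)))) := by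
  set o := extChartAt (𝓡 n) x₁ (γ a) with ho'
  set y := extChartAt (𝓡 n) x₁ (γ b) with hy'
  have ho : o ∈ N := (hs ⟨le_rfl, h.lt.le⟩).2
  have hy : y ∈ N := (hs ⟨h.lt.le, le_rfl⟩).2
  have hL := g.isLorentzOn_chart x₁
  -- The starting point does not lie in its own open cone, so the estimate is applied from points `u
  -- s` slightly in its past and then passed to the limit. Positive length restores strict
  -- timelikeness, which the limit alone would lose.
  obtain ⟨u, hu, hev⟩ := hN.eventually_exists_past hL ho
  have hlen : ∀ᶠ s in 𝓝[>] (0 : ℝ), IsFutureTimelike (g.chartForm x₁ (u s)) (g.chartTime x₁ (u s))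
      (V (u s) y) ∧ g.curveLength γ a b ≤
        ENNReal.ofReal (radialLength (g.chartForm x₁) V (u s) y) := by
    filter_upwards [hev] with s hs'
    obtain ⟨h1, h2⟩ := g.add_curveLength_le hN h hs'.1 hs hs'.2
    exact ⟨h1, le_trans le_add_self h2⟩
  have hND := hN.subset
  have hVy : ContinuousAt (fun u => V u y) o :=
    (hN.continuousOn_V.continuousAt ((hN.isOpen.prod hN.isOpen).mem_nhds ⟨ho, hy⟩)).comp
      (f := fun u => (u, y)) (by fun_prop)
  have hGo : ContinuousAt (g.chartForm x₁) o :=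
    hL.smooth.continuousOn.continuousAt (hL.isOpen.mem_nhds (hND ho))
  have hTo : ContinuousAt (g.chartTime x₁) o :=
    hL.continuousOn.continuousAt (hL.isOpen.mem_nhds (hND ho))
  have hr : ContinuousAt (fun u => radialLength (g.chartForm x₁) V u y) o :=
    (((hGo.clm_apply hVy).clm_apply hVy).neg).sqrt
  have hle : g.curveLength γ a b ≤ ENNReal.ofReal (radialLength (g.chartForm x₁) V o y) :=
    ge_of_tendsto ((ENNReal.continuous_ofReal.tendsto _).comp (hr.tendsto.comp hu))
      (hlen.mono fun s hs => hs.2)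
  refine ⟨hle, fun hpos => ?_⟩
  have h1 : 0 < radialLength (g.chartForm x₁) V o y := ENNReal.ofReal_pos.1 (hpos.trans_le hle)
  have h2 : g.chartForm x₁ o (V o y) (V o y) < 0 := by
    have := Real.sqrt_pos.1 h1
    linarith
  refine ⟨h2, (hL.form o (hND ho)).neg_of_nonpos h2 ?_⟩
  have h3 : ContinuousAt (fun u => g.chartForm x₁ u (g.chartTime x₁ u) (V u y)) o :=
    (hGo.clm_apply hTo).clm_apply hVy
  exact le_of_tendsto (h3.tendsto.comp hu) (hlen.mono fun s hs => hs.1.2.le)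

/-- The radial geodesic as a timelike curve. -/
lemma radial_timelike
    (hN : IsNormalNhd (g.chartForm x₁) (extChartAt (𝓡 n) x₁).target p₀ ρ c d J V N)
    {o y : EuclideanSpace ℝ (Fin n)} (ho : o ∈ N) (hy : y ∈ N)
    (h0 : IsFutureTimelike (g.chartForm x₁ o) (g.chartTime x₁ o) (V o y)) :
    IsC1With g.FutureTimelike (fun s => (extChartAt (𝓡 n) x₁).symm (c o (V o y) s)) 0 1 ∧
    ∀ s ∈ Icc (0 : ℝ) 1, ∀ t ∈ Icc (0 : ℝ) 1, s ≤ t →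
      g.curveLength (fun s => (extChartAt (𝓡 n) x₁).symm (c o (V o y) s)) s t =
      ENNReal.ofReal ((t - s) * radialLength (g.chartForm x₁) V o y) := by
  have hz := hN.V_mem o ho y hy
  have hL := g.isLorentzOn_chart x₁
  have hsub : Icc (0 : ℝ) 1 ⊆ Ioo (-2 : ℝ) 2 := fun s hs => ⟨by linarith [hs.1], by linarith [hs.2]⟩
  have hmem : ∀ s ∈ Icc (0 : ℝ) 1, c o (V o y) s ∈ (extChartAt (𝓡 n) x₁).target := fun s hs =>
    hN.flow.mem _ hz s (hsub hs)
  have hsource : MapsTo (fun s => (extChartAt (𝓡 n) x₁).symm (c o (V o y) s)) (Icc 0 1)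
      (extChartAt (𝓡 n) x₁).source := fun s hs => (extChartAt (𝓡 n) x₁).map_target (hmem s hs)
  have hinv : ∀ s ∈ Icc (0 : ℝ) 1, extChartAt (𝓡 n) x₁
      ((extChartAt (𝓡 n) x₁).symm (c o (V o y) s)) = c o (V o y) s := fun s hs =>
    (extChartAt (𝓡 n) x₁).right_inv (hmem s hs)
  have hsm : ContMDiffOn 𝓘(ℝ, ℝ) (𝓡 n) 1
      (fun s => (extChartAt (𝓡 n) x₁).symm (c o (V o y) s)) (Icc 0 1) :=
    contMDiffOn_extChartAt_symm_comp (by simp)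
      (((hN.flow.contDiffOn_c hL hz).mono hsub).of_le (by simp)) hmem
  have hv : ∀ s ∈ Icc (0 : ℝ) 1, (velocityWithin (fun s => (extChartAt (𝓡 n) x₁).symm (c o (V o y) s))
      0 1 s : EuclideanSpace ℝ (Fin n)) = chartDeriv x₁ (extChartAt (𝓡 n) x₁
      ((extChartAt (𝓡 n) x₁).symm (c o (V o y) s))) (d o (V o y) s) := by
    intro s hs
    refine velocityWithin_eq_chartDeriv one_pos hs (hsm.continuousOn s hs) (hsource hs) ?_
    exact (hN.flow.hasDerivAt_c _ hz s (hsub hs)).hasDerivWithinAt.congr hinv (hinv s hs)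
  have hft : ∀ s ∈ Icc (0 : ℝ) 1, g.FutureTimelike ((extChartAt (𝓡 n) x₁).symm (c o (V o y) s))
      (velocityWithin (fun s => (extChartAt (𝓡 n) x₁).symm (c o (V o y) s)) 0 1 s) := by
    intro s hs
    rw [g.futureTimelike_iff_chart (hsource hs) (hv s hs), hinv s hs]
    exact hN.flow.isFutureTimelike hL hz h0 (hsub hs)
  have hC1 : IsC1With g.FutureTimelike (fun s => (extChartAt (𝓡 n) x₁).symm (c o (V o y) s)) 0 1 :=
    ⟨one_pos, hsm, hft⟩
  refine ⟨hC1, fun s hs t ht hst => ?_⟩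
  have hsub' : Ioo s t ⊆ Ioo 0 1 := Ioo_subset_Ioo hs.1 ht.2
  rw [curveLength, ← restrict_Ioo_eq_restrict_Icc, setLIntegral_congr_fun (g := fun _ =>
    ENNReal.ofReal (radialLength (g.chartForm x₁) V o y)) measurableSet_Ioo, setLIntegral_const,
    Real.volume_Ioo, mul_comm, ENNReal.ofReal_mul (by linarith)]
  intro r hr
  have hr' := Ioo_subset_Icc_self (hsub' hr)
  have hen := hN.flow.energy_eq hL hz (hsub hr')
  simp only at hen ⊢
  rw [g.metric_eq_chartForm (hsource hr') ((velocity_eq_velocityWithin (hsub' hr)).trans (hv r hr')),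
    hinv r hr', hen, radialLength]

end Normal

end SpacetimeMetric

/-- Radial lengths add up along the curve, so `smul_eq_of_add_eq` shows that the unit direction from
`e m` to a later `e r` does not depend on `r`. Hence the curve after `m` is a single geodesic
through `e m`. As `m` is chosen before `t₀`, this covers a neighbourhood of `t₀`. -/
lemma IsNormalNhd.geodesic_of_radialLength_eq {E : Type*} [NormedAddCommGroup E] [NormedSpace ℝ E]
    [FiniteDimensional ℝ E] {G : E → E →L[ℝ] E →L[ℝ] ℝ} {T : E → E} {D : Set E} {x₀ : E} {ρ : ℝ}
    {c d : E → E → ℝ → E} {J : E × E → ℝ → E × E →L[ℝ] E × E} {V : E → E → E} {N : Set E}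
    (hL : IsLorentzOn G T D) (hN : IsNormalNhd G D x₀ ρ c d J V N) {e : ℝ → E} {l u t₀ : ℝ}
    (hlu : l < t₀ ∧ t₀ < u) (hmem : ∀ s ∈ Ioo l u, e s ∈ N)
    (key : ∀ s ∈ Ioo l u, ∀ t ∈ Ioo l u, s < t →
      IsFutureTimelike (G (e s)) (T (e s)) (V (e s) (e t)) ∧
      radialLength G V (e s) (e t) = t - s)
    (hseg : ∀ s ∈ Ioo l u, ∀ t ∈ Ioo l u, ∀ r ∈ Icc (0 : ℝ) 1, c (e s) (V (e s) (e t)) r ∈ N) :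
    ContDiffAt ℝ ∞ e t₀ ∧ deriv (deriv e) t₀ = geodesicAccel G (e t₀) (deriv e t₀) ∧
    G (e t₀) (deriv e t₀) (deriv e t₀) = -1 := by
  obtain ⟨s, hs⟩ := exists_between hlu.1
  obtain ⟨m, hm⟩ := exists_between hs.2
  obtain ⟨w, hw⟩ := exists_between hlu.2
  have hsI : s ∈ Ioo l u := ⟨hs.1, hs.2.trans hlu.2⟩
  have hmI : m ∈ Ioo l u := ⟨hs.1.trans hm.1, hm.2.trans hlu.2⟩
  have hwI : w ∈ Ioo l u := ⟨hlu.1.trans hw.1, hw.2⟩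
  have hmw : m < w := hm.2.trans hw.1
  -- The right hand side is the direction in which the geodesic from the earlier point `e s`
  -- arrives; it does not involve `r`.
  have hV : ∀ r ∈ Ioo m u, (r - m)⁻¹ • V (e m) (e r) =
      (m - s)⁻¹ • d (e s) (V (e s) (e m)) 1 := by
    intro r hr
    have hrI : r ∈ Ioo l u := ⟨hmI.1.trans hr.1, hr.2⟩
    obtain ⟨h1, h1'⟩ := key s hsI m hmI hm.1
    obtain ⟨h2, h2'⟩ := key m hmI r hrI hr.1
    obtain ⟨h3, h3'⟩ := key s hsI r hrI (hm.1.trans hr.1)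
    have := hN.smul_eq_of_add_eq hL (hmem s hsI) (hmem m hmI) (hmem r hrI) h1 h2
      (hseg m hmI r hrI) (by rw [h1', h2', h3']; ring)
    rwa [h1', h2'] at this
  set v := V (e m) (e w) with hv
  set q := e m with hq
  have hz : (q, v) ∈ Metric.ball (x₀, (0 : E)) ρ :=
    hN.V_mem _ (hmem m hmI) _ (hmem w hwI)
  have hwm : 0 < w - m := sub_pos.2 hmw
  have heq : ∀ r ∈ Ioo m w, e r = c q v ((w - m)⁻¹ * (r - m)) := by
    intro r hr
    have hrm : 0 < r - m := sub_pos.2 hr.1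
    have hrI : r ∈ Ioo l u := ⟨hmI.1.trans hr.1, hr.2.trans hw.2⟩
    have h1 := hV r ⟨hr.1, hr.2.trans hw.2⟩
    rw [← hV w ⟨hmw, hw.2⟩] at h1
    have h2 : V q (e r) = ((w - m)⁻¹ * (r - m)) • v := by
      rw [hv, mul_comm, mul_smul, ← h1, smul_inv_smul₀ hrm.ne']
    have h3 := hN.c_V _ (hmem m hmI) _ (hmem r hrI)
    rw [← h3, h2]
    have h4 := (hN.flow.homog _ hz 1 (by norm_num) ((w - m)⁻¹ * (r - m))
      ⟨by positivity, by rw [inv_mul_le_one₀ hwm]; linarith [hr.2]⟩).1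
    simpa only [mul_one] using h4
  have hIoo : ∀ r ∈ Ioo m w, (w - m)⁻¹ * (r - m) ∈ Ioo (-2 : ℝ) 2 := by
    intro r hr
    have hrm : 0 < r - m := sub_pos.2 hr.1
    have h1 : 0 < (w - m)⁻¹ * (r - m) := by positivity
    have h2 : (w - m)⁻¹ * (r - m) ≤ 1 := by rw [inv_mul_le_one₀ hwm]; linarith [hr.2]
    exact ⟨by linarith, by linarith⟩
  have ht₀ : t₀ ∈ Ioo m w := ⟨hm.2, hw.1⟩
  have hev : ∀ r ∈ Ioo m w, e =ᶠ[𝓝 r] fun r => c q v ((w - m)⁻¹ * (r - m)) := fun r hr =>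
    Filter.eventuallyEq_of_mem (isOpen_Ioo.mem_nhds hr) heq
  have hlin : ∀ r, HasDerivAt (fun r : ℝ => (w - m)⁻¹ * (r - m)) (w - m)⁻¹ r := fun r => by
    simpa using ((hasDerivAt_id r).sub_const m).const_mul (w - m)⁻¹
  have hd1 : ∀ r ∈ Ioo m w, HasDerivAt e ((w - m)⁻¹ • d q v ((w - m)⁻¹ * (r - m))) r := by
    intro r hr
    exact ((hN.flow.hasDerivAt_c _ hz _ (hIoo r hr)).scomp r (hlin r)).congr_of_eventuallyEq (hev r hr)
  have hde : deriv e =ᶠ[𝓝 t₀] fun r => (w - m)⁻¹ • d q v ((w - m)⁻¹ * (r - m)) :=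
    Filter.eventuallyEq_of_mem (isOpen_Ioo.mem_nhds ht₀) fun r hr => (hd1 r hr).deriv
  have hd2 : HasDerivAt (deriv e) ((w - m)⁻¹ • (w - m)⁻¹ • geodesicAccel (G)
      (c q v ((w - m)⁻¹ * (t₀ - m))) (d q v ((w - m)⁻¹ * (t₀ - m)))) t₀ :=
    (((hN.flow.hasDerivAt_d _ hz _ (hIoo t₀ ht₀)).scomp t₀ (hlin t₀)).const_smul
      (w - m)⁻¹).congr_of_eventuallyEq hde
  refine ⟨?_, ?_, ?_⟩
  · refine ContDiffAt.congr_of_eventuallyEq ?_ (hev t₀ ht₀)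
    refine ContDiffAt.comp (g := c q v) t₀ ?_ (ContDiff.contDiffAt (by fun_prop))
    exact (hN.flow.contDiffOn_c hL hz).contDiffAt (isOpen_Ioo.mem_nhds (hIoo t₀ ht₀))
  · rw [hd2.deriv, hde.self_of_nhds, geodesicAccel_smul, ← heq t₀ ht₀, smul_smul, pow_two]
  · have h1 := hN.flow.energy_eq hL hz (hIoo t₀ ht₀)
    have h2 := key m hmI w hwI hmw
    have h3 := IsNormalNhd.radialLength_sq h2.1
    simp only at h1
    rw [h2.2] at h3
    change G (e t₀) (deriv e t₀) (deriv e t₀) = -1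
    rw [hde.self_of_nhds, heq t₀ ht₀]
    simp only [map_smul, smul_apply, smul_eq_mul]
    rw [h1, h3]
    field_simp

/-! ### Local time separation, and curves that realise it -/

namespace SpacetimeMetric

variable {n : ℕ} {M : Type*} [TopologicalSpace M]
  [ChartedSpace (EuclideanSpace ℝ (Fin n)) M] [IsManifold (𝓡 n) ∞ M] (g : SpacetimeMetric n M)
  {x₀ x₁ : M} {γ : ℝ → M} {a b : ℝ}

/-- Strong causality at a point. -/
def StronglyCausalAt (x : M) : Prop :=
  ∀ U ∈ 𝓝 x, ∃ V ∈ 𝓝 x, V ⊆ U ∧ ∀ (γ : ℝ → M) (a b : ℝ) (p q : M), p ∈ V → q ∈ V →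
    g.CausalCurve γ a b p q → MapsTo γ (Icc a b) U

section Normal

variable {ρ : ℝ}
  {c d : EuclideanSpace ℝ (Fin n) → EuclideanSpace ℝ (Fin n) → ℝ → EuclideanSpace ℝ (Fin n)}
  {J : EuclideanSpace ℝ (Fin n) × EuclideanSpace ℝ (Fin n) → ℝ →
    EuclideanSpace ℝ (Fin n) × EuclideanSpace ℝ (Fin n) →L[ℝ]
    EuclideanSpace ℝ (Fin n) × EuclideanSpace ℝ (Fin n)}
  {V : EuclideanSpace ℝ (Fin n) → EuclideanSpace ℝ (Fin n) → EuclideanSpace ℝ (Fin n)}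
  {N : Set (EuclideanSpace ℝ (Fin n))}

lemma radial_endpoints {p₀ : EuclideanSpace ℝ (Fin n)}
    (hN : IsNormalNhd (g.chartForm x₁) (extChartAt (𝓡 n) x₁).target p₀ ρ c d J V N)
    {o y : M} (ho : o ∈ (extChartAt (𝓡 n) x₁).source) (hy : y ∈ (extChartAt (𝓡 n) x₁).source)
    (hoN : extChartAt (𝓡 n) x₁ o ∈ N) (hyN : extChartAt (𝓡 n) x₁ y ∈ N) :
    (extChartAt (𝓡 n) x₁).symm (c (extChartAt (𝓡 n) x₁ o)
      (V (extChartAt (𝓡 n) x₁ o) (extChartAt (𝓡 n) x₁ y)) 0) = o ∧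
    (extChartAt (𝓡 n) x₁).symm (c (extChartAt (𝓡 n) x₁ o)
      (V (extChartAt (𝓡 n) x₁ o) (extChartAt (𝓡 n) x₁ y)) 1) = y := by
  have h0 := hN.flow.c_zero _ (hN.V_mem _ hoN _ hyN)
  simp only at h0
  rw [h0, hN.c_V _ hoN _ hyN, (extChartAt (𝓡 n) x₁).left_inv ho,
    (extChartAt (𝓡 n) x₁).left_inv hy]
  exact ⟨rfl, rfl⟩

/-- Near a point of strong causality, the time separation is the length of radial geodesics. -/
theorem exists_nhds_tau_eq (hsc : g.StronglyCausalAt x₀)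
    (hx₀ : x₀ ∈ (extChartAt (𝓡 n) x₁).source)
    (hN : IsNormalNhd (g.chartForm x₁) (extChartAt (𝓡 n) x₁).target
      (extChartAt (𝓡 n) x₁ x₀) ρ c d J V N) :
    ∃ W ∈ 𝓝 x₀, W ⊆ (extChartAt (𝓡 n) x₁).source ∧ ∀ o ∈ W, ∀ y ∈ W,
      extChartAt (𝓡 n) x₁ o ∈ N ∧ extChartAt (𝓡 n) x₁ y ∈ N ∧
      (∀ s ∈ Icc (0 : ℝ) 1, c (extChartAt (𝓡 n) x₁ o)
        (V (extChartAt (𝓡 n) x₁ o) (extChartAt (𝓡 n) x₁ y)) s ∈ N) ∧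
      (0 < g.causalData.τ o y → IsFutureTimelike (g.chartForm x₁ (extChartAt (𝓡 n) x₁ o))
        (g.chartTime x₁ (extChartAt (𝓡 n) x₁ o))
        (V (extChartAt (𝓡 n) x₁ o) (extChartAt (𝓡 n) x₁ y))) ∧
      (IsFutureTimelike (g.chartForm x₁ (extChartAt (𝓡 n) x₁ o))
        (g.chartTime x₁ (extChartAt (𝓡 n) x₁ o))
        (V (extChartAt (𝓡 n) x₁ o) (extChartAt (𝓡 n) x₁ y)) →
        g.causalData.τ o y = ENNReal.ofReal (radialLength (g.chartForm x₁) V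
          (extChartAt (𝓡 n) x₁ o) (extChartAt (𝓡 n) x₁ y))) := by
  have hcont : ContinuousAt (extChartAt (𝓡 n) x₁) x₀ := continuousAt_extChartAt' hx₀
  obtain ⟨W₁, hW₁, hW₁s⟩ : ∃ W ∈ 𝓝 x₀, ∀ o ∈ W, ∀ y ∈ W,
      extChartAt (𝓡 n) x₁ o ∈ N ∧ extChartAt (𝓡 n) x₁ y ∈ N ∧
      (∀ s ∈ Icc (0 : ℝ) 1, c (extChartAt (𝓡 n) x₁ o)
        (V (extChartAt (𝓡 n) x₁ o) (extChartAt (𝓡 n) x₁ y)) s ∈ N) := by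
    have h0 : Tendsto (Prod.map (extChartAt (𝓡 n) x₁) (extChartAt (𝓡 n) x₁)) (𝓝 (x₀, x₀))
        (𝓝 (extChartAt (𝓡 n) x₁ x₀, extChartAt (𝓡 n) x₁ x₀)) := by
      rw [nhds_prod_eq, nhds_prod_eq]
      exact hcont.tendsto.prodMap hcont.tendsto
    have h1 := h0.eventually hN.eventually_segment
    obtain ⟨A, hA, B, hB, hAB⟩ := mem_nhds_prod_iff.1 h1
    refine ⟨A ∩ B, inter_mem hA hB, fun o ho y hy => ?_⟩
    exact hAB (mk_mem_prod ho.1 hy.2)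
  have hU : (extChartAt (𝓡 n) x₁).source ∩ extChartAt (𝓡 n) x₁ ⁻¹' N ∈ 𝓝 x₀ :=
    inter_mem (extChartAt_source_mem_nhds' hx₀) (hcont.preimage_mem_nhds (hN.isOpen.mem_nhds hN.mem))
  obtain ⟨W₂, hW₂, hW₂U, hW₂s⟩ := hsc _ hU
  -- On `W₂`, strong causality keeps every causal curve between `o` and `y` in the normal
  -- neighbourhood, so the radial length bounds all competitors. On `W₁` the radial geodesic stays
  -- inside that neighbourhood.
  refine ⟨W₁ ∩ W₂, inter_mem hW₁ hW₂, fun x hx => (hW₂U hx.2).1, fun o ho y hy => ?_⟩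
  obtain ⟨hoN, hyN, hseg⟩ := hW₁s o ho.1 y hy.1
  have hcurve : ∀ γ a b, g.CausalCurve γ a b o y → g.curveLength γ a b ≤
      ENNReal.ofReal (radialLength (g.chartForm x₁) V
        (extChartAt (𝓡 n) x₁ o) (extChartAt (𝓡 n) x₁ y)) ∧
      (0 < g.curveLength γ a b → IsFutureTimelike (g.chartForm x₁ (extChartAt (𝓡 n) x₁ o))
        (g.chartTime x₁ (extChartAt (𝓡 n) x₁ o))
        (V (extChartAt (𝓡 n) x₁ o) (extChartAt (𝓡 n) x₁ y))) := by
    intro γ a b h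
    have h1 := hW₂s γ a b o y ho.2 hy.2 h
    obtain ⟨h2, rfl, rfl⟩ := h
    exact g.curveLength_le_radialLength hN h2 h1
  refine ⟨hoN, hyN, hseg, fun hpos => ?_, fun hft => le_antisymm ?_ ?_⟩
  · simp only [causalData, lt_iSup_iff] at hpos
    obtain ⟨γ, a, b, h, hpos⟩ := hpos
    exact (hcurve γ a b h).2 hpos
  · exact iSup_le fun γ => iSup_le fun a => iSup_le fun b => iSup_le fun h => (hcurve γ a b h).1
  · obtain ⟨h1, h2⟩ := g.radial_timelike hN hoN hyN hft
    obtain ⟨e0, e1⟩ := g.radial_endpoints hN (hW₂U ho.2).1 (hW₂U hy.2).1 hoN hyN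
    have h3 := h2 0 (by simp) 1 (by simp) zero_le_one
    rw [sub_zero, one_mul] at h3
    rw [← h3]
    exact le_iSup_of_le _ (le_iSup_of_le 0 (le_iSup_of_le 1 (le_iSup_of_le
      ⟨h1.isPiecewiseC1With.imp fun x v hv => ⟨hv.1.le, hv.2⟩, e0, e1⟩ le_rfl)))

end Normal

/-- The geodesic equation in the chart around `x₁`. -/
lemma geodesic_equation_of_accel {e : ℝ → EuclideanSpace ℝ (Fin n)} {t : ℝ}
    (hD : e t ∈ (extChartAt (𝓡 n) x₁).target)
    (he : deriv (deriv e) t = geodesicAccel (g.chartForm x₁) (e t) (deriv e t))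
    (w : EuclideanSpace ℝ (Fin n)) :
    g.chartMetric x₁ (e t) (deriv (deriv e) t) w
      + g.christoffel x₁ (e t) (deriv e t) (deriv e t) w = 0 := by
  have hL := g.isLorentzOn_chart x₁
  have hd : DifferentiableAt ℝ (g.chartForm x₁) (e t) :=
    (hL.smooth.contDiffAt (hL.isOpen.mem_nhds hD)).differentiableAt (by simp)
  have hf : ∀ v w u, fderiv ℝ (fun z => g.chartMetric x₁ z v w) (e t) u =
      fderiv ℝ (g.chartForm x₁) (e t) u v w := by
    intro v w u
    have h1 := (hd.hasFDerivAt.clm_apply (hasFDerivAt_const v _)).clm_apply (hasFDerivAt_const w _)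
    have h2 : HasFDerivAt (fun z => g.chartMetric x₁ z v w) _ (e t) := h1
    rw [h2.fderiv]
    simp
  rw [christoffel, hf, hf, ← chartForm_eq_chartMetric, he, hL.accel_eq hD]
  ring

lemma chart_geodesic_of_tau_eq {C : ℝ → M} {t₀ : ℝ} (hC : ContinuousAt C t₀)
    (hsc : g.StronglyCausalAt (C t₀)) (hx₁ : C t₀ ∈ (extChartAt (𝓡 n) x₁).source)
    {S : Set ℝ} (hS : S ∈ 𝓝 t₀) (hτ : ∀ x ∈ S, ∀ y ∈ S, x < y →
      g.causalData.τ (C x) (C y) = ENNReal.ofReal (y - x)) :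
    ContDiffAt ℝ ∞ (fun s => extChartAt (𝓡 n) x₁ (C s)) t₀ ∧
    deriv (deriv fun s => extChartAt (𝓡 n) x₁ (C s)) t₀ =
      geodesicAccel (g.chartForm x₁) (extChartAt (𝓡 n) x₁ (C t₀))
        (deriv (fun s => extChartAt (𝓡 n) x₁ (C s)) t₀) ∧
    g.chartForm x₁ (extChartAt (𝓡 n) x₁ (C t₀)) (deriv (fun s => extChartAt (𝓡 n) x₁ (C s)) t₀)
      (deriv (fun s => extChartAt (𝓡 n) x₁ (C s)) t₀) = -1 := by
  have hL := g.isLorentzOn_chart x₁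
  obtain ⟨ρ, c, d, J, V, N, hN⟩ := hL.exists_normalNhd ((extChartAt (𝓡 n) x₁).map_source hx₁)
  obtain ⟨W, hW, hWs, hWτ⟩ := g.exists_nhds_tau_eq hsc hx₁ hN
  obtain ⟨l, u, hlu, hI⟩ := mem_nhds_iff_exists_Ioo_subset.1
    (inter_mem (hC.preimage_mem_nhds hW) hS)
  set e : ℝ → EuclideanSpace ℝ (Fin n) := fun s => extChartAt (𝓡 n) x₁ (C s) with he
  have key : ∀ s ∈ Ioo l u, ∀ t ∈ Ioo l u, s < t →
      IsFutureTimelike (g.chartForm x₁ (e s)) (g.chartTime x₁ (e s)) (V (e s) (e t)) ∧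
      radialLength (g.chartForm x₁) V (e s) (e t) = t - s := by
    intro s hs t ht hst
    have h1 : g.causalData.τ (C s) (C t) = ENNReal.ofReal (t - s) :=
      hτ s (hI hs).2 t (hI ht).2 hst
    obtain ⟨-, -, -, h2, h3⟩ := hWτ (C s) (hI hs).1 (C t) (hI ht).1
    have h4 := h2 (by rw [h1]; exact ENNReal.ofReal_pos.2 (sub_pos.2 hst))
    refine ⟨h4, ?_⟩
    have h5 := (h3 h4).symm.trans h1
    exact (ENNReal.ofReal_eq_ofReal_iff (radialLength_nonneg _ _ _ _) (sub_nonneg.2 hst.le)).1 h5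
  have hmem : ∀ s ∈ Ioo l u, e s ∈ N := fun s hs => (hWτ _ (hI hs).1 _ (hI hs).1).1
  exact hN.geodesic_of_radialLength_eq hL hlu hmem key
    fun s hs t ht => (hWτ _ (hI hs).1 _ (hI ht).1).2.2.1

/-- A continuous curve along which the time separation is the difference of the parameters is a
timelike geodesic. -/
theorem isGeodesicOn_of_tau_eq {C : ℝ → M} {α β : ℝ} (hC : ContinuousOn C (Ioo α β))
    (hsc : g.IsStronglyCausal) (hτ : ∀ x ∈ Ioo α β, ∀ y ∈ Ioo α β, x < y →
      g.causalData.τ (C x) (C y) = ENNReal.ofReal (y - x)) :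
    g.IsGeodesicOn C (Ioo α β) ∧
      ∀ t ∈ Ioo α β, g.metric (C t) (velocity C t) (velocity C t) = -1 := by
  -- The geodesic equation is required in every chart around the point, so the normal neighbourhood
  -- is built in an arbitrary chart rather than the preferred one.
  have key : ∀ t ∈ Ioo α β, ∀ x₁ : M, C t ∈ (extChartAt (𝓡 n) x₁).source → _ :=
    fun t ht x₁ hx₁ => g.chart_geodesic_of_tau_eq (hC.continuousAt (isOpen_Ioo.mem_nhds ht))
      (hsc (C t)) hx₁ (isOpen_Ioo.mem_nhds ht) hτ
  refine ⟨⟨isOpen_Ioo, fun t ht => ?_, fun t ht x₁ hx₁ w => ?_⟩, fun t ht => ?_⟩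
  · have hs := mem_extChartAt_source (I := 𝓡 n) (C t)
    have h1 := (key t ht (C t) hs).1
    have h2 : ContMDiffAt 𝓘(ℝ, ℝ) (𝓡 n) ∞
        (fun s => (extChartAt (𝓡 n) (C t)).symm (extChartAt (𝓡 n) (C t) (C s))) t := by
      have h3 := (contMDiffOn_extChartAt_symm (I := 𝓡 n) (n := ∞) (C t)).contMDiffAt
        ((isOpen_extChartAt_target (C t)).mem_nhds ((extChartAt (𝓡 n) (C t)).map_source hs))
      exact ContMDiffAt.comp (g := (extChartAt (𝓡 n) (C t)).symm) t h3 h1.contMDiffAt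
    refine (h2.congr_of_eventuallyEq ?_).contMDiffWithinAt
    filter_upwards [(hC.continuousAt (isOpen_Ioo.mem_nhds ht)).preimage_mem_nhds
      (extChartAt_source_mem_nhds (I := 𝓡 n) (C t))] with s hs'
    exact ((extChartAt (𝓡 n) (C t)).left_inv hs').symm
  · exact g.geodesic_equation_of_accel (e := fun s => extChartAt (𝓡 n) x₁ (C s))
      ((extChartAt (𝓡 n) x₁).map_source hx₁) (key t ht x₁ hx₁).2.1 w
  · have hs := mem_extChartAt_source (I := 𝓡 n) (C t)
    obtain ⟨h1, -, h3⟩ := key t ht (C t) hs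
    rw [g.metric_eq_chartForm hs (velocity_eq_chartDeriv
      (hC.continuousAt (isOpen_Ioo.mem_nhds ht)) hs
      (h1.differentiableAt (by simp)).hasDerivAt), h3]

end SpacetimeMetric

/-! ### Lipschitz curves and time separation in an extension -/

namespace SpacetimeMetric

section Metric

variable {n : ℕ} {M : Type*} [MetricSpace M]
  [ChartedSpace (EuclideanSpace ℝ (Fin n)) M]

variable (n M) in
/-- `C¹` curves on compact intervals are Lipschitz. -/
def C1CurvesLipschitz : Prop := ∀ (γ : ℝ → M) (a b : ℝ), a < b →
  ContMDiffOn 𝓘(ℝ, ℝ) (𝓡 n) 1 γ (Icc a b) → ∃ K, LipschitzOnWith K γ (Icc a b)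

variable [IsManifold (𝓡 n) ∞ M] {g : SpacetimeMetric n M} {γ : ℝ → M} {a b : ℝ}

lemma _root_.LipschitzOnWith.union_Icc {X : Type*} [PseudoMetricSpace X] {f : ℝ → X} {a m b : ℝ}
    {K₁ K₂ : ℝ≥0} (h₁ : LipschitzOnWith K₁ f (Icc a m)) (h₂ : LipschitzOnWith K₂ f (Icc m b))
    (ham : a ≤ m) (hmb : m ≤ b) : LipschitzOnWith (max K₁ K₂) f (Icc a b) := by
  have h₁' := h₁.weaken (le_max_left K₁ K₂)
  have h₂' := h₂.weaken (le_max_right K₁ K₂)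
  have key : ∀ x ∈ Icc a b, ∀ y ∈ Icc a b, x ≤ y → dist (f x) (f y) ≤ max K₁ K₂ * dist x y := by
    intro x hx y hy hxy
    rcases le_total y m with hym | hym
    · exact h₁'.dist_le_mul x ⟨hx.1, hxy.trans hym⟩ y ⟨hy.1, hym⟩
    rcases le_total m x with hmx | hmx
    · exact h₂'.dist_le_mul x ⟨hmx, hx.2⟩ y ⟨hym, hy.2⟩
    · have h3 := h₁'.dist_le_mul x ⟨hx.1, hmx⟩ m ⟨ham, le_rfl⟩
      have h4 := h₂'.dist_le_mul m ⟨le_rfl, hmb⟩ y ⟨hym, hy.2⟩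
      have h5 := dist_triangle (f x) (f m) (f y)
      have e : dist x y = dist x m + dist m y := by
        rw [Real.dist_eq, Real.dist_eq, Real.dist_eq, abs_of_nonpos (by linarith),
          abs_of_nonpos (by linarith), abs_of_nonpos (by linarith)]
        ring
      rw [e, mul_add]
      linarith
  refine LipschitzOnWith.of_dist_le_mul fun x hx y hy => ?_
  rcases le_total x y with h | h
  · exact key x hx y hy h
  · rw [dist_comm (f x), dist_comm x]
    exact key y hy x hx h

lemma C1CurvesLipschitz.exists_lipschitzOnWith (hM : C1CurvesLipschitz n M)
    {P : ∀ x : M, TangentSpace (𝓡 n) x → Prop} (h : IsPiecewiseC1With P γ a b) :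
    ∃ K, LipschitzOnWith K γ (Icc a b) := by
  refine h.induction (Q := fun a b => ∃ K, LipschitzOnWith K γ (Icc a b)) ?_ ?_
  · exact fun a b h => hM γ a b h.1 h.2.1
  · rintro a m b h1 h2 ⟨K₁, hK₁⟩ ⟨K₂, hK₂⟩
    exact ⟨_, hK₁.union_Icc hK₂ h1.lt.le h2.1.le⟩

/-- A constant piece would have zero velocity, on which the time-orienting field cannot be strictly
negative. -/
lemma IsPiecewiseC1With.exists_ne (h : IsPiecewiseC1With g.FutureCausal γ a b) :
    ∃ s ∈ Icc a b, ∃ t ∈ Icc a b, γ s ≠ γ t := by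
  refine h.induction (Q := fun a b => ∃ s ∈ Icc a b, ∃ t ∈ Icc a b, γ s ≠ γ t) ?_ ?_
  · intro a b h
    by_contra hcon
    push Not at hcon
    have ha : a ∈ Icc a b := ⟨le_rfl, h.1.le⟩
    have h1 := (h.2.2 a ha).2
    have h2 : velocityWithin (n := n) γ a b a = 0 := by
      have h3 : HasMFDerivWithinAt 𝓘(ℝ, ℝ) (𝓡 n) γ (Icc a b) a 0 :=
        (hasMFDerivWithinAt_const (γ a) (Icc a b) a).congr_of_eventuallyEq
          (eventually_mem_nhdsWithin.mono fun s hs => hcon s hs a ha) rfl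
      rw [velocityWithin, h3.mfderivWithin (uniqueDiffOn_Icc h.1 a ha).uniqueMDiffWithinAt]
      rfl
    rw [h2, map_zero] at h1
    exact lt_irrefl _ h1
  · rintro a m b h1 h2 ⟨s, hs, t, ht, hst⟩ -
    have := Icc_subset_Icc (le_refl a) h2.1.le
    exact ⟨s, this hs, t, this ht, hst⟩

/-- Piecewise `C¹` causal curves are causal curves in the metric sense. -/
lemma IsPiecewiseC1With.isCausalCurve (hM : C1CurvesLipschitz n M)
    (h : IsPiecewiseC1With g.FutureCausal γ a b) : g.causalData.IsCausalCurve γ (Icc a b) where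
  ordConnected := ordConnected_Icc
  nonconstant := h.exists_ne
  locallyLipschitz := by
    obtain ⟨K, hK⟩ := hM.exists_lipschitzOnWith h
    exact fun x _ => ⟨K, Icc a b, self_mem_nhdsWithin, hK⟩
  le s hs t ht hst := Or.inr ⟨γ, s, t, h.mono hs.1 hst ht.2, rfl, rfl⟩

lemma length_le_tau {X : Type*} [MetricSpace X] (S : CausalData X) (γ : ℝ → X) {a b : ℝ}
    (hab : a < b) : S.length γ a b ≤ S.τ (γ a) (γ b) := by
  refine iInf_le_of_le 1 (iInf_le_of_le (fun i => a + i * (b - a)) (iInf_le_of_le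
    ⟨fun i j hij => ?_, by simp, by simp⟩ (by simp)))
  have : (i : ℝ) < j := by exact_mod_cast hij
  have := mul_lt_mul_of_pos_right this (sub_pos.2 hab)
  simp only
  linarith

/-- An extension does not decrease the time separation. -/
lemma tau_le_of_lengths (hM : C1CurvesLipschitz n M) {Y : Type*} [MetricSpace Y] {S : CausalData Y}
    {ι : M → Y} (hl : ∀ (γ : ℝ → M) (a b : ℝ), a < b → g.causalData.IsCausalCurve γ (Icc a b) →
      g.causalData.length γ a b = S.length (ι ∘ γ) a b) (x y : M) :
    g.causalData.τ x y ≤ S.τ (ι x) (ι y) := by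
  refine iSup_le fun γ => iSup_le fun a => iSup_le fun b => iSup_le fun h => ?_
  obtain ⟨h, rfl, rfl⟩ := h
  refine (g.curveLength_le_length h).trans ?_
  rw [hl γ a b h.lt (h.isCausalCurve hM)]
  exact length_le_tau S (ι ∘ γ) h.lt

end Metric

section Charts

variable {n : ℕ} {M : Type*} [TopologicalSpace M]
  [ChartedSpace (EuclideanSpace ℝ (Fin n)) M] [IsManifold (𝓡 n) ∞ M]

lemma chartDeriv_eq_symmL_apply {x₁ x : M} (hx : x ∈ (extChartAt (𝓡 n) x₁).source)
    (v : EuclideanSpace ℝ (Fin n)) : chartDeriv x₁ (extChartAt (𝓡 n) x₁ x) v =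
      (trivializationAt (EuclideanSpace ℝ (Fin n)) (TangentSpace (𝓡 n)) x₁).symmL ℝ x v := by
  have h := chartDeriv_apply_eq_symm ((extChartAt (𝓡 n) x₁).map_source hx) v
  refine h.trans ?_
  rw [extChartAt_source] at hx
  rw [(extChartAt (𝓡 n) x₁).left_inv (by rwa [extChartAt_source])]
  exact (Bundle.Trivialization.symmL_apply (R := ℝ) _ hx v).symm

end Charts

/-! ### `C¹` curves are Lipschitz for a Riemannian distance -/

section Riemannian

variable {n : ℕ} {M : Type*} [MetricSpace M]
    [ChartedSpace (EuclideanSpace ℝ (Fin n)) M] [IsManifold (𝓡 n) ∞ M]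
    [Bundle.RiemannianBundle (fun x : M => TangentSpace (𝓡 n) x)]
    [IsContMDiffRiemannianBundle (𝓡 n) ∞ (EuclideanSpace ℝ (Fin n))
      (fun x : M => TangentSpace (𝓡 n) x)]
    [IsRiemannianManifold (𝓡 n) M]

lemma isContinuousRiemannianBundle_of_isContMDiff :
    IsContinuousRiemannianBundle (EuclideanSpace ℝ (Fin n))
      (fun x : M => TangentSpace (𝓡 n) x) := by
  obtain ⟨G, hG, hG'⟩ := IsContMDiffRiemannianBundle.exists_contMDiff (IB := 𝓡 n) (n := ∞)
    (F := EuclideanSpace ℝ (Fin n)) (E := fun x : M => TangentSpace (𝓡 n) x)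
  exact ⟨G, hG.continuous, hG'⟩

/-- `C¹` curves in a Riemannian manifold are Lipschitz. -/
lemma c1CurvesLipschitz_of_isRiemannianManifold : C1CurvesLipschitz n M := by
  have _ := isContinuousRiemannianBundle_of_isContMDiff (n := n) (M := M)
  intro γ a b hab hγ
  refine LocallyLipschitzOn.exists_lipschitzOnWith_of_compact isCompact_Icc ?_
  intro t ht
  -- Near `γ t` the Riemannian norm of the velocity is at most `C` times its coordinate norm, and
  -- the latter is bounded by compactness. The length of a subarc then bounds the distance of its
  -- ends.
  obtain ⟨C, hC, hev⟩ := eventually_norm_symmL_trivializationAt_lt (EuclideanSpace ℝ (Fin n))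
    (fun x : M => TangentSpace (𝓡 n) x) (γ t)
  have hsrc : ∀ᶠ x in 𝓝 (γ t), x ∈ (extChartAt (𝓡 n) (γ t)).source :=
    extChartAt_source_mem_nhds (I := 𝓡 n) (γ t)
  obtain ⟨δ, hδ, hδs⟩ := Metric.mem_nhdsWithin_iff.1
    ((hγ.continuousOn t ht).eventually (hev.and hsrc))
  set a' := max a (t - δ / 2) with ha'
  set b' := min b (t + δ / 2) with hb'
  have hab' : a' < b' := by
    refine max_lt (lt_min hab ?_) (lt_min ?_ ?_)
    · linarith [ht.1]
    · linarith [ht.2]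
    · linarith
  have hsub : Icc a' b' ⊆ Icc a b := Icc_subset_Icc (le_max_left _ _) (min_le_left _ _)
  have hgood : ∀ s ∈ Icc a' b', ‖(trivializationAt (EuclideanSpace ℝ (Fin n))
      (fun x : M => TangentSpace (𝓡 n) x) (γ t)).symmL ℝ (γ s)‖ < C ∧
      γ s ∈ (extChartAt (𝓡 n) (γ t)).source := by
    intro s hs
    refine hδs ⟨?_, hsub hs⟩
    have h1 := (le_max_right _ _).trans hs.1
    have h2 := hs.2.trans (min_le_right _ _)
    rw [Metric.mem_ball, Real.dist_eq, abs_lt]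
    constructor <;> linarith
  have hC1 : IsC1With (n := n) (fun _ _ => True) γ a' b' :=
    ⟨hab', hγ.mono hsub, fun _ _ => trivial⟩
  obtain ⟨e', he'c, he'⟩ := hC1.chart fun s hs => (hgood s hs).2
  obtain ⟨K, hK⟩ := isCompact_Icc.exists_bound_of_continuousOn he'c
  have hK0 : 0 ≤ K := (norm_nonneg _).trans (hK a' ⟨le_rfl, hab'.le⟩)
  have key : ∀ s ∈ Icc a' b', ∀ r ∈ Icc a' b', s ≤ r →
      edist (γ s) (γ r) ≤ (Real.toNNReal (C * K) : ℝ≥0∞) * edist s r := by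
    intro s hs r hr hsr
    have hI : Icc s r ⊆ Icc a' b' := Icc_subset_Icc hs.1 hr.2
    rw [IsRiemannianManifold.out (I := 𝓡 n)]
    refine (Manifold.riemannianEDist_le_pathELength (I := 𝓡 n) ((hγ.mono hsub).mono hI) rfl rfl hsr).trans ?_
    rw [Manifold.pathELength_eq_lintegral_mfderiv_Ioo]
    refine (setLIntegral_mono' (g := fun _ => (Real.toNNReal (C * K) : ℝ≥0∞)) measurableSet_Ioo
      fun u hu => ?_).trans ?_
    · have hu' := hI (Ioo_subset_Icc_self hu)
      have e1 : (velocity γ u : EuclideanSpace ℝ (Fin n)) = _ :=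
        (velocity_eq_velocityWithin ⟨hs.1.trans_lt hu.1, hu.2.trans_le hr.2⟩).trans
          ((he' u hu').2.trans (chartDeriv_eq_symmL_apply (hgood u hu').2 (e' u)))
      have e2 : mfderiv 𝓘(ℝ, ℝ) (𝓡 n) γ u (1 : ℝ) = (trivializationAt (EuclideanSpace ℝ (Fin n))
        (fun x : M => TangentSpace (𝓡 n) x) (γ t)).symmL ℝ (γ u) (e' u) := e1
      refine (le_of_eq (congrArg (fun v : TangentSpace (𝓡 n) (γ u) => ‖v‖ₑ) e2)).trans ?_
      rw [← ofReal_norm]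
      refine ENNReal.ofReal_le_ofReal (((ContinuousLinearMap.le_opNorm _ _).trans ?_))
      exact mul_le_mul (hgood u hu').1.le (hK u hu') (norm_nonneg _) hC.le
    · rw [setLIntegral_const, Real.volume_Ioo, edist_comm, edist_dist, Real.dist_eq,
        abs_of_nonneg (by linarith)]
  refine ⟨Real.toNNReal (C * K), Icc a' b', ?_, ?_⟩
  · refine mem_nhdsWithin.2 ⟨Ioo (t - δ / 2) (t + δ / 2), isOpen_Ioo, ⟨by linarith, by linarith⟩, ?_⟩
    exact fun s hs => ⟨max_le hs.2.1 hs.1.1.le, le_min hs.2.2 hs.1.2.le⟩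
  · intro s hs r hr
    rcases le_total s r with h | h
    · exact key s hs r hr h
    · rw [edist_comm (γ s), edist_comm s]
      exact key r hr s hs h

end Riemannian

end SpacetimeMetric

/-! ### Lengths and maximal curves in Lorentzian pre-length spaces -/

lemma LocallyLipschitzOn.comp_locallyLipschitz {X Y Z : Type*} [PseudoEMetricSpace X]
    [PseudoEMetricSpace Y] [PseudoEMetricSpace Z] {f : Y → Z} {w : X → Y} {A : Set X} {B : Set Y}
    (hf : LocallyLipschitzOn B f) (hw : LocallyLipschitz w) (h : MapsTo w A B) :
    LocallyLipschitzOn A (f ∘ w) := by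
  intro x hx
  obtain ⟨K, s, hs, hK⟩ := hf (h hx)
  obtain ⟨L, t, ht, hL⟩ := hw x
  refine ⟨K * L, t ∩ w ⁻¹' s, inter_mem (mem_nhdsWithin_of_mem_nhds ht)
    ((hw.continuous.continuousWithinAt.tendsto_nhdsWithin h) hs), ?_⟩
  exact hK.comp (hL.mono inter_subset_left) fun y hy => hy.2

namespace CausalData

variable {X : Type*} [MetricSpace X] {S : CausalData X} {γ σ : ℝ → X} {a b m s t : ℝ}

lemma length_le_sum {N : ℕ} {t : ℕ → ℝ} (h : StrictMono t) (h0 : t 0 = a) (hN : t N = b) :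
    S.length γ a b ≤ ∑ i ∈ Finset.range N, S.τ (γ (t i)) (γ (t (i + 1))) :=
  iInf_le_of_le N (iInf_le_of_le t (iInf_le_of_le ⟨h, h0, hN⟩ le_rfl))

lemma le_length {c : ℝ≥0∞} (h : ∀ (N : ℕ) (t : ℕ → ℝ), StrictMono t → t 0 = a → t N = b →
    c ≤ ∑ i ∈ Finset.range N, S.τ (γ (t i)) (γ (t (i + 1)))) : c ≤ S.length γ a b :=
  le_iInf fun N => le_iInf fun t => le_iInf fun ht => h N t ht.1 ht.2.1 ht.2.2

lemma length_le_add : S.length γ a b ≤ S.length γ a m + S.length γ m b := by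
  -- Truncated subtraction isolates one infimum at a time, so that arbitrary partitions of the two
  -- halves can be chosen independently and concatenated.
  rw [← tsub_le_iff_left]
  refine le_length fun N₂ t₂ h₂ h20 h2N => ?_
  rw [tsub_le_iff_left, ← tsub_le_iff_right]
  refine le_length fun N₁ t₁ h₁ h10 h1N => ?_
  rw [tsub_le_iff_right]
  obtain ⟨t, ht, hl, hr⟩ := exists_partition_append h₁ h₂ (h1N.trans h20.symm)
  refine (length_le_sum ht (by rw [hl 0 (Nat.zero_le _), h10]) (hr N₂ ▸ h2N :
    t (N₁ + N₂) = b)).trans (le_of_eq ?_)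
  rw [Finset.sum_range_add]
  congr 1
  · refine Finset.sum_congr rfl fun i hi => ?_
    have hi := Finset.mem_range.1 hi
    rw [hl i hi.le, hl (i + 1) hi]
  · refine Finset.sum_congr rfl fun i _ => ?_
    rw [hr, add_assoc, hr]

lemma length_self : S.length γ a a = 0 := by
  refine le_antisymm ?_ zero_le
  exact length_le_sum (N := 0) (t := fun i => a + i) (fun i j hij => by simpa using hij)
    (by simp) (by simp)

lemma length_le_tau_of_le (hab : a ≤ b) : S.length γ a b ≤ S.τ (γ a) (γ b) := by
  rcases hab.eq_or_lt with rfl | h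
  · rw [length_self]
    exact zero_le
  · exact SpacetimeMetric.length_le_tau S γ h

lemma length_comp_strictMono_le {φ : ℝ → ℝ} (hφ : StrictMono φ) :
    S.length γ (φ a) (φ b) ≤ S.length (γ ∘ φ) a b :=
  le_length fun _ _ ht h0 hN => length_le_sum (hφ.comp ht) (congrArg φ h0) (congrArg φ hN)

lemma length_comp_affine (hst : s < t) :
    S.length (γ ∘ fun r => s + r * (t - s)) 0 1 = S.length γ s t := by
  have hts : 0 < t - s := sub_pos.2 hst
  have h1 : StrictMono fun r : ℝ => s + r * (t - s) := fun x y hxy => by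
    have := mul_lt_mul_of_pos_right hxy hts
    simp only
    linarith
  have h2 : StrictMono fun r : ℝ => (r - s) / (t - s) := fun x y hxy => by
    simp only
    gcongr
  refine le_antisymm ?_ ?_
  · have := length_comp_strictMono_le (S := S) (γ := γ ∘ fun r => s + r * (t - s)) (a := s) (b := t) h2
    have e : (γ ∘ fun r => s + r * (t - s)) ∘ (fun r : ℝ => (r - s) / (t - s)) = γ := by
      ext r
      simp only [Function.comp_apply]
      congr 1
      field_simp
      ring
    rwa [e, sub_self, zero_div, div_self hts.ne'] at this
  · have := length_comp_strictMono_le (S := S) (γ := γ) (a := 0) (b := 1) h1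
    simpa using this

lemma affine_mem_Icc (hst : s ≤ t) {r : ℝ} (hr : r ∈ Icc (0 : ℝ) 1) :
    s + r * (t - s) ∈ Icc s t := by
  have h1 := mul_nonneg hr.1 (sub_nonneg.2 hst)
  have h2 := mul_le_of_le_one_left (sub_nonneg.2 hst) hr.2
  constructor <;> linarith

lemma IsCausalCurve.comp_affine {J : Set ℝ} (h : S.IsCausalCurve γ J) (hst : s < t)
    (hJ : Icc s t ⊆ J) (hne : γ s ≠ γ t) :
    S.IsCausalCurve (γ ∘ fun r => s + r * (t - s)) (Icc 0 1) where
  ordConnected := ordConnected_Icc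
  nonconstant := ⟨0, by simp, 1, by simp, by simpa using hne⟩
  locallyLipschitz := by
    have h1 : LipschitzWith (Real.nnabs (t - s)) fun r : ℝ => s + r * (t - s) := by
      refine LipschitzWith.of_dist_le_mul fun x y => ?_
      rw [Real.dist_eq, Real.dist_eq, Real.coe_nnabs, ← abs_mul]
      exact le_of_eq (congrArg abs (by ring))
    exact (h.locallyLipschitz.mono hJ).comp_locallyLipschitz h1.locallyLipschitz
      fun r hr => affine_mem_Icc hst.le hr
  le x hx y hy hxy := by
    refine h.le _ (hJ (affine_mem_Icc hst.le hx)) _ (hJ (affine_mem_Icc hst.le hy)) ?_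
    have := mul_lt_mul_of_pos_right hxy (sub_pos.2 hst)
    linarith

/-- A maximal causal curve of finite length. -/
structure IsMaximalCurve (S : CausalData X) (σ : ℝ → X) : Prop where
  isCausalCurve : S.IsCausalCurve σ (Icc 0 1)
  length_eq : S.length σ 0 1 = S.τ (σ 0) (σ 1)
  ne_top : S.τ (σ 0) (σ 1) ≠ ⊤

namespace IsMaximalCurve

lemma le (h : S.IsMaximalCurve σ) (hS : S.IsLorentzianPreLengthSpace) (hs : 0 ≤ s) (hst : s ≤ t) (ht : t ≤ 1) : S.le (σ s) (σ t) := by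
  rcases hst.eq_or_lt with rfl | h1
  · exact hS.le_refl _
  · exact h.isCausalCurve.le s ⟨hs, hst.trans ht⟩ t ⟨hs.trans hst, ht⟩ h1

lemma tau_ne_top (h : S.IsMaximalCurve σ) (hS : S.IsLorentzianPreLengthSpace) (hs : 0 ≤ s) (hst : s ≤ t) (ht : t ≤ 1) : S.τ (σ s) (σ t) ≠ ⊤ := by
  have h1 := hS.reverse_triangle _ _ _ (h.le hS le_rfl hs (hst.trans ht)) (h.le hS hs hst ht)
  have h2 := hS.reverse_triangle _ _ _ (h.le hS le_rfl (hs.trans hst) ht)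
    (h.le hS (hs.trans hst) ht le_rfl)
  exact ne_top_of_le_ne_top h.ne_top ((le_add_self.trans h1).trans (le_self_add.trans h2))

/-- Pieces of maximal curves are maximal: length is subadditive and `τ` is superadditive along the
curve, so a deficit on one piece would survive in the total. Finiteness of the outer terms is needed
to cancel them. -/
lemma tau_eq_length (h : S.IsMaximalCurve σ) (hS : S.IsLorentzianPreLengthSpace) (hs : 0 ≤ s) (hst : s ≤ t) (ht : t ≤ 1) :
    S.τ (σ s) (σ t) = S.length σ s t := by
  refine le_antisymm ?_ (length_le_tau_of_le hst)
  have h1 := hS.reverse_triangle _ _ _ (h.le hS le_rfl hs (hst.trans ht)) (h.le hS hs hst ht)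
  have h2 := hS.reverse_triangle _ _ _ (h.le hS le_rfl (hs.trans hst) ht)
    (h.le hS (hs.trans hst) ht le_rfl)
  have h3 : S.τ (σ 0) (σ 1) ≤ S.τ (σ 0) (σ s) + S.length σ s t + S.τ (σ t) (σ 1) := by
    rw [← h.length_eq]
    refine (length_le_add (m := t)).trans (add_le_add ?_ (length_le_tau_of_le ht))
    exact (length_le_add (m := s)).trans (add_le_add (length_le_tau_of_le hs) le_rfl)
  have h4 : S.τ (σ 0) (σ s) + S.τ (σ s) (σ t) + S.τ (σ t) (σ 1) ≤
      S.τ (σ 0) (σ s) + S.length σ s t + S.τ (σ t) (σ 1) :=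
    (add_le_add h1 le_rfl).trans (h2.trans h3)
  have f1 := h.tau_ne_top hS (hs.trans hst) ht le_rfl
  have f2 := h.tau_ne_top hS le_rfl hs (hst.trans ht)
  rwa [ENNReal.add_le_add_iff_right f1, ENNReal.add_le_add_iff_left f2] at h4

lemma tau_add (h : S.IsMaximalCurve σ) (hS : S.IsLorentzianPreLengthSpace) {r : ℝ} (hr : 0 ≤ r) (hrs : r ≤ s) (hst : s ≤ t) (ht : t ≤ 1) :
    S.τ (σ r) (σ s) + S.τ (σ s) (σ t) = S.τ (σ r) (σ t) := by
  refine le_antisymm (hS.reverse_triangle _ _ _ (h.le hS hr hrs (hst.trans ht))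
    (h.le hS (hr.trans hrs) hst ht)) ?_
  rw [h.tau_eq_length hS hr (hrs.trans hst) ht, h.tau_eq_length hS hr hrs (hst.trans ht),
    h.tau_eq_length hS (hr.trans hrs) hst ht]
  exact length_le_add

lemma isSide (h : S.IsMaximalCurve σ) (hS : S.IsLorentzianPreLengthSpace) (hs : 0 ≤ s) (hst : s < t) (ht : t ≤ 1) (hne : σ s ≠ σ t) :
    S.IsSide (σ ∘ fun r => s + r * (t - s)) (σ s) (σ t) := by
  refine Or.inr ⟨hne, ⟨h.isCausalCurve.comp_affine hst (Icc_subset_Icc hs ht) hne,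
    by simp, by simp⟩, ?_⟩
  rw [length_comp_affine hst, h.tau_eq_length hS hs hst.le ht]

end IsMaximalCurve

/-! ### Absence of small causal loops -/

section Loops

/-- A localising neighbourhood contains no closed causal loops. -/
lemma IsLocalising.antisymm {Ω : Set X} (hS : S.IsLorentzianPreLengthSpace)
    (hΩ : S.IsLocalising Ω) {p q : X} (hp : p ∈ Ω) (hq : q ∈ Ω)
    (hpq : S.le p q) (hqp : S.le q p) : p = q := by
  by_contra hne
  obtain ⟨C, hC⟩ := hΩ.length_bounded
  obtain ⟨ρ, -, -, hρ⟩ := hΩ.exists_local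
  obtain ⟨κ, ⟨hκ, h0, h1⟩, hκΩ, -⟩ := hρ ⟨p, hp⟩ ⟨q, hq⟩ hpq (by simpa using hne)
  simp only at h0 h1
  -- Closing up `κ` with `q ≤ p` makes all of its points mutually related, so every
  -- reparametrisation, even a backwards one, satisfies the causality condition.
  have hmut : ∀ s ∈ Icc (0 : ℝ) 1, ∀ t ∈ Icc (0 : ℝ) 1, S.le (κ s) (κ t) := by
    have hle : ∀ s ∈ Icc (0 : ℝ) 1, ∀ t ∈ Icc (0 : ℝ) 1, s ≤ t → S.le (κ s) (κ t) := by
      intro s hs t ht hst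
      rcases hst.eq_or_lt with rfl | h
      · exact hS.le_refl _
      · exact hκ.le s hs t ht h
    intro s hs t ht
    have e1 := hle s hs 1 (by simp) hs.2
    have e2 := hle 0 (by simp) t ht ht.1
    rw [h1] at e1
    rw [h0] at e2
    exact hS.le_trans _ _ _ e1 (hS.le_trans _ _ _ hqp e2)
  -- This Lipschitz function oscillates between `0` and `1` forever, so `κ ∘ w` is a causal curve in
  -- `Ω` running from `p` to `q` and back infinitely often. Each passage contributes at least `edist
  -- p q` to its variation.
  set w : ℝ → ℝ := fun t => (1 - Real.cos t) / 2 with hw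
  have hwI : ∀ t, w t ∈ Icc (0 : ℝ) 1 := fun t =>
    ⟨by have := Real.cos_le_one t; simp only [hw]; linarith,
      by have := Real.neg_one_le_cos t; simp only [hw]; linarith⟩
  have hwlip : LocallyLipschitz w :=
    ContDiff.locallyLipschitz (𝕂 := ℝ) (by fun_prop)
  have hw0 : ∀ k : ℕ, κ (w (2 * k * Real.pi)) = p := fun k => by
    have : Real.cos (2 * k * Real.pi) = 1 := by
      have := Real.cos_nat_mul_two_pi k
      rwa [show (k : ℝ) * (2 * Real.pi) = 2 * k * Real.pi by ring] at this
    rw [hw]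
    simp [this, h0]
  have hw1 : ∀ k : ℕ, κ (w ((2 * k + 1) * Real.pi)) = q := fun k => by
    have : Real.cos ((2 * k + 1) * Real.pi) = -1 := by
      have := Real.cos_nat_mul_two_pi_add_pi k
      rwa [show (k : ℝ) * (2 * Real.pi) + Real.pi = (2 * k + 1) * Real.pi by ring] at this
    rw [hw]
    simp only [this]
    norm_num [h1]
  have hcurve : S.IsCausalCurve (κ ∘ w) univ := by
    refine ⟨ordConnected_univ, ⟨2 * (0 : ℕ) * Real.pi, trivial, (2 * (0 : ℕ) + 1) * Real.pi,
      trivial, ?_⟩, ?_, fun s _ t _ _ => hmut _ (hwI s) _ (hwI t)⟩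
    · simp only [Function.comp_apply]
      rw [hw0 0, hw1 0]
      exact hne
    · exact hκ.locallyLipschitz.comp_locallyLipschitz hwlip fun t _ => hwI t
  have hbound := hC _ _ hcurve fun t _ => hκΩ (hwI t)
  have hsum : ∀ n : ℕ, (n : ℝ≥0∞) * edist p q ≤ C := by
    intro n
    refine le_trans ?_ hbound
    have hmono : Monotone fun i : ℕ => (i : ℝ) * Real.pi := fun i j hij => by
      have : (i : ℝ) ≤ j := by exact_mod_cast hij
      exact mul_le_mul_of_nonneg_right this Real.pi_pos.le
    refine le_trans ?_ (eVariationOn.sum_le (f := κ ∘ w) (s := univ) (n := n) (u := fun i : ℕ => (i : ℝ) * Real.pi)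
      hmono (fun _ => trivial))
    have : ∀ i : ℕ, edist ((κ ∘ w) ((i + 1 : ℕ) * Real.pi)) ((κ ∘ w) (i * Real.pi)) = edist p q := by
      intro i
      simp only [Function.comp_apply]
      rcases Nat.even_or_odd' i with ⟨k, rfl | rfl⟩
      · have e1 := hw0 k
        have e2 := hw1 k
        push_cast
        rw [e1, e2, edist_comm]
      · have e1 := hw1 k
        have e2 := hw0 (k + 1)
        push_cast at e2 ⊢
        rw [show 2 * (k : ℝ) + 1 + 1 = 2 * (k + 1) by ring, e1, e2]
    simp only [this]
    simp
  have hpos : edist p q ≠ 0 := by simpa using hne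
  obtain ⟨n, hn⟩ := ENNReal.exists_nat_mul_gt hpos (ENNReal.coe_ne_top (r := C))
  exact (hsum n).not_gt hn

end Loops

end CausalData

/-- Used with `f = τ (σ 0) (σ ·)`, this finds a point at which a maximal curve passes from timelike
to null within arbitrarily small neighbourhoods. The curve may rest at that point for a while: `s₁`
is the first parameter on the level, `m` is where `σ` stops resting, `r` lies just before `s₁` and
`q` just after `m`. On `[s₁, m]` the curve does not move, so all of `[r, q]` is mapped close to `y`.
-/
lemma exists_level_exit {X : Type*} [TopologicalSpace X] [T1Space X] {σ : ℝ → X} {f : ℝ → ℝ} {s t : ℝ}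
    (hσ : ContinuousOn σ (Icc 0 1)) (hf : ContinuousOn f (Icc 0 1)) (hmono : MonotoneOn f (Icc 0 1))
    (hs : 0 ≤ s) (hst : s < t) (ht : t ≤ 1) (hfst : f s = f t) (hne : σ s ≠ σ t) (h0 : f 0 < f s) :
    ∃ y, ∀ U ∈ 𝓝 y, ∃ r m q, 0 ≤ r ∧ r < m ∧ m < q ∧ q ≤ 1 ∧ σ m = y ∧ MapsTo σ (Icc r q) U ∧
      f r < f m ∧ f m = f q ∧ σ q ≠ y := by
  have hsub : Icc 0 s ⊆ Icc (0 : ℝ) 1 := Icc_subset_Icc le_rfl (hst.le.trans ht)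
  -- the first time at which the level is attained
  set A : Set ℝ := Icc 0 s ∩ f ⁻¹' {f s} with hA
  have hAc : IsCompact A := isCompact_Icc.of_isClosed_subset
    ((hf.mono hsub).preimage_isClosed_of_isClosed isClosed_Icc isClosed_singleton) inter_subset_left
  obtain ⟨s₁, hs₁, hmin⟩ := hAc.exists_isLeast ⟨s, ⟨hs, le_rfl⟩, rfl⟩
  have hfs₁ : f s₁ = f s := hs₁.2
  have hs₁0 : 0 < s₁ := by
    rcases hs₁.1.1.eq_or_lt with h | h
    · rw [← hfs₁, ← h] at h0
      exact absurd h0 (lt_irrefl _)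
    · exact h
  have hs₁t : s₁ < t := hs₁.1.2.trans_lt hst
  have hlev : ∀ u ∈ Icc s₁ t, f u = f s := fun u hu => by
    refine le_antisymm ?_ ?_
    · rw [hfst]
      exact hmono ⟨hs₁.1.1.trans hu.1, hu.2.trans ht⟩ ⟨hs.trans hst.le, ht⟩ hu.2
    · rw [← hfs₁]
      exact hmono ⟨hs₁.1.1, hs₁t.le.trans ht⟩ ⟨hs₁.1.1.trans hu.1, hu.2.trans ht⟩ hu.1
  -- the last time until which the curve is constant
  set B : Set ℝ := {u | u ∈ Icc s₁ t ∧ σ u ≠ σ s₁} with hB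
  have hBne : B.Nonempty := by
    by_cases h : σ s = σ s₁
    · exact ⟨t, ⟨hs₁t.le, le_rfl⟩, by rw [← h]; exact hne.symm⟩
    · exact ⟨s, ⟨hs₁.1.2, hst.le⟩, h⟩
  have hBb : BddBelow B := ⟨s₁, fun u hu => hu.1.1⟩
  set m := sInf B with hm
  have hm1 : s₁ ≤ m := le_csInf hBne fun u hu => hu.1.1
  have hmt : m ≤ t := (csInf_le hBb hBne.some_mem).trans hBne.some_mem.1.2
  have hconst : ∀ u ∈ Ico s₁ m, σ u = σ s₁ := fun u hu => by
    by_contra h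
    exact (csInf_le hBb (show u ∈ B from ⟨⟨hu.1, hu.2.le.trans hmt⟩, h⟩)).not_gt hu.2
  have hm01 : m ∈ Icc (0 : ℝ) 1 := ⟨hs₁.1.1.trans hm1, hmt.trans ht⟩
  have hσm : σ m = σ s₁ := by
    rcases hm1.eq_or_lt with h | h
    · rw [← h]
    · have h1 : Tendsto σ (𝓝[Ico s₁ m] m) (𝓝 (σ m)) := ((hσ m hm01).mono fun u hu =>
        ⟨hs₁.1.1.trans hu.1, hu.2.le.trans hm01.2⟩)
      have h2 : Tendsto σ (𝓝[Ico s₁ m] m) (𝓝 (σ s₁)) :=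
        tendsto_const_nhds.congr' (eventually_of_mem self_mem_nhdsWithin fun u hu => (hconst u hu).symm)
      have : (𝓝[Ico s₁ m] m).NeBot := by
        rw [← mem_closure_iff_nhdsWithin_neBot, closure_Ico h.ne]
        exact ⟨hm1, le_rfl⟩
      by_contra hc
      have h3 := h1.eventually (isOpen_compl_singleton.mem_nhds hc)
      have h4 : ∀ᶠ u in 𝓝[Ico s₁ m] m, σ u = σ s₁ := eventually_of_mem self_mem_nhdsWithin hconst
      obtain ⟨u, hu1, hu2⟩ := (h3.and h4).exists
      exact hu1 hu2
  have hmB : m ∉ B := fun h => h.2 hσm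
  refine ⟨σ s₁, fun U hU => ?_⟩
  have hs₁1 : s₁ ∈ Icc (0 : ℝ) 1 := ⟨hs₁.1.1, hs₁t.le.trans ht⟩
  obtain ⟨δ, hδ, hδU⟩ := Metric.mem_nhdsWithin_iff.1 (hσ s₁ hs₁1 hU)
  obtain ⟨δ', hδ', hδU'⟩ := Metric.mem_nhdsWithin_iff.1 (hσ m hm01 (by rwa [hσm]))
  obtain ⟨q, hqB, hqm⟩ := exists_lt_of_csInf_lt hBne (show sInf B < m + δ' by linarith)
  have hmq : m < q := lt_of_le_of_ne (csInf_le hBb hqB) fun h => hmB (h ▸ hqB)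
  refine ⟨max 0 (s₁ - δ / 2), m, q, le_max_left _ _, ?_, hmq, hqB.1.2.trans ht, hσm, ?_, ?_, ?_, hqB.2⟩
  · refine lt_of_lt_of_le (max_lt hs₁0 (by linarith)) hm1
  · intro u hu
    have hu0 := (le_max_left _ _).trans hu.1
    have hu1 := (le_max_right _ _).trans hu.1
    have huI : u ∈ Icc (0 : ℝ) 1 := ⟨hu0, hu.2.trans (hqB.1.2.trans ht)⟩
    rcases lt_or_ge u s₁ with h | h
    · refine hδU ⟨?_, huI⟩
      rw [Metric.mem_ball, Real.dist_eq, abs_lt]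
      constructor <;> linarith
    · rcases lt_or_ge u m with h' | h'
      · show σ u ∈ U
        rw [hconst u ⟨h, h'⟩]
        exact mem_of_mem_nhds hU
      · refine hδU' ⟨?_, huI⟩
        rw [Metric.mem_ball, Real.dist_eq, abs_lt]
        constructor <;> linarith [hu.2]
  · rw [hlev m ⟨hm1, hmt⟩]
    have hlt : max 0 (s₁ - δ / 2) < s₁ := max_lt hs₁0 (by linarith)
    have hr1 : max 0 (s₁ - δ / 2) ∈ Icc (0 : ℝ) 1 := ⟨le_max_left _ _, hlt.le.trans hs₁1.2⟩
    refine lt_of_le_of_ne (hfs₁ ▸ hmono hr1 hs₁1 hlt.le) fun h => ?_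
    exact (hmin ⟨⟨hr1.1, hlt.le.trans hs₁.1.2⟩, h⟩).not_gt hlt
  · rw [hlev m ⟨hm1, hmt⟩, hlev q hqB.1]

/-! ### Upper curvature bounds exclude null pieces of maximal curves -/

namespace CausalData

/-- All timelike triangles with sufficiently small side lengths are realised. -/
def HasSmallTriangles {X : Type*} [MetricSpace X] (T : CausalData X) (ε : ℝ) : Prop :=
  ∀ a b c : ℝ, 0 < a → 0 < b → a + b ≤ c → c < ε → ∃ (x y z : X) (α β γ : ℝ → X),
    T.IsTriangle x y z α β γ ∧ T.τ x y = ENNReal.ofReal a ∧ T.τ y z = ENNReal.ofReal b ∧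
      T.τ x z = ENNReal.ofReal c ∧ T.τ x x = 0

lemma exists_timelikeSizeBounds (K : ℝ) : ∃ ε > 0, ∀ a b c, 0 ≤ a → 0 ≤ b → a + b ≤ c → c < ε →
    TimelikeSizeBounds K a b c := by
  -- The summand `1` keeps the quotient meaningful for `K = 0`; for either sign of `K` the value is
  -- below the required bound.
  refine ⟨Real.pi / √(|K| + 1), by positivity, fun a b c ha hb hab hc => ⟨ha, hb, hab, ?_, ?_⟩⟩
  · intro _ hK
    have h1 := Real.sqrt_pos.2 hK
    refine hc.trans_le ?_
    gcongr
    linarith [le_abs_self K]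
  · intro _ hK
    have h1 := Real.sqrt_pos.2 (neg_pos.2 hK)
    refine hc.trans_le ?_
    gcongr
    linarith [neg_le_abs K]

variable {X : Type*} [MetricSpace X] {S : CausalData X} {σ : ℝ → X} {U W : Set X} {K ε r m q : ℝ}

lemma IsSide.left_mem {x y : X} (h : S.IsSide σ x y) : x ∈ σ '' Icc 0 1 := by
  rcases h with h | h
  · exact ⟨0, by simp, h.2 0 (by simp)⟩
  · exact ⟨0, by simp, h.2.1.2.1⟩

lemma IsSide.right_mem {x y : X} (h : S.IsSide σ x y) : y ∈ σ '' Icc 0 1 := by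
  rcases h with h | h
  · exact ⟨1, by simp, (h.2 1 (by simp)).trans h.1⟩
  · exact ⟨1, by simp, h.2.1.2.2⟩

lemma tau_self_eq_zero (hS : S.IsLorentzianPreLengthSpace) {x : X} (h : S.τ x x ≠ ⊤) : S.τ x x = 0 := by
  have := hS.reverse_triangle x x x (hS.le_refl x) (hS.le_refl x)
  by_contra h0
  exact (ENNReal.lt_add_right h h0).not_ge this

lemma IsCausalCurve.continuousOn {J : Set ℝ} (h : S.IsCausalCurve σ J) : ContinuousOn σ J :=
  h.locallyLipschitz.continuousOn

/-- Existence of comparison triangles in the model space for the triangles of a sufficiently small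
neighbourhood, for points on the sides that correspond to vertices. -/
lemma IsComparisonNhd.exists_triangle (hU : S.IsComparisonNhd K (fun s s' => s' ≤ s) U)
    (hT : (modelSpace K).HasSmallTriangles ε)
    (hsize : ∀ a b c, 0 ≤ a → 0 ≤ b → a + b ≤ c → c < ε → TimelikeSizeBounds K a b c)
    (hS : S.IsLorentzianPreLengthSpace)
    {x y z p : X} {γ : ℝ → X} (hx : x ∈ U) (hy : y ∈ U) (hz : z ∈ U) (hxy : S.ll x y) (hyz : S.ll y z)
    (hnxy : x ≠ y) (hnyz : y ≠ z) (hγ : S.IsSide γ x z) (hγU : MapsTo γ (Icc 0 1) U)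
    (hp : p ∈ γ '' Icc 0 1) (hlt : S.τ x z < ENNReal.ofReal ε) :
    (S.τ x p = S.τ x z → S.τ y z ≤ S.τ y p) ∧ (S.τ x p = 0 → S.τ x y ≤ S.τ p y) := by
  obtain ⟨α, hα, hαU, hαl⟩ := hU.exists_maximal x hx y hy (hS.le_of_ll _ _ hxy) hnxy
  obtain ⟨β, hβ, hβU, hβl⟩ := hU.exists_maximal y hy z hz (hS.le_of_ll _ _ hyz) hnyz
  have fxy := hU.finite x hx y hy
  have fyz := hU.finite y hy z hz
  have fxz := hU.finite x hx z hz
  have hsum := hS.reverse_triangle x y z (hS.le_of_ll _ _ hxy) (hS.le_of_ll _ _ hyz)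
  have ha : 0 < (S.τ x y).toReal := ENNReal.toReal_pos ((hS.tau_pos_iff _ _).2 hxy).ne' fxy
  have hb : 0 < (S.τ y z).toReal := ENNReal.toReal_pos ((hS.tau_pos_iff _ _).2 hyz).ne' fyz
  have hab : (S.τ x y).toReal + (S.τ y z).toReal ≤ (S.τ x z).toReal := by
    rw [← ENNReal.toReal_add fxy fyz]
    exact ENNReal.toReal_mono fxz hsum
  have hc : (S.τ x z).toReal < ε := (ENNReal.lt_ofReal_iff_toReal_lt fxz).1 hlt
  obtain ⟨x', y', z', α', β', γ', hT', e1, e2, e3, e4⟩ := hT _ _ _ ha hb hab hc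
  rw [ENNReal.ofReal_toReal fxy] at e1
  rw [ENNReal.ofReal_toReal fyz] at e2
  rw [ENNReal.ofReal_toReal fxz] at e3
  have hαs : S.IsSide α x y := Or.inr ⟨hnxy, hα, hαl⟩
  have hβs : S.IsSide β y z := Or.inr ⟨hnyz, hβ, hβl⟩
  have hcmp := hU.comparison x y z α β γ (Or.inl ⟨hxy, hS.le_of_ll _ _ hyz⟩) ⟨hαs, hβs, hγ⟩ hαU hβU hγU
    (hsize _ _ _ ha.le hb.le hab hc) x' y' z' α' β' γ' hT' e1 e2 e3
  have hy' : Corresponds S (modelSpace K) x y α x' α' y y' :=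
    ⟨hxy, hαs.right_mem, hT'.1.right_mem, e1.symm⟩
  have hxz := hS.ll_trans _ _ _ hxy hyz
  -- A point `p` of the long side with `τ x p = τ x z` corresponds to `z'`, and one with `τ x p = 0`
  -- corresponds to `x'` because `τ x' x' = 0`. In both cases the model distance to `y'` is a side
  -- length of the triangle.
  constructor
  · intro h
    have := hcmp y p y' z' (Or.inl hy')
      (Or.inr (Or.inr ⟨hxz, hp, hT'.2.2.right_mem, h.trans e3.symm⟩))
    rwa [e2] at this
  · intro h
    have := hcmp p y x' y' (Or.inr (Or.inr ⟨hxz, hp, hT'.2.2.left_mem, h.trans e4.symm⟩)) (Or.inl hy')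
    rwa [e1] at this

lemma le_of_tendsto_of_isClosed (hW : IsClosed {p : X × X | p.1 ∈ closure W ∧ p.2 ∈ closure W ∧ S.le p.1 p.2})
    {l : Filter ℝ} [l.NeBot] {u v : ℝ → X} {x y : X} (hu : Tendsto u l (𝓝 x)) (hv : Tendsto v l (𝓝 y))
    (hx : W ∈ 𝓝 x) (hy : W ∈ 𝓝 y) (h : ∀ᶠ t in l, S.le (u t) (v t)) : S.le x y := by
  refine (hW.mem_of_tendsto (hu.prodMk_nhds hv) ?_).2.2
  filter_upwards [hu hx, hv hy, h] with t h1 h2 h3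
  exact ⟨subset_closure h1, subset_closure h2, h3⟩

lemma MapsTo.comp_affine {s t : ℝ} (hst : s ≤ t) (h : MapsTo σ (Icc s t) U) :
    MapsTo (σ ∘ fun r => s + r * (t - s)) (Icc 0 1) U :=
  fun _ hr => h (affine_mem_Icc hst hr)

lemma mem_image_affine {s t u : ℝ} (hst : s < t) (hu : u ∈ Icc s t) :
    σ u ∈ (σ ∘ fun r => s + r * (t - s)) '' Icc 0 1 := by
  have h := sub_pos.2 hst
  refine ⟨(u - s) / (t - s), ⟨div_nonneg (sub_nonneg.2 hu.1) h.le, (div_le_one h).2 (by linarith [hu.2])⟩, ?_⟩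
  simp only [Function.comp_apply]
  congr 1
  field_simp
  ring

/-- Since `σ m` and `σ q` are equally far from `σ r`, comparison with points `κ u` on a timelike
curve from `σ r` to `σ q` gives `τ (κ u) (σ m) ≥ τ (κ u) (σ q) > 0`. Hence `κ u ≤ σ m`, and
closedness of the causal relation applies as `κ u` tends to `σ q`. -/
lemma IsMaximalCurve.le_of_timelike_null (hσ : S.IsMaximalCurve σ) (hS : S.IsLorentzianLengthSpace)
    (hU : S.IsComparisonNhd K (fun s s' => s' ≤ s) U) (hT : (modelSpace K).HasSmallTriangles ε)
    (hsize : ∀ a b c, 0 ≤ a → 0 ≤ b → a + b ≤ c → c < ε → TimelikeSizeBounds K a b c)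
    (hW : IsClosed {p : X × X | p.1 ∈ closure W ∧ p.2 ∈ closure W ∧ S.le p.1 p.2})
    (hr : 0 ≤ r) (hrm : r < m) (hmq : m < q) (hq : q ≤ 1) (hmap : MapsTo σ (Icc r q) (interior U ∩ interior W))
    (hpos : 0 < S.τ (σ r) (σ m)) (h0 : S.τ (σ m) (σ q) = 0)
    (hlt : S.τ (σ r) (σ q) < ENNReal.ofReal ε) : S.le (σ q) (σ m) := by
  have hP := hS.isLorentzianPreLengthSpace
  have hrq := hrm.trans hmq
  have hadd := hσ.tau_add hP hr hrm.le hmq.le hq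
  rw [h0, add_zero] at hadd
  have hllrq : S.ll (σ r) (σ q) := (hP.tau_pos_iff _ _).1 (hadd ▸ hpos)
  have hmemU : ∀ {u}, u ∈ Icc r q → σ u ∈ U := fun hu => interior_subset (hmap hu).1
  have hrI : r ∈ Icc r q := ⟨le_rfl, hrq.le⟩
  have hqI : q ∈ Icc r q := ⟨hrq.le, le_rfl⟩
  have hmI : m ∈ Icc r q := ⟨hrm.le, hmq.le⟩
  have hself : ∀ {u}, u ∈ U → S.τ u u = 0 := fun hu => tau_self_eq_zero hP (hU.finite _ hu _ hu)
  have hirr : ∀ {u v}, u ∈ U → S.ll u v → u ≠ v := fun hu h e => by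
    subst e
    exact ((hP.tau_pos_iff _ _).2 h).ne' (hself hu)
  obtain ⟨κ, hκ, hκ0, hκ1⟩ := hS.isCausallyPathConnected.1 _ _ hllrq
  have hκc : Tendsto κ (𝓝[Ioo 0 1] 1) (𝓝 (σ q)) := by
    have := hκ.locallyLipschitz.continuousOn 1 (by simp)
    rw [ContinuousWithinAt, hκ1] at this
    exact this.mono_left (nhdsWithin_mono _ Ioo_subset_Icc_self)
  have hne : (𝓝[Ioo (0 : ℝ) 1] 1).NeBot := by
    rw [← mem_closure_iff_nhdsWithin_neBot, closure_Ioo zero_ne_one]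
    simp
  refine le_of_tendsto_of_isClosed hW hκc tendsto_const_nhds (mem_interior_iff_mem_nhds.1 (hmap hqI).2)
    (mem_interior_iff_mem_nhds.1 (hmap hmI).2) ?_
  filter_upwards [self_mem_nhdsWithin, hκc (mem_interior_iff_mem_nhds.1 (hmap hqI).1)] with u hu huU
  have h1 : S.ll (σ r) (κ u) := hκ0 ▸ hκ.ll 0 (by simp) u ⟨hu.1.le, hu.2.le⟩ hu.1
  have h2 : S.ll (κ u) (σ q) := hκ1 ▸ hκ.ll u ⟨hu.1.le, hu.2.le⟩ 1 (by simp) hu.2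
  have h3 := (hU.exists_triangle hT hsize hP (hmemU hrI) huU (hmemU hqI) h1 h2 (hirr (hmemU hrI) h1)
    (hirr huU h2) (hσ.isSide hP hr hrq hq (hirr (hmemU hrI) hllrq))
    (MapsTo.comp_affine hrq.le fun u hu => hmemU hu) (mem_image_affine hrq hmI) hlt).1 hadd
  exact hP.le_of_ll _ _ ((hP.tau_pos_iff _ _).1 (((hP.tau_pos_iff _ _).2 h2).trans_le h3))

/-- The time dual: here `σ m` has separation zero from `σ r`, so it corresponds to the initial
comparison vertex, and `κ u` tends to `σ r`. -/
lemma IsMaximalCurve.le_of_null_timelike (hσ : S.IsMaximalCurve σ) (hS : S.IsLorentzianLengthSpace)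
    (hU : S.IsComparisonNhd K (fun s s' => s' ≤ s) U) (hT : (modelSpace K).HasSmallTriangles ε)
    (hsize : ∀ a b c, 0 ≤ a → 0 ≤ b → a + b ≤ c → c < ε → TimelikeSizeBounds K a b c)
    (hW : IsClosed {p : X × X | p.1 ∈ closure W ∧ p.2 ∈ closure W ∧ S.le p.1 p.2})
    (hr : 0 ≤ r) (hrm : r < m) (hmq : m < q) (hq : q ≤ 1) (hmap : MapsTo σ (Icc r q) (interior U ∩ interior W))
    (hpos : 0 < S.τ (σ m) (σ q)) (h0 : S.τ (σ r) (σ m) = 0)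
    (hlt : S.τ (σ r) (σ q) < ENNReal.ofReal ε) : S.le (σ m) (σ r) := by
  have hP := hS.isLorentzianPreLengthSpace
  have hrq := hrm.trans hmq
  have hadd := hσ.tau_add hP hr hrm.le hmq.le hq
  rw [h0, zero_add] at hadd
  have hllrq : S.ll (σ r) (σ q) := (hP.tau_pos_iff _ _).1 (hadd ▸ hpos)
  have hmemU : ∀ {u}, u ∈ Icc r q → σ u ∈ U := fun hu => interior_subset (hmap hu).1
  have hrI : r ∈ Icc r q := ⟨le_rfl, hrq.le⟩
  have hqI : q ∈ Icc r q := ⟨hrq.le, le_rfl⟩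
  have hmI : m ∈ Icc r q := ⟨hrm.le, hmq.le⟩
  have hself : ∀ {u}, u ∈ U → S.τ u u = 0 := fun hu => tau_self_eq_zero hP (hU.finite _ hu _ hu)
  have hirr : ∀ {u v}, u ∈ U → S.ll u v → u ≠ v := fun hu h e => by
    subst e
    exact ((hP.tau_pos_iff _ _).2 h).ne' (hself hu)
  obtain ⟨κ, hκ, hκ0, hκ1⟩ := hS.isCausallyPathConnected.1 _ _ hllrq
  have hκc : Tendsto κ (𝓝[Ioo 0 1] 0) (𝓝 (σ r)) := by
    have := hκ.locallyLipschitz.continuousOn 0 (by simp)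
    rw [ContinuousWithinAt, hκ0] at this
    exact this.mono_left (nhdsWithin_mono _ Ioo_subset_Icc_self)
  have hne : (𝓝[Ioo (0 : ℝ) 1] 0).NeBot := by
    rw [← mem_closure_iff_nhdsWithin_neBot, closure_Ioo zero_ne_one]
    simp
  refine le_of_tendsto_of_isClosed hW tendsto_const_nhds hκc (mem_interior_iff_mem_nhds.1 (hmap hmI).2)
    (mem_interior_iff_mem_nhds.1 (hmap hrI).2) ?_
  filter_upwards [self_mem_nhdsWithin, hκc (mem_interior_iff_mem_nhds.1 (hmap hrI).1)] with u hu huU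
  have h1 : S.ll (σ r) (κ u) := hκ0 ▸ hκ.ll 0 (by simp) u ⟨hu.1.le, hu.2.le⟩ hu.1
  have h2 : S.ll (κ u) (σ q) := hκ1 ▸ hκ.ll u ⟨hu.1.le, hu.2.le⟩ 1 (by simp) hu.2
  have h3 := (hU.exists_triangle hT hsize hP (hmemU hrI) huU (hmemU hqI) h1 h2 (hirr (hmemU hrI) h1)
    (hirr huU h2) (hσ.isSide hP hr hrq hq (hirr (hmemU hrI) hllrq))
    (MapsTo.comp_affine hrq.le fun u hu => hmemU hu) (mem_image_affine hrq hmI) hlt).2 h0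
  exact hP.le_of_ll _ _ ((hP.tau_pos_iff _ _).1 (((hP.tau_pos_iff _ _).2 h1).trans_le h3))

lemma IsMaximalCurve.toReal_tau_add (hσ : S.IsMaximalCurve σ) (hP : S.IsLorentzianPreLengthSpace)
    {s t : ℝ} (hs : 0 ≤ s) (hst : s ≤ t) (ht : t ≤ 1) :
    (S.τ (σ 0) (σ s)).toReal + (S.τ (σ s) (σ t)).toReal = (S.τ (σ 0) (σ t)).toReal := by
  rw [← ENNReal.toReal_add (hσ.tau_ne_top hP le_rfl hs (hst.trans ht)) (hσ.tau_ne_top hP hs hst ht),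
    hσ.tau_add hP le_rfl hs hst ht]

lemma IsMaximalCurve.monotoneOn_tau (hσ : S.IsMaximalCurve σ) (hP : S.IsLorentzianPreLengthSpace) :
    MonotoneOn (fun s => (S.τ (σ 0) (σ s)).toReal) (Icc 0 1) := fun s hs t ht hst => by
  have := hσ.toReal_tau_add hP hs.1 hst ht.2
  have h0 := ENNReal.toReal_nonneg (a := S.τ (σ s) (σ t))
  simp only
  linarith

/-- Every point has a neighbourhood on which the time separation function is small, if it is finite and
continuous near the diagonal. -/
lemma IsComparisonNhd.exists_tau_lt {cmp : ℝ≥0∞ → ℝ≥0∞ → Prop} (hU : S.IsComparisonNhd K cmp U)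
    (hP : S.IsLorentzianPreLengthSpace) {y : X} (hy : U ∈ 𝓝 y) {e : ℝ≥0∞} (he : 0 < e) :
    ∃ V ∈ 𝓝 y, ∀ p ∈ V, ∀ q ∈ V, S.τ p q < e := by
  have h1 : ContinuousAt (fun p : X × X => S.τ p.1 p.2) (y, y) :=
    hU.continuous.continuousAt (prod_mem_nhds hy hy)
  have h2 : ∀ᶠ p : X × X in 𝓝 (y, y), S.τ p.1 p.2 < e := by
    refine h1.eventually_lt continuousAt_const ?_
    have hyU := mem_of_mem_nhds hy
    simpa [tau_self_eq_zero hP (hU.finite y hyU y hyU)] using he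
  rw [nhds_prod_eq] at h2
  obtain ⟨V, hV, hV'⟩ := (eventually_prod_self_iff (r := fun p q => S.τ p q < e)).1 h2
  exact ⟨V, hV, fun p hp q hq => hV' p hp q hq⟩

/-- By additivity along a maximal curve the increments are time separations of nearby points. These
are small because `τ` is finite and continuous on comparison neighbourhoods and vanishes on the
diagonal there. -/
lemma IsMaximalCurve.continuousOn_tau (hσ : S.IsMaximalCurve σ) (hP : S.IsLorentzianPreLengthSpace)
    (hK : S.CausalCurvatureBoundedAbove K) :
    ContinuousOn (fun s => (S.τ (σ 0) (σ s)).toReal) (Icc 0 1) := by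
  intro s hs
  obtain ⟨U, hU, hcmp⟩ := hK (σ s)
  rw [Metric.continuousWithinAt_iff]
  intro e he
  obtain ⟨V, hV, hVe⟩ := hcmp.exists_tau_lt hP hU (ENNReal.ofReal_pos.2 he)
  obtain ⟨δ, hδ, hδV⟩ := Metric.mem_nhdsWithin_iff.1 (hσ.isCausalCurve.continuousOn s hs hV)
  refine ⟨δ, hδ, fun t ht htd => ?_⟩
  have htV : σ t ∈ V := hδV ⟨htd, ht⟩
  have hsV : σ s ∈ V := mem_of_mem_nhds hV
  rw [Real.dist_eq, abs_lt]
  rcases le_total s t with h | h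
  · have h1 := hσ.toReal_tau_add hP hs.1 h ht.2
    have h2 := (ENNReal.lt_ofReal_iff_toReal_lt (hσ.tau_ne_top hP hs.1 h ht.2)).1 (hVe _ hsV _ htV)
    have h3 := ENNReal.toReal_nonneg (a := S.τ (σ s) (σ t))
    constructor <;> linarith
  · have h1 := hσ.toReal_tau_add hP ht.1 h hs.2
    have h2 := (ENNReal.lt_ofReal_iff_toReal_lt (hσ.tau_ne_top hP ht.1 h hs.2)).1 (hVe _ htV _ hsV)
    have h3 := ENNReal.toReal_nonneg (a := S.τ (σ t) (σ s))
    constructor <;> linarith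

/-- In a Lorentzian length space with causal curvature bounded above, a maximal curve of positive length
is timelike, up to constant pieces. -/
lemma IsMaximalCurve.strict (hσ : S.IsMaximalCurve σ) (hS : S.IsLorentzianLengthSpace)
    (hK : S.CausalCurvatureBoundedAbove K) (hT : (modelSpace K).HasSmallTriangles ε) (hε : 0 < ε)
    (hpos : 0 < S.τ (σ 0) (σ 1)) {s t : ℝ} (hs : 0 ≤ s) (hst : s < t) (ht : t ≤ 1)
    (hne : σ s ≠ σ t) : (S.τ (σ 0) (σ s)).toReal < (S.τ (σ 0) (σ t)).toReal := by
  have hP := hS.isLorentzianPreLengthSpace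
  obtain ⟨ε', hε', hsize⟩ := exists_timelikeSizeBounds K
  set e := min ε ε' with he
  have hT' : (modelSpace K).HasSmallTriangles e := fun a b c ha hb hab hc =>
    hT a b c ha hb hab (hc.trans_le (min_le_left _ _))
  have hsize' : ∀ a b c, 0 ≤ a → 0 ≤ b → a + b ≤ c → c < e → TimelikeSizeBounds K a b c :=
    fun a b c ha hb hab hc => hsize a b c ha hb hab (hc.trans_le (min_le_right _ _))
  have hepos : 0 < ENNReal.ofReal e := ENNReal.ofReal_pos.2 (lt_min hε hε')
  set f : ℝ → ℝ := fun s => (S.τ (σ 0) (σ s)).toReal with hf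
  have hfc : ContinuousOn f (Icc 0 1) := hσ.continuousOn_tau hP hK
  have hfm : MonotoneOn f (Icc 0 1) := hσ.monotoneOn_tau hP
  have hσc := hσ.isCausalCurve.continuousOn
  have hsI : s ∈ Icc (0 : ℝ) 1 := ⟨hs, hst.le.trans ht⟩
  have htI : t ∈ Icc (0 : ℝ) 1 := ⟨hs.trans hst.le, ht⟩
  refine lt_of_le_of_ne (hfm hsI htI hst.le) fun hfst => ?_
  change f s = f t at hfst
  have hf0 : f 0 = 0 := by
    have := tau_self_eq_zero hP (hσ.tau_ne_top hP le_rfl le_rfl zero_le_one)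
    simp [hf, this]
  have hf1 : 0 < f 1 := ENNReal.toReal_pos hpos.ne' hσ.ne_top
  have htau : ∀ {u v}, 0 ≤ u → u ≤ v → v ≤ 1 → f u < f v → 0 < S.τ (σ u) (σ v) := by
    intro u v hu huv hv h
    have h1 := hσ.toReal_tau_add hP hu huv hv
    refine pos_iff_ne_zero.2 fun h0 => ?_
    rw [h0] at h1
    simp only [ENNReal.toReal_zero, add_zero] at h1
    exact h.ne h1
  have htau0 : ∀ {u v}, 0 ≤ u → u ≤ v → v ≤ 1 → f u = f v → S.τ (σ u) (σ v) = 0 := by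
    intro u v hu huv hv h
    have h1 := hσ.toReal_tau_add hP hu huv hv
    have h2 : (S.τ (σ u) (σ v)).toReal = 0 := by
      simp only [hf] at h
      linarith
    exact (ENNReal.toReal_eq_zero_iff _).1 h2 |>.resolve_right (hσ.tau_ne_top hP hu huv hv)
  have hnhd : ∀ y, ∃ U W Ω V, S.IsComparisonNhd K (fun s s' => s' ≤ s) U ∧
      IsClosed {p : X × X | p.1 ∈ closure W ∧ p.2 ∈ closure W ∧ S.le p.1 p.2} ∧
      S.IsLocalising Ω ∧ V ∈ 𝓝 y ∧ V ⊆ interior U ∩ interior W ∧ V ⊆ Ω ∧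
      ∀ p ∈ V, ∀ q ∈ V, S.τ p q < ENNReal.ofReal e := by
    intro y
    obtain ⟨U, hU, hcmp⟩ := hK y
    obtain ⟨W, hW, hWc⟩ := hS.isLocallyCausallyClosed y
    obtain ⟨Ω, hΩ, hΩl⟩ := hS.isLocalisable y
    obtain ⟨V, hV, hVe⟩ := hcmp.exists_tau_lt hP hU hepos
    refine ⟨U, W, Ω, (interior U ∩ interior W) ∩ (Ω ∩ V), hcmp, hWc, hΩl,
      inter_mem (inter_mem (interior_mem_nhds.2 hU) (interior_mem_nhds.2 hW))
        (inter_mem (hΩl.isOpen.mem_nhds hΩ) hV), inter_subset_left, fun p hp => hp.2.1,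
      fun p hp q hq => hVe p hp.2.2 q hq.2.2⟩
  -- Either the level of the null piece is positive and has been reached from below, or it is zero
  -- and, as the total length is positive, it is left upwards later. The second case is the first
  -- for the reversed curve `u ↦ σ (1 - u)` with `-f (1 - u)`.
  rcases lt_or_ge (f 0) (f s) with h0 | h0
  · obtain ⟨y, hy⟩ := exists_level_exit hσc hfc hfm hs hst ht hfst hne h0
    obtain ⟨U, W, Ω, V, hcmp, hWc, hΩl, hV, hV1, hV2, hV3⟩ := hnhd y
    obtain ⟨r, m, q, hr, hrm, hmq, hq, hmy, hmap, hfr, hfq, hqy⟩ := hy V hV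
    have hrq := hrm.trans hmq
    have h1 := hσ.le_of_timelike_null hS hcmp hT' hsize' hWc hr hrm hmq hq (hmap.mono_right hV1)
      (htau hr hrm.le (hmq.le.trans hq) hfr) (htau0 (hr.trans hrm.le) hmq.le hq hfq)
      (hV3 _ (hmap ⟨le_rfl, hrq.le⟩) _ (hmap ⟨hrq.le, le_rfl⟩))
    exact hqy (hmy ▸ hΩl.antisymm hP (hV2 (hmap ⟨hrq.le, le_rfl⟩)) (hV2 (hmap ⟨hrm.le, hmq.le⟩)) h1
      (hσ.le hP (hr.trans hrm.le) hmq.le hq))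
  · have hrefl : MapsTo (fun u : ℝ => 1 - u) (Icc 0 1) (Icc 0 1) := fun u hu =>
      ⟨by linarith [hu.2], by linarith [hu.1]⟩
    have hrc : ContinuousOn (fun u : ℝ => 1 - u) (Icc 0 1) := by fun_prop
    obtain ⟨y, hy⟩ := exists_level_exit (σ := fun u => σ (1 - u)) (f := fun u => -f (1 - u)) (s := 1 - t)
      (t := 1 - s) (hσc.comp hrc hrefl) (hfc.comp hrc hrefl).neg
      (fun u hu v hv huv => neg_le_neg (hfm (hrefl hv) (hrefl hu) (by linarith)))
      (by linarith) (by linarith) (by linarith) (by simpa using! hfst.symm)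
      (by simpa using hne.symm) (by
        simp only [sub_zero, sub_sub_cancel, neg_lt_neg_iff]
        exact (hfst.symm.le.trans (h0.trans_eq hf0)).trans_lt hf1)
    obtain ⟨U, W, Ω, V, hcmp, hWc, hΩl, hV, hV1, hV2, hV3⟩ := hnhd y
    obtain ⟨r, m, q, hr, hrm, hmq, hq, hmy, hmap, hfr, hfq, hqy⟩ := hy V hV
    have hmap' : MapsTo σ (Icc (1 - q) (1 - r)) V := fun u hu => by
      have := hmap (show 1 - u ∈ Icc r q from ⟨by linarith [hu.2], by linarith [hu.1]⟩)
      simpa using this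
    have e1 : 1 - q < 1 - m := by linarith
    have e2 : 1 - m < 1 - r := by linarith
    have e3 : 0 ≤ 1 - q := by linarith
    have e4 : 1 - r ≤ 1 := by linarith
    have h1 := hσ.le_of_null_timelike hS hcmp hT' hsize' hWc e3 e1 e2 e4 (hmap'.mono_right hV1)
      (htau (e3.trans e1.le) e2.le e4 (neg_lt_neg_iff.1 hfr)) (htau0 e3 e1.le (e2.le.trans e4) (neg_inj.1 hfq).symm)
      (hV3 _ (hmap' ⟨le_rfl, (e1.trans e2).le⟩) _ (hmap' ⟨(e1.trans e2).le, le_rfl⟩))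
    exact hqy (hmy ▸ hΩl.antisymm hP (hV2 (hmap' ⟨le_rfl, (e1.trans e2).le⟩)) (hV2 (hmap' ⟨e1.le, e2.le⟩))
      (hσ.le hP e3 e1.le (e2.le.trans e4)) h1)

end CausalData

/-- In the application `Φ` is an energy and `ψ` a time orientation. Reaching the level `l` could
coincide with a past-directed vector, so the intermediate value theorem is applied to the maximum of
both functions; its zero cannot come from `ψ`, because `ψ` does not vanish where `Φ < 0`. -/
lemma exists_level_of_continuousOn {Φ ψ : ℝ → ℝ} {r l : ℝ} (hr : 0 ≤ r) (hl : l < 0)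
    (hΦ : ContinuousOn Φ (Icc 0 r)) (hψ : ContinuousOn ψ (Icc 0 r))
    (hne : ∀ s ∈ Icc 0 r, Φ s < 0 → ψ s ≠ 0) (h0 : Φ 0 ≤ l) (h0' : ψ 0 < 0)
    (h1 : Φ r ≤ l → ¬ ψ r < 0) : ∃ s ∈ Icc 0 r, Φ s = l ∧ ψ s < 0 := by
  -- `max (Φ - l) ψ` is nonpositive at `0` and nonnegative at `r`
  have hc : ContinuousOn (fun s => max (Φ s - l) (ψ s)) (Icc 0 r) :=
    (hΦ.sub continuousOn_const).sup hψ
  have hmem : (0 : ℝ) ∈ Icc (max (Φ 0 - l) (ψ 0)) (max (Φ r - l) (ψ r)) := by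
    refine ⟨max_le (by linarith) h0'.le, ?_⟩
    by_contra! h
    rw [max_lt_iff] at h
    exact h1 (by linarith) h.2
  obtain ⟨s, hs, hs0⟩ := intermediate_value_Icc hr hc hmem
  simp only at hs0
  have e1 : Φ s - l ≤ 0 := hs0 ▸ le_max_left _ _
  have e2 : ψ s ≤ 0 := hs0 ▸ le_max_right _ _
  have e3 : ψ s < 0 := lt_of_le_of_ne e2 (hne s hs (by linarith))
  refine ⟨s, hs, ?_, e3⟩
  rcases max_choice (Φ s - l) (ψ s) with h | h <;> rw [h] at hs0 <;> linarith

/-! ### Triangles with prescribed small side lengths -/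

section Triangles

variable {E : Type*} [NormedAddCommGroup E] [NormedSpace ℝ E] [FiniteDimensional ℝ E]
  {G : E → E →L[ℝ] E →L[ℝ] ℝ} {T : E → E} {D : Set E} {x₀ : E} {ρ : ℝ}
  {c d : E → E → ℝ → E} {J : E × E → ℝ → E × E →L[ℝ] E × E} {V : E → E → E} {N W : Set E}

namespace IsNormalNhd

lemma exp_zero (hN : IsNormalNhd G D x₀ ρ c d J V N) : c x₀ 0 1 = x₀ := by
  have hz : (x₀, (0 : E)) ∈ Metric.ball (x₀, (0 : E)) ρ := Metric.mem_ball_self hN.flow.pos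
  have h1 := hN.flow.homog _ hz 1 (by norm_num) 0 (by simp)
  have h2 := hN.flow.c_zero _ hz
  simp only [smul_zero, zero_mul] at h1 h2
  exact h1.1.trans h2

lemma continuousOn_exp (hN : IsNormalNhd G D x₀ ρ c d J V N) :
    ContinuousOn (fun v => c x₀ v 1) (Metric.ball 0 ρ) := by
  have h : ContinuousOn (fun v : E => ((x₀, v), (1 : ℝ))) (Metric.ball 0 ρ) := by fun_prop
  exact (continuous_fst.comp_continuousOn (hN.flow.continuousOn.comp h fun v hv =>
    ⟨mem_ball_prod_zero.2 ⟨by simpa using hN.flow.pos, by simpa using hv⟩, by norm_num⟩))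

lemma continuousOn_isFutureTimelike (h : IsLorentzOn G T D) (hN : IsNormalNhd G D x₀ ρ c d J V N)
    {u : E} (hu : u ∈ N) :
    ContinuousOn (fun y => G u (V u y) (V u y)) N ∧ ContinuousOn (fun y => G u (T u) (V u y)) N := by
  have hV := hN.continuousOn_radial hu
  exact ⟨h.continuousOn_apply continuousOn_const hV hV fun _ _ => hN.subset hu,
    h.continuousOn_apply continuousOn_const continuousOn_const hV fun _ _ => hN.subset hu⟩

/-- In a null direction there are points that are strictly farther from a given past point. -/
lemma eventually_radial_lt (h : IsLorentzOn G T D) (hN : IsNormalNhd G D x₀ ρ c d J V N)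
    {u w : E} (hu : u ∈ N) (hF : IsFutureTimelike (G u) (T u) (V u x₀))
    (hw : IsFutureCausal (G x₀) (T x₀) w) :
    ∀ᶠ s in 𝓝[>] (0 : ℝ), G u (V u (c x₀ (s • w) 1)) (V u (c x₀ (s • w) 1)) <
      G u (V u x₀) (V u x₀) := by
  obtain ⟨l, hl, hlw⟩ : ∃ l : ℝ, 0 < l ∧ ‖l • w‖ < ρ := by
    refine ⟨ρ / (2 * (‖w‖ + 1)), div_pos hN.flow.pos (by positivity), ?_⟩
    rw [norm_smul, Real.norm_of_nonneg (div_nonneg hN.flow.pos.le (by positivity)),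
      div_mul_eq_mul_div, div_lt_iff₀ (by positivity)]
    nlinarith [hN.flow.pos, norm_nonneg w]
  have hz : (x₀, l • w) ∈ Metric.ball (x₀, (0 : E)) ρ :=
    mem_ball_prod_zero.2 ⟨by simpa using hN.flow.pos, by simpa using hlw⟩
  have hc0 : c x₀ (l • w) 0 = x₀ := hN.flow.c_zero _ hz
  have hd0 : d x₀ (l • w) 0 = l • w := hN.flow.d_zero _ hz
  have hder := (hN.flow.hasDerivAt_c _ hz 0 (by norm_num)).hasDerivWithinAt (s := univ)
  simp only [hd0] at hder
  have hk := hN.hasDerivWithinAt_radial hu hder (by simpa only [hc0] using hN.mem)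
  simp only [hc0, hasDerivWithinAt_univ] at hk
  -- The radial energy from `u` strictly decreases in every future causal direction, null ones
  -- included, since the radial velocity is timelike.
  have hneg : 2 * G x₀ (d u (V u x₀) 1) (l • w) < 0 := by
    have := (h.form x₀ (hN.subset hN.mem)).inner_neg (hN.radial_future h hu hN.mem hF) hw
    rw [map_smul, smul_eq_mul]
    nlinarith [mul_neg_of_pos_of_neg hl this]
  have h1 : ∀ᶠ s in 𝓝[>] (0 : ℝ), G u (V u (c x₀ (l • w) s)) (V u (c x₀ (l • w) s)) <
      G u (V u x₀) (V u x₀) := by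
    have h2 := hk.hasDerivWithinAt (s := Ioi 0)
    rw [hasDerivWithinAt_iff_tendsto_slope' self_notMem_Ioi] at h2
    filter_upwards [h2.eventually (gt_mem_nhds hneg), self_mem_nhdsWithin] with s hs hs0
    rw [slope_def_field, sub_zero, hc0] at hs
    by_contra! hcon
    exact hs.not_ge (div_nonneg (sub_nonneg.2 hcon) (le_of_lt hs0))
  have h3 : Tendsto (fun s : ℝ => s / l) (𝓝[>] 0) (𝓝[>] 0) := by
    refine tendsto_nhdsWithin_iff.2 ⟨?_, eventually_of_mem self_mem_nhdsWithin fun s hs => div_pos hs hl⟩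
    have : Continuous fun s : ℝ => s / l := by fun_prop
    have h4 := this.tendsto 0
    rw [zero_div] at h4
    exact h4.mono_left nhdsWithin_le_nhds
  filter_upwards [h3.eventually h1, Ioo_mem_nhdsGT hl] with s hs hsl
  have e := (hN.flow.homog _ hz 1 (by norm_num) (s / l)
    ⟨(div_pos hsl.1 hl).le, (div_le_one hl).2 hsl.2.le⟩).1
  simp only [smul_smul, div_mul_cancel₀ _ hl.ne', mul_one] at e
  rwa [e]

-- The vertices are `x₀`, `z = exp (l e₀)` and `y = exp (√(a² + η²) e₀ + η e₁)`, so `y` has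
-- separation `a` from `x₀` for every `η`. For `η = 0` it lies on the side to `z`, at separation at
-- least `l - a ≥ b` from `z`. For `η = r` the point `z` is no longer in its timelike future. By
-- continuity some `η` in between gives exactly `b`. The value of `r` is fixed before `ε`: as `a`
-- tends to `0`, the vector at `η = r` tends to the null vector `r (e₀ + e₁)`.
set_option maxHeartbeats 1000000 in
lemma exists_triangle (h : IsLorentzOn G T D) (hN : IsNormalNhd G D x₀ ρ c d J V N)
    {e₀ e₁ : E} {μ : ℝ} (hμ : 0 < μ) (hT : T x₀ = μ • e₀) (h00 : G x₀ e₀ e₀ = -1)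
    (h01 : G x₀ e₀ e₁ = 0) (h11 : G x₀ e₁ e₁ = 1) (hW : W ∈ 𝓝 x₀) (hWN : W ⊆ N)
    (hseg : ∀ o ∈ W, ∀ y ∈ W, ∀ s ∈ Icc (0 : ℝ) 1, c o (V o y) s ∈ N)
    (hsub : ∀ z ∈ W, IsFutureTimelike (G x₀) (T x₀) (V x₀ z) → ∀ s ∈ Ioo (0 : ℝ) 1,
      c x₀ (V x₀ z) s ∈ W →
      IsFutureTimelike (G (c x₀ (V x₀ z) s)) (T (c x₀ (V x₀ z) s)) (V (c x₀ (V x₀ z) s) z) ∧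
      (1 - s) * radialLength G V x₀ z ≤ radialLength G V (c x₀ (V x₀ z) s) z) :
    ∃ ε > 0, ∀ a b l : ℝ, 0 < a → 0 < b → a + b ≤ l → l < ε → ∃ y ∈ W, ∃ z ∈ W,
      IsFutureTimelike (G x₀) (T x₀) (V x₀ y) ∧ IsFutureTimelike (G y) (T y) (V y z) ∧
      IsFutureTimelike (G x₀) (T x₀) (V x₀ z) ∧ radialLength G V x₀ y = a ∧
      radialLength G V y z = b ∧ radialLength G V x₀ z = l := by
  have hform := h.form x₀ (hN.subset hN.mem)
  have hex0 := hN.exp_zero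
  have hexc := hN.continuousOn_exp
  have hρ := hN.flow.pos
  have h0b : (0 : E) ∈ Metric.ball (0 : E) ρ := Metric.mem_ball_self hρ
  -- small tangent vectors
  obtain ⟨δ, hδ, hδW⟩ : ∃ δ > 0, ∀ v : E, ‖v‖ < δ → (x₀, v) ∈ Metric.ball (x₀, (0 : E)) ρ ∧
      c x₀ v 1 ∈ W := by
    have h1 : ∀ᶠ v : E in 𝓝 0, c x₀ v 1 ∈ W :=
      (hexc.continuousAt (Metric.isOpen_ball.mem_nhds h0b)).eventually_mem (by simpa only [hex0] using hW)
    obtain ⟨δ, hδ, h2⟩ := Metric.eventually_nhds_iff.1 (h1.and (Metric.isOpen_ball.mem_nhds h0b))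
    refine ⟨δ, hδ, fun v hv => ?_⟩
    have h3 := h2 (by simpa using hv)
    exact ⟨mem_ball_prod_zero.2 ⟨by simpa using hρ, by simpa using h3.2⟩, h3.1⟩
  have hV : ∀ v : E, ‖v‖ < δ → V x₀ (c x₀ v 1) = v := fun v hv => hN.V_c _ _ (hδW v hv).1
  -- a point in the past
  obtain ⟨u, hu, hFu⟩ : ∃ u ∈ N, IsFutureTimelike (G u) (T u) (V u x₀) := by
    obtain ⟨u, -, hu⟩ := hN.eventually_exists_past h hN.mem
    obtain ⟨s, hs⟩ := hu.exists
    exact ⟨u s, hs⟩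
  have hcu := hN.continuousOn_isFutureTimelike h hu
  have hTe : ∀ v, G x₀ (T x₀) v = μ * G x₀ e₀ v := fun v => by rw [hT]; simp
  have hwF : IsFutureCausal (G x₀) (T x₀) (e₀ + e₁) := by
    have h10 : G x₀ e₁ e₀ = 0 := by rw [hform.symm, h01]
    refine ⟨?_, ?_⟩
    · simp [h00, h01, h11, h10]
    · rw [hTe]
      simp [h00, h01, hμ]
  have hlin : ∀ f : ℝ → E, Continuous f → f 0 = 0 → ∀ η > 0, ∀ᶠ s in 𝓝 (0 : ℝ), ‖f s‖ < η := by
    intro f hf hf0 η hη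
    have : Tendsto (fun s => ‖f s‖) (𝓝 0) (𝓝 0) := by
      have := hf.norm.tendsto 0
      simpa [hf0] using this
    exact this.eventually (gt_mem_nhds hη)
  -- a null direction in which the distance to `u` increases
  obtain ⟨r, hr0, hrlt, hrδ, hrN, hrF⟩ : ∃ r > 0,
      G u (V u (c x₀ (r • (e₀ + e₁)) 1)) (V u (c x₀ (r • (e₀ + e₁)) 1)) < G u (V u x₀) (V u x₀) ∧
      r * (‖e₀‖ + ‖e₁‖) < δ / 2 ∧ c x₀ (r • (e₀ + e₁)) 1 ∈ N ∧
      G u (T u) (V u (c x₀ (r • (e₀ + e₁)) 1)) < 0 := by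
    have h1 := hN.eventually_radial_lt h hu hFu hwF
    have hcl : Continuous fun s : ℝ => s * (‖e₀‖ + ‖e₁‖) := by fun_prop
    have h2 : ∀ᶠ s in 𝓝 (0 : ℝ), s * (‖e₀‖ + ‖e₁‖) < δ / 2 := by
      have := hcl.tendsto 0
      rw [zero_mul] at this
      exact this.eventually (gt_mem_nhds (by linarith))
    have hcs : Continuous fun s : ℝ => s • (e₀ + e₁) := by fun_prop
    have h3 : Tendsto (fun s : ℝ => c x₀ (s • (e₀ + e₁)) 1) (𝓝 0) (𝓝 x₀) := by
      have := (hexc.continuousAt (Metric.isOpen_ball.mem_nhds h0b)).tendsto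
      rw [hex0] at this
      exact this.comp (by simpa using hcs.tendsto 0)
    have h4 : ∀ᶠ y in 𝓝 x₀, y ∈ N ∧ G u (T u) (V u y) < 0 :=
      (hN.isOpen.eventually_mem hN.mem).and ((hcu.2.continuousAt (hN.isOpen.mem_nhds hN.mem)).eventually
        (gt_mem_nhds hFu.2))
    obtain ⟨r, ⟨⟨h5, h6⟩, h7⟩, h8⟩ := ((h1.and (h2.filter_mono nhdsWithin_le_nhds)).and
      ((h3.eventually h4).filter_mono nhdsWithin_le_nhds)).and self_mem_nhdsWithin |>.exists
    exact ⟨r, h8, h5, h6, h7.1, h7.2⟩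
  -- The value `m` separates the radial energies from `u`: for small `a` and `l` the point at `η =
  -- r` lies below it and `z` above it, so `z` is strictly closer to `u` than that point is.
  obtain ⟨m, hm1, hm2⟩ := exists_between hrlt
  -- the family of points at distance `a`
  set v : ℝ → ℝ → E := fun a η => √(a ^ 2 + η ^ 2) • e₀ + η • e₁ with hv
  have hvc : Continuous fun p : ℝ × ℝ => v p.1 p.2 := by
    simp only [hv]
    fun_prop
  have hv0 : v 0 r = r • (e₀ + e₁) := by
    simp [hv, Real.sqrt_sq hr0.le]
  have hrw : r • (e₀ + e₁) ∈ Metric.ball (0 : E) ρ := by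
    have h1 : ‖r • (e₀ + e₁)‖ < δ := by
      rw [norm_smul, Real.norm_of_nonneg hr0.le]
      have := mul_le_mul_of_nonneg_left (norm_add_le e₀ e₁) hr0.le
      linarith
    have := (mem_ball_prod_zero.1 (hδW _ h1).1).2
    simpa using this
  have hY : Tendsto (fun a => c x₀ (v a r) 1) (𝓝 0) (𝓝 (c x₀ (r • (e₀ + e₁)) 1)) := by
    have h1 : Continuous fun a => v a r := hvc.comp (by fun_prop : Continuous fun a : ℝ => (a, r))
    have h2 := h1.tendsto 0
    rw [hv0] at h2
    exact (hexc.continuousAt (Metric.isOpen_ball.mem_nhds hrw)).tendsto.comp h2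
  have hZ : Tendsto (fun l : ℝ => c x₀ (l • e₀) 1) (𝓝 0) (𝓝 x₀) := by
    have hcs : Continuous fun s : ℝ => s • e₀ := by fun_prop
    have := (hexc.continuousAt (Metric.isOpen_ball.mem_nhds h0b)).tendsto
    rw [hex0] at this
    exact this.comp (by simpa using hcs.tendsto 0)
  have hEa : ∀ᶠ a in 𝓝 (0 : ℝ), G u (V u (c x₀ (v a r) 1)) (V u (c x₀ (v a r) 1)) < m ∧
      G u (T u) (V u (c x₀ (v a r) 1)) < 0 :=
    hY.eventually (((hcu.1.continuousAt (hN.isOpen.mem_nhds hrN)).eventually (gt_mem_nhds hm1)).and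
      ((hcu.2.continuousAt (hN.isOpen.mem_nhds hrN)).eventually (gt_mem_nhds hrF)))
  have hEl : ∀ᶠ l in 𝓝 (0 : ℝ), m < G u (V u (c x₀ (l • e₀) 1)) (V u (c x₀ (l • e₀) 1)) :=
    hZ.eventually ((hcu.1.continuousAt (hN.isOpen.mem_nhds hN.mem)).eventually (lt_mem_nhds hm2))
  have hEd : ∀ᶠ l in 𝓝 (0 : ℝ), ‖l • e₀‖ < δ / 2 :=
    hlin (fun l => l • e₀) (by fun_prop) (by simp) _ (by linarith)
  obtain ⟨ε, hε, hεE⟩ := Metric.eventually_nhds_iff.1 ((hEa.and hEl).and hEd)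
  refine ⟨ε, hε, fun a b l ha hb hab hl => ?_⟩
  have hla : a < l := by linarith
  have hl0 : 0 < l := ha.trans hla
  have hEa' := hεE (show dist a 0 < ε by
    rw [dist_zero_right, Real.norm_of_nonneg ha.le]; linarith)
  have hEl' := hεE (show dist l 0 < ε by
    rw [dist_zero_right, Real.norm_of_nonneg hl0.le]; linarith)
  have hvδ : ∀ η ∈ Icc 0 r, ‖v a η‖ < δ := by
    intro η hη
    have h1 : √(a ^ 2 + η ^ 2) ≤ a + η := by
      rw [Real.sqrt_le_left (by linarith [hη.1])]
      nlinarith [hη.1, mul_nonneg ha.le hη.1]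
    have h2 : ‖v a η‖ ≤ √(a ^ 2 + η ^ 2) * ‖e₀‖ + η * ‖e₁‖ := by
      refine (norm_add_le _ _).trans (le_of_eq ?_)
      rw [norm_smul, norm_smul, Real.norm_of_nonneg (Real.sqrt_nonneg _), Real.norm_of_nonneg hη.1]
    have h3 : a * ‖e₀‖ < δ / 2 := by
      have := hEa'.2
      rwa [norm_smul, Real.norm_of_nonneg ha.le] at this
    have h4 := mul_le_mul_of_nonneg_right h1 (norm_nonneg e₀)
    have h5 := mul_le_mul_of_nonneg_right hη.2 (add_nonneg (norm_nonneg e₀) (norm_nonneg e₁))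
    nlinarith
  have hzδ : ‖l • e₀‖ < δ := by linarith [hEl'.2]
  set z := c x₀ (l • e₀) 1 with hz
  have hzW : z ∈ W := (hδW _ hzδ).2
  have hVz : V x₀ z = l • e₀ := hV _ hzδ
  have hzF : IsFutureTimelike (G x₀) (T x₀) (V x₀ z) := by
    rw [hVz]
    refine ⟨?_, ?_⟩
    · simp [h00, hl0]
    · rw [hTe]
      simp [h00, hl0, hμ]
  have hzr : radialLength G V x₀ z = l := by
    rw [radialLength, hVz]
    simp [h00, Real.sqrt_mul_self hl0.le]
  set Y : ℝ → E := fun η => c x₀ (v a η) 1 with hYd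
  have hYW : MapsTo Y (Icc 0 r) W := fun η hη => (hδW _ (hvδ η hη)).2
  have hYc : ContinuousOn Y (Icc 0 r) :=
    hexc.comp (hvc.comp (by fun_prop : Continuous fun η : ℝ => (a, η))).continuousOn fun η hη => by
      have := (mem_ball_prod_zero.1 (hδW _ (hvδ η hη)).1).2
      simpa using this
  have hVc : ContinuousOn (fun η => V (Y η) z) (Icc 0 r) :=
    hN.continuousOn_V.comp (hYc.prodMk continuousOn_const) fun η hη => ⟨hWN (hYW hη), hWN hzW⟩
  have hYD : MapsTo Y (Icc 0 r) D := fun η hη => hN.subset (hWN (hYW hη))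
  have hΦ := h.continuousOn_apply hYc hVc hVc hYD
  have hψ := h.continuousOn_apply hYc (h.continuousOn.comp hYc hYD) hVc hYD
  have hY0 : Y 0 = c x₀ (V x₀ z) (a / l) := by
    have e := (hN.flow.homog _ (hδW _ hzδ).1 1 (by norm_num) (a / l)
      ⟨(div_pos ha hl0).le, (div_le_one hl0).2 hla.le⟩).1
    simp only [smul_smul, div_mul_cancel₀ _ hl0.ne', mul_one] at e
    rw [hVz, ← e]
    simp [hYd, hv, Real.sqrt_sq ha.le]
  have h0mem : (0 : ℝ) ∈ Icc 0 r := ⟨le_rfl, hr0.le⟩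
  have hrmem : r ∈ Icc 0 r := ⟨hr0.le, le_rfl⟩
  have hs0 := hsub z hzW hzF (a / l) ⟨div_pos ha hl0, (div_lt_one hl0).2 hla⟩ (hY0 ▸ hYW h0mem)
  rw [← hY0, hzr] at hs0
  have hbl : b ≤ radialLength G V (Y 0) z := by
    refine le_trans ?_ hs0.2
    rw [sub_mul, div_mul_cancel₀ _ hl0.ne']
    linarith
  obtain ⟨η, hη, hη1, hη2⟩ := exists_level_of_continuousOn hr0.le (l := -b ^ 2) (by nlinarith) hΦ hψ
    (fun s hs hs1 => ((h.form _ (hYD hs)).neg_of_nonpos hs1 |> fun k hk => (k hk.le).ne hk))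
    (by rw [radialLength_sq hs0.1]; nlinarith) hs0.1.2 (by
      -- If `z` were in the timelike future of `Y r`, the radial length from `u` could only increase
      -- from `Y r` to `z`, contrary to the choice of `m`.
      intro hr1 hr2
      have hF : IsFutureTimelike (G (Y r)) (T (Y r)) (V (Y r) z) := ⟨hr1.trans_lt (by nlinarith), hr2⟩
      have hyN := hWN (hYW hrmem)
      have hb := hN.V_mem _ hyN z (hWN hzW)
      have hI : Icc (0 : ℝ) 1 ⊆ Ioo (-2) 2 := fun s hs => ⟨by linarith [hs.1], by linarith [hs.2]⟩
      have he : ∀ s ∈ Icc (0 : ℝ) 1, HasDerivWithinAt (c (Y r) (V (Y r) z)) (d (Y r) (V (Y r) z) s)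
          (Icc 0 1) s := fun s hs => (hN.flow.hasDerivAt_c _ hb s (hI hs)).hasDerivWithinAt
      have he' : ContinuousOn (d (Y r) (V (Y r) z)) (Icc 0 1) := fun s hs =>
        (hN.flow.hasDerivAt_d _ hb s (hI hs)).continuousAt.continuousWithinAt
      have heN : MapsTo (c (Y r) (V (Y r) z)) (Icc 0 1) N := hseg _ (hYW hrmem) _ hzW
      have hcc : ∀ s ∈ Icc (0 : ℝ) 1, IsFutureCausal (G (c (Y r) (V (Y r) z) s))
          (T (c (Y r) (V (Y r) z) s)) (d (Y r) (V (Y r) z) s) := fun s hs =>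
        (hN.flow.isFutureTimelike h hb hF (hI hs)).isFutureCausal
      have hst : c (Y r) (V (Y r) z) 0 = Y r := hN.flow.c_zero _ hb
      have hen : c (Y r) (V (Y r) z) 1 = z := hN.c_V _ hyN _ (hWN hzW)
      have hFy : IsFutureTimelike (G u) (T u) (V u (Y r)) :=
        ⟨hEa'.1.1.1.trans (hm2.trans hFu.1), hEa'.1.1.2⟩
      have hFz := hN.inCone_of_curve h he heN hcc hu (by rwa [hst]) 1 (by simp)
      have hle := hN.lintegral_le_of_curve h zero_le_one he he' heN hcc hu (by rwa [hst])
      rw [hen] at hFz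
      rw [hst, hen] at hle
      have hle2 := (ENNReal.ofReal_le_ofReal_iff (radialLength_nonneg G V u z)).1 (le_self_add.trans hle)
      have q1 := radialLength_sq hFy
      have q2 := radialLength_sq hFz
      have q3 : radialLength G V u (Y r) ^ 2 ≤ radialLength G V u z ^ 2 :=
        pow_le_pow_left₀ (radialLength_nonneg G V u _) hle2 2
      have q4 := hEa'.1.1.1
      have q5 := hEl'.1.2
      linarith)
  have hVY : V x₀ (Y η) = v a η := hV _ (hvδ η hη)
  have h10 : G x₀ e₁ e₀ = 0 := by rw [hform.symm, h01]
  have hsq : √(a ^ 2 + η ^ 2) * √(a ^ 2 + η ^ 2) = a ^ 2 + η ^ 2 := Real.mul_self_sqrt (by positivity)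
  have hvv : G x₀ (v a η) (v a η) = -a ^ 2 := by
    simp only [hv, map_add, map_smul, add_apply, smul_apply, smul_eq_mul, h00, h01, h10, h11]
    nlinarith
  refine ⟨Y η, hYW hη, z, hzW, ⟨?_, ?_⟩, ⟨hη1.trans_lt (by nlinarith), hη2⟩, hzF, ?_, ?_, hzr⟩
  · rw [hVY, hvv]
    nlinarith
  · rw [hVY, hTe]
    have : 0 < √(a ^ 2 + η ^ 2) := Real.sqrt_pos.2 (by positivity)
    simp only [hv, map_add, map_smul, smul_eq_mul, h00, h01]
    nlinarith [mul_pos hμ this]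
  · rw [radialLength, hVY, hvv, neg_neg, Real.sqrt_sq ha.le]
  · rw [radialLength, hη1, neg_neg, Real.sqrt_sq hb.le]

end IsNormalNhd

end Triangles

lemma IsLorentzForm.exists_orthonormal {E : Type*} [NormedAddCommGroup E] [NormedSpace ℝ E]
    [FiniteDimensional ℝ E] {B : E →L[ℝ] E →L[ℝ] ℝ} {T : E} (h : IsLorentzForm B T)
    (hdim : 2 ≤ Module.finrank ℝ E) :
    ∃ (e₀ e₁ : E) (μ : ℝ), 0 < μ ∧ T = μ • e₀ ∧ B e₀ e₀ = -1 ∧ B e₀ e₁ = 0 ∧ B e₁ e₁ = 1 := by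
  obtain ⟨w, hw, hw0⟩ : ∃ w, B T w = 0 ∧ w ≠ 0 := by
    by_contra! hcon
    have hker : LinearMap.ker (B T : E →ₗ[ℝ] ℝ) = ⊥ := by
      rw [Submodule.eq_bot_iff]
      intro w hw
      exact hcon w (by simpa using hw)
    have h1 := LinearMap.finrank_le_finrank_of_injective (LinearMap.ker_eq_bot.1 hker)
    rw [Module.finrank_self] at h1
    omega
  have hw2 := h.posDef w hw hw0
  have hT := h.timelike
  have hμ : 0 < √(-B T T) := Real.sqrt_pos.2 (by linarith)
  have hν : 0 < √(B w w) := Real.sqrt_pos.2 hw2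
  have e1 : √(-B T T) * √(-B T T) = -B T T := Real.mul_self_sqrt (by linarith)
  have e2 : √(B w w) * √(B w w) = B w w := Real.mul_self_sqrt hw2.le
  refine ⟨(√(-B T T))⁻¹ • T, (√(B w w))⁻¹ • w, √(-B T T), hμ, ?_, ?_, ?_, ?_⟩
  · rw [smul_smul, mul_inv_cancel₀ hμ.ne', one_smul]
  · simp only [map_smul, smul_apply, smul_eq_mul]
    field_simp
    linarith
  · simp [hw]
  · simp only [map_smul, smul_apply, smul_eq_mul]
    field_simp
    linarith

lemma IsNormalNhd.V_self {E : Type*} [NormedAddCommGroup E] [NormedSpace ℝ E] [FiniteDimensional ℝ E]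
    {G : E → E →L[ℝ] E →L[ℝ] ℝ} {D : Set E} {x₀ : E} {ρ : ℝ}
    {c d : E → E → ℝ → E} {J : E × E → ℝ → E × E →L[ℝ] E × E} {V : E → E → E} {N : Set E}
    (hN : IsNormalNhd G D x₀ ρ c d J V N) {o : E} (ho : o ∈ N) : V o o = 0 := by
  have hz : (o, (0 : E)) ∈ Metric.ball (x₀, (0 : E)) ρ :=
    mem_ball_prod_zero.2 ⟨(mem_ball_prod_zero.1 (hN.V_mem o ho o ho)).1, by simpa using hN.flow.pos⟩
  have h1 := hN.flow.homog _ hz 1 (by norm_num) 0 (by simp)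
  have h2 := hN.flow.c_zero _ hz
  simp only [smul_zero, zero_mul] at h1 h2
  have h3 := hN.V_c o 0 hz
  rwa [h1.1.trans h2] at h3

namespace SpacetimeMetric

section

variable {n : ℕ} {M : Type*} [MetricSpace M]
  [ChartedSpace (EuclideanSpace ℝ (Fin n)) M] [IsManifold (𝓡 n) ∞ M] {g : SpacetimeMetric n M}
  {x₀ x₁ : M} {ρ : ℝ}
  {c d : EuclideanSpace ℝ (Fin n) → EuclideanSpace ℝ (Fin n) → ℝ → EuclideanSpace ℝ (Fin n)}
  {J : EuclideanSpace ℝ (Fin n) × EuclideanSpace ℝ (Fin n) → ℝ →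
    EuclideanSpace ℝ (Fin n) × EuclideanSpace ℝ (Fin n) →L[ℝ]
    EuclideanSpace ℝ (Fin n) × EuclideanSpace ℝ (Fin n)}
  {V : EuclideanSpace ℝ (Fin n) → EuclideanSpace ℝ (Fin n) → EuclideanSpace ℝ (Fin n)}
  {N : Set (EuclideanSpace ℝ (Fin n))} {p₀ : EuclideanSpace ℝ (Fin n)}

lemma curveLength_le_tau {γ : ℝ → M} {a b : ℝ} (h : IsPiecewiseC1With g.FutureCausal γ a b) :
    g.curveLength γ a b ≤ g.causalData.τ (γ a) (γ b) :=
  le_iSup₂_of_le γ a (le_iSup₂_of_le b ⟨h, rfl, rfl⟩ le_rfl)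

/-- Radial timelike geodesics that realise the time separation are sides of triangles. -/
lemma isSide_radial (hM : C1CurvesLipschitz n M)
    (hN : IsNormalNhd (g.chartForm x₁) (extChartAt (𝓡 n) x₁).target p₀ ρ c d J V N)
    {o y : EuclideanSpace ℝ (Fin n)} (ho : o ∈ N) (hy : y ∈ N)
    (hF : IsFutureTimelike (g.chartForm x₁ o) (g.chartTime x₁ o) (V o y))
    (hτ : g.causalData.τ ((extChartAt (𝓡 n) x₁).symm o) ((extChartAt (𝓡 n) x₁).symm y) =
      ENNReal.ofReal (radialLength (g.chartForm x₁) V o y)) :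
    g.causalData.IsSide (fun s => (extChartAt (𝓡 n) x₁).symm (c o (V o y) s))
      ((extChartAt (𝓡 n) x₁).symm o) ((extChartAt (𝓡 n) x₁).symm y) := by
  obtain ⟨h1, h2⟩ := g.radial_timelike hN ho hy hF
  have hb := hN.V_mem o ho y hy
  have h3 : IsPiecewiseC1With g.FutureCausal
      (fun s => (extChartAt (𝓡 n) x₁).symm (c o (V o y) s)) 0 1 :=
    h1.isPiecewiseC1With.imp fun x v hv => ⟨hv.1.le, hv.2⟩
  have hc0 : c o (V o y) 0 = o := hN.flow.c_zero _ hb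
  have hc1 : c o (V o y) 1 = y := hN.c_V o ho y hy
  refine Or.inr ⟨fun he => ?_, ⟨h3.isCausalCurve hM, by simp only [hc0], by simp only [hc1]⟩, ?_⟩
  · have : o = y := (extChartAt (𝓡 n) x₁).symm.injOn (hN.subset ho) (hN.subset hy) he
    subst this
    rw [hN.V_self ho] at hF
    simpa using hF.1
  · refine le_antisymm ?_ ?_
    · have := CausalData.length_le_tau_of_le (S := g.causalData)
        (γ := fun s => (extChartAt (𝓡 n) x₁).symm (c o (V o y) s)) zero_le_one
      simpa only [hc0, hc1] using this
    · rw [hτ]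
      refine le_trans (le_of_eq ?_) (g.curveLength_le_length h3)
      rw [h2 0 (by simp) 1 (by simp) zero_le_one, sub_zero, one_mul]

/-- Near a point of strong causality `τ` equals the radial length, so radial triangles of the chart
are triangles with maximal sides. Dimension at least two supplies the spacelike direction `e₁`. -/
theorem exists_hasSmallTriangles (hM : C1CurvesLipschitz n M) (hn : 2 ≤ n) (hsc : g.StronglyCausalAt x₀) :
    ∃ ε > 0, g.causalData.HasSmallTriangles ε := by
  have hL := g.isLorentzOn_chart x₀
  have hxs := mem_extChartAt_source (I := 𝓡 n) x₀
  have hxt := mem_extChartAt_target (I := 𝓡 n) x₀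
  obtain ⟨ρ, c, d, J, V, N, hN⟩ := hL.exists_normalNhd hxt
  obtain ⟨W, hW, hWs, hWp⟩ := g.exists_nhds_tau_eq hsc hxs hN
  obtain ⟨e₀, e₁, μ, hμ, hT, h00, h01, h11⟩ := (hL.form _ hxt).exists_orthonormal (by simpa using hn)
  set ψ := extChartAt (𝓡 n) x₀ with hψ
  set W' : Set (EuclideanSpace ℝ (Fin n)) := ψ.target ∩ ψ.symm ⁻¹' W with hW'
  have hW'n : W' ∈ 𝓝 (ψ x₀) := by
    refine inter_mem (extChartAt_target_mem_nhds x₀) ?_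
    exact (continuousAt_extChartAt_symm x₀).preimage_mem_nhds (by rwa [ψ.left_inv hxs])
  have hψr : ∀ y ∈ W', ψ (ψ.symm y) = y := fun y hy => ψ.right_inv hy.1
  have key : ∀ o ∈ W', ∀ y ∈ W', o ∈ N ∧ y ∈ N ∧ (∀ s ∈ Icc (0 : ℝ) 1, c o (V o y) s ∈ N) ∧
      (0 < g.causalData.τ (ψ.symm o) (ψ.symm y) →
        IsFutureTimelike (g.chartForm x₀ o) (g.chartTime x₀ o) (V o y)) ∧
      (IsFutureTimelike (g.chartForm x₀ o) (g.chartTime x₀ o) (V o y) →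
        g.causalData.τ (ψ.symm o) (ψ.symm y) = ENNReal.ofReal (radialLength (g.chartForm x₀) V o y)) := by
    intro o ho y hy
    have := hWp _ ho.2 _ hy.2
    rwa [hψr o ho, hψr y hy] at this
  have hx₀W : ψ x₀ ∈ W' := mem_of_mem_nhds hW'n
  obtain ⟨ε, hε, hεT⟩ := hN.exists_triangle hL hμ hT h00 h01 h11 hW'n (fun y hy => (key y hy y hy).1)
    (fun o ho y hy => (key o ho y hy).2.2.1) (by
      -- The remainder of the radial geodesic beyond `s` is a competitor for `τ`, and `τ` is in turn
      -- the radial length from the intermediate point.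
      intro z hz hF s hs hsW
      have h1 := (key _ hx₀W z hz)
      obtain ⟨h2, h3⟩ := g.radial_timelike hN h1.1 h1.2.1 hF
      have h4 : IsPiecewiseC1With g.FutureCausal
          (fun s => (extChartAt (𝓡 n) x₀).symm (c (ψ x₀) (V (ψ x₀) z) s)) s 1 :=
        (h2.mono hs.1.le hs.2 le_rfl).isPiecewiseC1With.imp fun x v hv => ⟨hv.1.le, hv.2⟩
      have h5 := curveLength_le_tau h4
      rw [h3 s ⟨hs.1.le, hs.2.le⟩ 1 (by simp) hs.2.le, hN.c_V _ h1.1 _ h1.2.1] at h5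
      have h6 := key _ hsW z hz
      have hr : 0 < radialLength (g.chartForm x₀) V (ψ x₀) z := IsNormalNhd.radialLength_pos hF
      have hpos : 0 < ENNReal.ofReal ((1 - s) * radialLength (g.chartForm x₀) V (ψ x₀) z) :=
        ENNReal.ofReal_pos.2 (mul_pos (by linarith [hs.2]) hr)
      have h7 := h6.2.2.2.1 (hpos.trans_le h5)
      refine ⟨h7, ?_⟩
      have h8 := h5.trans_eq (h6.2.2.2.2 h7)
      exact (ENNReal.ofReal_le_ofReal_iff (radialLength_nonneg _ _ _ _)).1 h8)
  refine ⟨ε, hε, fun a b l ha hb hab hl => ?_⟩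
  obtain ⟨y, hy, z, hz, F1, F2, F3, r1, r2, r3⟩ := hεT a b l ha hb hab hl
  have k1 := key _ hx₀W y hy
  have k2 := key y hy z hz
  have k3 := key _ hx₀W z hz
  have k0 := key _ hx₀W _ hx₀W
  have t1 := k1.2.2.2.2 F1
  have t2 := k2.2.2.2.2 F2
  have t3 := k3.2.2.2.2 F3
  refine ⟨_, _, _, _, _, _, ⟨isSide_radial hM hN k1.1 k1.2.1 F1 t1, isSide_radial hM hN k2.1 k2.2.1 F2 t2,
    isSide_radial hM hN k3.1 k3.2.1 F3 t3⟩, by rw [← r1]; exact t1, by rw [← r2]; exact t2,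
    by rw [← r3]; exact t3, ?_⟩
  by_contra h0
  have := (k0.2.2.2.1 (pos_iff_ne_zero.2 h0)).1
  rw [hN.V_self hN.mem] at this
  simp at this

end

/-! ### Small triangles in the model spaces -/

section Model

lemma c1CurvesLipschitz_euclideanSpace : C1CurvesLipschitz 2 (EuclideanSpace ℝ (Fin 2)) := by
  intro γ a b hab h
  exact (contMDiffOn_iff_contDiffOn.1 h).exists_lipschitzOnWith one_ne_zero (convex_Icc a b) isCompact_Icc

/-- Functions with nonnegative derivative in future causal directions are nondecreasing along causal
curves. -/
lemma monotoneOn_of_causal {g : SpacetimeMetric 2 (EuclideanSpace ℝ (Fin 2))} {F : EuclideanSpace ℝ (Fin 2) → ℝ} {F' : EuclideanSpace ℝ (Fin 2) → EuclideanSpace ℝ (Fin 2) →L[ℝ] ℝ}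
    (hF : ∀ y, HasFDerivAt F (F' y) y) (hF' : ∀ y v, g.FutureCausal y v → 0 ≤ F' y v) {γ : ℝ → EuclideanSpace ℝ (Fin 2)}
    {a b : ℝ} (h : IsPiecewiseC1With g.FutureCausal γ a b) : F (γ a) ≤ F (γ b) := by
  refine h.induction (Q := fun a b => F (γ a) ≤ F (γ b)) (fun a b h => ?_) fun _ _ _ _ _ h1 h2 => h1.trans h2
  obtain ⟨hab, hγ, hv⟩ := h
  have hγ' := contMDiffOn_iff_contDiffOn.1 hγ
  have hd : ∀ s ∈ Icc a b, HasDerivWithinAt (fun s => F (γ s)) (F' (γ s) (velocityWithin γ a b s))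
      (Icc a b) s := by
    intro s hs
    have h1 := (hγ'.differentiableOn one_ne_zero s hs).hasFDerivWithinAt
    have h2 := ((hF (γ s)).comp_hasFDerivWithinAt s h1).hasDerivWithinAt
    have h3 : (velocityWithin γ a b s : EuclideanSpace ℝ (Fin 2)) = fderivWithin ℝ γ (Icc a b) s 1 := by
      rw [velocityWithin, mfderivWithin_eq_fderivWithin]
      rfl
    rw [h3]
    exact h2
  refine monotoneOn_of_deriv_nonneg (convex_Icc a b) (fun s hs => (hd s hs).continuousWithinAt)
    (fun s hs => ?_) (fun s hs => ?_) ⟨le_rfl, hab.le⟩ ⟨hab.le, le_rfl⟩ hab.le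
  · exact (hd s (interior_subset hs)).differentiableWithinAt.mono interior_subset
  · rw [interior_Icc] at hs
    have h1 := (hd s (Ioo_subset_Icc_self hs)).hasDerivAt (Icc_mem_nhds hs.1 hs.2)
    rw [h1.deriv]
    exact hF' _ _ (hv s (Ioo_subset_Icc_self hs))

/-- The coefficient of `dx²` is at least `1`, so replacing it by `1` only widens the cones. -/
lemma modelSpacetime_futureCausal {K : ℝ} {y v : EuclideanSpace ℝ (Fin 2)} (h : (modelSpacetime K).FutureCausal y v) :
    |v 1| ≤ Real.cosh (√(max (-K) 0) * y 1) * v 0 := by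
  obtain ⟨h1, h2⟩ := h
  change modelForm K y v v ≤ 0 at h1
  change modelForm K y (EuclideanSpace.single 0 1) v < 0 at h2
  rw [modelForm_apply] at h1 h2
  have c1 := Real.one_le_cosh (√(max K 0) * y 0)
  have c2 := Real.cosh_pos (√(max (-K) 0) * y 1)
  simp at h2
  have hv0 : 0 < v 0 := by
    by_contra! hcon
    nlinarith [sq_nonneg (Real.cosh (√(max (-K) 0) * y 1))]
  refine abs_le_of_sq_le_sq ?_ (mul_nonneg c2.le hv0.le)
  nlinarith [mul_nonneg (sub_nonneg.2 (one_le_pow₀ c1 (n := 2))) (sq_nonneg (v 1))]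

/-- With `X x = ∫ du / cosh (k u)`, the functions `t`, `t + X` and `t - X` are nondecreasing along
causal curves. Their values at the end points therefore confine the whole curve to a small box. -/
lemma modelSpacetime_stronglyCausalAt (K : ℝ) : (modelSpacetime K).StronglyCausalAt 0 := by
  set k := √(max (-K) 0) with hk
  set X : ℝ → ℝ := fun x => ∫ u in (0 : ℝ)..x, (Real.cosh (k * u))⁻¹ with hX
  have hcont : Continuous fun u : ℝ => (Real.cosh (k * u))⁻¹ :=
    (by fun_prop : Continuous fun u : ℝ => Real.cosh (k * u)).inv₀ fun u => (Real.cosh_pos _).ne'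
  have hXd : ∀ x, HasDerivAt X (Real.cosh (k * x))⁻¹ x := fun x =>
    intervalIntegral.integral_hasDerivAt_right (hcont.intervalIntegrable _ _)
      (hcont.stronglyMeasurableAtFilter _ _) hcont.continuousAt
  have hXm : StrictMono X := strictMono_of_deriv_pos fun x => by
    rw [(hXd x).deriv]
    exact inv_pos.2 (Real.cosh_pos _)
  have hX0 : X 0 = 0 := by simp [hX]
  have hXc : Continuous X := continuous_iff_continuousAt.2 fun x => (hXd x).continuousAt
  have hp (i : Fin 2) (y : EuclideanSpace ℝ (Fin 2)) : HasFDerivAt (fun y : EuclideanSpace ℝ (Fin 2) => y i) (EuclideanSpace.proj i : EuclideanSpace ℝ (Fin 2) →L[ℝ] ℝ) y :=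
    (EuclideanSpace.proj i : EuclideanSpace ℝ (Fin 2) →L[ℝ] ℝ).hasFDerivAt
  have hXp (y : EuclideanSpace ℝ (Fin 2)) := (hXd (y 1)).comp_hasFDerivAt y (hp 1 y)
  have hcausal : ∀ {y v : EuclideanSpace ℝ (Fin 2)}, (modelSpacetime K).FutureCausal y v → 0 ≤ v 0 ∧
      |(Real.cosh (k * y 1))⁻¹ * v 1| ≤ v 0 := by
    intro y v h
    have h1 := modelSpacetime_futureCausal h
    have c2 := Real.cosh_pos (k * y 1)
    rw [abs_mul, abs_of_pos (inv_pos.2 c2), inv_mul_le_iff₀ c2]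
    exact ⟨nonneg_of_mul_nonneg_right ((abs_nonneg _).trans h1) c2, h1⟩
  intro U hU
  obtain ⟨η, hη, hηU⟩ : ∃ η > 0, ∀ y : EuclideanSpace ℝ (Fin 2), |y 0| < η → |y 1| < η → y ∈ U := by
    obtain ⟨δ, hδ, hδU⟩ := Metric.mem_nhds_iff.1 hU
    refine ⟨δ / 2, by linarith, fun y h0 h1 => hδU ?_⟩
    rw [mem_ball_zero_iff, EuclideanSpace.norm_eq, Real.sqrt_lt' hδ, Fin.sum_univ_two]
    simp only [Real.norm_eq_abs, sq_abs]
    have := sq_lt_sq.2 (h0.trans_eq (abs_of_pos (half_pos hδ)).symm)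
    have := sq_lt_sq.2 (h1.trans_eq (abs_of_pos (half_pos hδ)).symm)
    nlinarith
  -- If `|t| < β` and `|X| < β` at the ends, then along the curve `|t| < β` and `t ± X < 2β`, hence
  -- `|X| < 3β`.
  obtain ⟨β, hβ, hβη, hβ1, hβ2⟩ : ∃ β > 0, β ≤ η ∧ 3 * β ≤ X η ∧ 3 * β ≤ -X (-η) := by
    have h1 : 0 < X η := hX0 ▸ hXm hη
    have h2 : X (-η) < 0 := hX0 ▸ hXm (by linarith : -η < 0)
    refine ⟨min η (min (X η / 3) (-X (-η) / 3)), lt_min hη (lt_min (by linarith) (by linarith)),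
      min_le_left _ _, ?_, ?_⟩
    · linarith [(min_le_right η (min (X η / 3) (-X (-η) / 3))).trans (min_le_left _ _)]
    · linarith [(min_le_right η (min (X η / 3) (-X (-η) / 3))).trans (min_le_right _ _)]
  have hbox : ∀ y : EuclideanSpace ℝ (Fin 2), |y 0| < β → |X (y 1)| < 3 * β → y ∈ U := by
    intro y h0 h1
    rw [abs_lt] at h1
    refine hηU y (h0.trans_le hβη) (abs_lt.2 ⟨?_, ?_⟩)
    · exact hXm.lt_iff_lt.1 (by linarith)
    · exact hXm.lt_iff_lt.1 (by linarith)
  refine ⟨{y | |y 0| < β ∧ |X (y 1)| < β}, ?_, fun y hy => hbox y hy.1 (hy.2.trans (by linarith)), ?_⟩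
  · have h0 : Continuous fun y : EuclideanSpace ℝ (Fin 2) => |y 0| := by fun_prop
    have h1 : Continuous fun y : EuclideanSpace ℝ (Fin 2) => |X (y 1)| := (hXc.comp (by fun_prop)).abs
    refine ((isOpen_lt h0 continuous_const).inter (isOpen_lt h1 continuous_const)).mem_nhds ?_
    simp [hX0, hβ]
  · rintro γ a b p q hp' hq' ⟨hγ, rfl, rfl⟩ s hs
    have mono : ∀ (F : EuclideanSpace ℝ (Fin 2) → ℝ) (F' : EuclideanSpace ℝ (Fin 2) → EuclideanSpace ℝ (Fin 2) →L[ℝ] ℝ), (∀ y, HasFDerivAt F (F' y) y) →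
        (∀ y v, (modelSpacetime K).FutureCausal y v → 0 ≤ F' y v) →
        F (γ a) ≤ F (γ s) ∧ F (γ s) ≤ F (γ b) := by
      intro F F' hF hF'
      constructor
      · rcases hs.1.eq_or_lt with h | h
        · rw [h]
        · exact monotoneOn_of_causal hF hF' (hγ.mono le_rfl h hs.2)
      · rcases hs.2.eq_or_lt with h | h
        · rw [h]
        · exact monotoneOn_of_causal hF hF' (hγ.mono hs.1 h le_rfl)
    have m1 := mono _ _ (hp 0) fun y v h => by simpa using (hcausal h).1
    have m2 := mono _ _ (fun y => (hp 0 y).add (hXp y)) fun y (w : EuclideanSpace ℝ (Fin 2)) h => by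
      have := abs_le.1 (hcausal h).2
      change 0 ≤ w 0 + (Real.cosh (k * y 1))⁻¹ * w 1
      linarith
    have m3 := mono _ _ (fun y => (hp 0 y).sub (hXp y)) fun y (w : EuclideanSpace ℝ (Fin 2)) h => by
      have := abs_le.1 (hcausal h).2
      change 0 ≤ w 0 - (Real.cosh (k * y 1))⁻¹ * w 1
      linarith
    simp only [Pi.add_apply, Pi.sub_apply, Function.comp_apply] at m1 m2 m3
    have a1 := abs_lt.1 hp'.1
    have a2 := abs_lt.1 hp'.2
    have a3 := abs_lt.1 hq'.1
    have a4 := abs_lt.1 hq'.2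
    refine hbox _ (abs_lt.2 ⟨by linarith, by linarith⟩) (abs_lt.2 ⟨by linarith, by linarith⟩)

theorem exists_hasSmallTriangles_modelSpace (K : ℝ) : ∃ ε > 0, (modelSpace K).HasSmallTriangles ε :=
  exists_hasSmallTriangles c1CurvesLipschitz_euclideanSpace le_rfl (modelSpacetime_stronglyCausalAt K)

end Model

end SpacetimeMetric

/-! ### Changing and reparametrising curves -/

namespace CausalData

variable {X : Type*} [MetricSpace X] {S : CausalData X} {γ σ : ℝ → X} {a b : ℝ}

lemma length_congr_le (h : EqOn γ σ (Icc a b)) : S.length γ a b ≤ S.length σ a b := by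
  refine le_length fun N t ht h0 hN => (length_le_sum ht h0 hN).trans (le_of_eq ?_)
  refine Finset.sum_congr rfl fun i hi => ?_
  have hi := Finset.mem_range.1 hi
  have hmem : ∀ j ≤ N, t j ∈ Icc a b := fun j hj =>
    ⟨h0 ▸ ht.monotone (Nat.zero_le j), hN ▸ ht.monotone hj⟩
  rw [h (hmem i hi.le), h (hmem (i + 1) hi)]

lemma length_congr (h : EqOn γ σ (Icc a b)) : S.length γ a b = S.length σ a b :=
  (length_congr_le h).antisymm (length_congr_le h.symm)

lemma IsCausalCurve.congr {J : Set ℝ} (h : S.IsCausalCurve γ J) (he : EqOn σ γ J) :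
    S.IsCausalCurve σ J where
  ordConnected := h.ordConnected
  nonconstant := by
    obtain ⟨s, hs, t, ht, hne⟩ := h.nonconstant
    exact ⟨s, hs, t, ht, by rwa [he hs, he ht]⟩
  locallyLipschitz := by
    intro x hx
    obtain ⟨K, t, ht, hK⟩ := h.locallyLipschitz hx
    refine ⟨K, t ∩ J, inter_mem ht self_mem_nhdsWithin, fun y hy z hz => ?_⟩
    rw [he hy.2, he hz.2]
    exact hK hy.1 hz.1
  le s hs t ht hst := by
    rw [he hs, he ht]
    exact h.le s hs t ht hst

lemma IsCausalCurve.mono {J : Set ℝ} (h : S.IsCausalCurve γ J) (hJ : Icc a b ⊆ J) (hab : a ≤ b)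
    (hne : γ a ≠ γ b) : S.IsCausalCurve γ (Icc a b) where
  ordConnected := ordConnected_Icc
  nonconstant := ⟨a, ⟨le_rfl, hab⟩, b, ⟨hab, le_rfl⟩, hne⟩
  locallyLipschitz := h.locallyLipschitz.mono hJ
  le s hs t ht := h.le s (hJ hs) t (hJ ht)

end CausalData

/-- A curve factors continuously through a monotone function with the same level sets. -/
lemma exists_continuousOn_factor {X : Type*} [TopologicalSpace X] {σ : ℝ → X} {f : ℝ → ℝ} {α β : ℝ}
    (hαβ : α ≤ β) (hσ : ContinuousOn σ (Icc α β)) (hf : ContinuousOn f (Icc α β))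
    (hmono : MonotoneOn f (Icc α β))
    (hlev : ∀ s ∈ Icc α β, ∀ t ∈ Icc α β, f s = f t → σ s = σ t) :
    ∃ C : ℝ → X, ContinuousOn C (Icc (f α) (f β)) ∧ ∀ s ∈ Icc α β, C (f s) = σ s := by
  have hsurj : ∀ v ∈ Icc (f α) (f β), ∃ s ∈ Icc α β, f s = v := fun v hv =>
    intermediate_value_Icc hαβ hf hv
  choose! s hs hfs using hsurj
  have hmaps : ∀ t ∈ Icc α β, f t ∈ Icc (f α) (f β) := fun t ht =>
    ⟨hmono ⟨le_rfl, hαβ⟩ ht ht.1, hmono ht ⟨hαβ, le_rfl⟩ ht.2⟩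
  have hC : ∀ t ∈ Icc α β, σ (s (f t)) = σ t := fun t ht =>
    hlev _ (hs _ (hmaps t ht)) _ ht (hfs _ (hmaps t ht))
  refine ⟨fun v => σ (s v), ?_, hC⟩
  -- No continuous choice of preimages is needed: the preimage of a closed set under the factor map
  -- is the image under `f` of a compact set.
  rw [continuousOn_iff_isClosed]
  intro Z hZ
  refine ⟨f '' (Icc α β ∩ σ ⁻¹' Z), ?_, ?_⟩
  · have : IsCompact (Icc α β ∩ σ ⁻¹' Z) := isCompact_Icc.of_isClosed_subset
      (hσ.preimage_isClosed_of_isClosed isClosed_Icc hZ) inter_subset_left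
    exact (this.image_of_continuousOn (hf.mono inter_subset_left)).isClosed
  · ext v
    constructor
    · rintro ⟨h1, h2⟩
      exact ⟨⟨s v, ⟨hs v h2, h1⟩, hfs v h2⟩, h2⟩
    · rintro ⟨⟨t, ⟨ht, htZ⟩, rfl⟩, h2⟩
      refine ⟨?_, h2⟩
      change σ (s (f t)) ∈ Z
      rwa [hC t ht]

/-! ### Maximal curves do not leave the spacetime -/

namespace SpacetimeMetric

variable {n : ℕ} {M : Type*} [MetricSpace M] [Nonempty M]
  [ChartedSpace (EuclideanSpace ℝ (Fin n)) M] [IsManifold (𝓡 n) ∞ M] {g : SpacetimeMetric n M}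
  {Y : Type*} [MetricSpace Y] {S : CausalData Y} {ι : M → Y} {σ : ℝ → Y} {α β : ℝ}

/-- A maximal timelike curve cannot leave the image of a timelike geodesically complete spacetime. -/
lemma endpoints_mem_range (hM : C1CurvesLipschitz n M) (hsc : g.IsStronglyCausal)
    (hcomplete : g.IsTimelikeGeodesicallyComplete) (hS : S.IsLorentzianPreLengthSpace)
    (hι : Isometry ι)
    (hcausal : ∀ (γ : ℝ → M) (J : Set ℝ), g.causalData.IsCausalCurve γ J ↔ S.IsCausalCurve (ι ∘ γ) J)
    (hlen : ∀ (γ : ℝ → M) (a b : ℝ), a < b → g.causalData.IsCausalCurve γ (Icc a b) →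
      g.causalData.length γ a b = S.length (ι ∘ γ) a b)
    (hσ : S.IsMaximalCurve σ)
    (hf : ContinuousOn (fun s => (S.τ (σ 0) (σ s)).toReal) (Icc 0 1))
    (hstrict : ∀ s t, 0 ≤ s → s < t → t ≤ 1 → σ s ≠ σ t →
      (S.τ (σ 0) (σ s)).toReal < (S.τ (σ 0) (σ t)).toReal)
    (hα : 0 ≤ α) (hαβ : α < β) (hβ : β ≤ 1) (hne : σ α ≠ σ β) (hmaps : ∀ s ∈ Ioo α β, σ s ∈ range ι) :
    σ α ∈ range ι ∧ σ β ∈ range ι := by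
  set f : ℝ → ℝ := fun s => (S.τ (σ 0) (σ s)).toReal with hfd
  have hsub : Icc α β ⊆ Icc 0 1 := Icc_subset_Icc hα hβ
  have hmono : MonotoneOn f (Icc 0 1) := hσ.monotoneOn_tau hS
  have hlev : ∀ s ∈ Icc α β, ∀ t ∈ Icc α β, f s = f t → σ s = σ t := by
    intro s hs t ht hst
    by_contra hne
    rcases lt_trichotomy s t with h | h | h
    · exact (hstrict s t (hα.trans hs.1) h (ht.2.trans hβ) hne).ne hst
    · exact hne (by rw [h])
    · exact (hstrict t s (hα.trans ht.1) h (hs.2.trans hβ) (Ne.symm hne)).ne' hst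
  -- Parametrisation by time separation; `hstrict` guarantees that `σ` is constant on the level sets
  -- of `f`.
  obtain ⟨C, hC, hCf⟩ := exists_continuousOn_factor hαβ.le (hσ.isCausalCurve.continuousOn.mono hsub)
    (hf.mono hsub) (hmono.mono hsub) hlev
  have hfαβ : f α < f β := hstrict α β hα hαβ hβ hne
  -- every level in the interior is attained in the interior
  have hpar : ∀ v ∈ Ioo (f α) (f β), ∃ s ∈ Ioo α β, f s = v := by
    intro v hv
    obtain ⟨s, hs, rfl⟩ := intermediate_value_Icc hαβ.le (hf.mono hsub) ⟨hv.1.le, hv.2.le⟩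
    refine ⟨s, ⟨lt_of_le_of_ne hs.1 fun h => ?_, lt_of_le_of_ne hs.2 fun h => ?_⟩, rfl⟩
    · rw [← h] at hv
      exact hv.1.ne rfl
    · rw [h] at hv
      exact hv.2.ne rfl
  obtain ⟨j, hj⟩ : ∃ j : Y → M, ∀ y ∈ range ι, ι (j y) = y :=
    ⟨Function.invFun ι, fun y hy => Function.invFun_eq hy⟩
  have hjC : ∀ v ∈ Ioo (f α) (f β), ι (j (C v)) = C v := by
    intro v hv
    obtain ⟨s, hs, rfl⟩ := hpar v hv
    rw [hCf s (Ioo_subset_Icc_self hs)]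
    exact hj _ (hmaps s hs)
  have hjCc : ContinuousOn (fun v => j (C v)) (Ioo (f α) (f β)) := by
    rw [hι.isEmbedding.continuousOn_iff]
    exact (hC.mono Ioo_subset_Icc_self).congr hjC
  have hτ : ∀ v ∈ Ioo (f α) (f β), ∀ w ∈ Ioo (f α) (f β), v < w →
      g.causalData.τ (j (C v)) (j (C w)) = ENNReal.ofReal (w - v) := by
    intro v hv w hw hvw
    have hv' := hjC v hv
    have hw' := hjC w hw
    obtain ⟨s, hs, rfl⟩ := hpar v hv
    obtain ⟨t, ht, rfl⟩ := hpar w hw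
    have hst : s < t := by
      by_contra! hcon
      exact hvw.not_ge (hmono (hsub (Ioo_subset_Icc_self ht)) (hsub (Ioo_subset_Icc_self hs)) hcon)
    have hs0 := hα.trans hs.1.le
    have ht1 := ht.2.le.trans hβ
    rw [hCf s (Ioo_subset_Icc_self hs)] at hv' ⊢
    rw [hCf t (Ioo_subset_Icc_self ht)] at hw' ⊢
    have hτS : S.τ (σ s) (σ t) = ENNReal.ofReal (f t - f s) := by
      have := hσ.toReal_tau_add hS hs0 hst.le ht1
      rw [← ENNReal.ofReal_toReal (hσ.tau_ne_top hS hs0 hst.le ht1)]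
      congr 1
      simp only [hfd]
      linarith
    have hnest : σ s ≠ σ t := fun he => by
      have := congrArg (fun y => (S.τ (σ 0) y).toReal) he
      exact hvw.ne this
    refine le_antisymm ?_ ?_
    -- Upper bound: the extension does not decrease `τ`. For the lower bound, the pulled back piece
    -- of `σ` has the same length as `σ`, which is `f t - f s` by maximality.
    · refine (tau_le_of_lengths hM hlen _ _).trans (le_of_eq ?_)
      rw [hv', hw', hτS]
    · have heq : EqOn (ι ∘ fun r => j (σ r)) σ (Icc s t) := fun r hr =>
        hj _ (hmaps r ⟨hs.1.trans_le hr.1, hr.2.trans_lt ht.2⟩)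
      have hcS : S.IsCausalCurve (ι ∘ fun r => j (σ r)) (Icc s t) :=
        (hσ.isCausalCurve.mono (Icc_subset_Icc hs0 ht1) hst.le hnest).congr heq
      have hl := hlen _ s t hst ((hcausal _ _).2 hcS)
      rw [CausalData.length_congr heq, ← hσ.tau_eq_length hS hs0 hst.le ht1, hτS] at hl
      rw [← hl]
      exact CausalData.length_le_tau_of_le (γ := fun r => j (σ r)) hst.le
  obtain ⟨hgeo, hunit⟩ := isGeodesicOn_of_tau_eq (g := g) hjCc hsc hτ
  obtain ⟨η, hη, hηeq⟩ := hcomplete _ _ ordConnected_Ioo (nonempty_Ioo.2 hfαβ) hgeo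
    fun t ht => by rw [hunit t ht]; norm_num
  -- The extended geodesic and `C` agree on the open interval, hence by continuity at its end
  -- points, where `C` takes the values `σ α` and `σ β`.
  have hηc : Continuous fun v => ι (η v) :=
    hι.continuous.comp (continuousOn_univ.1 hη.2.1.continuousOn)
  have heq : ∀ v ∈ Icc (f α) (f β), ι (η v) = C v := by
    have h1 : EqOn (fun v => ι (η v)) C (Ioo (f α) (f β)) := fun v hv => by
      simp only [hηeq hv]
      exact hjC v hv
    have h2 := h1.of_subset_closure hηc.continuousOn hC Ioo_subset_Icc_self
      (by rw [closure_Ioo hfαβ.ne])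
    exact h2
  constructor
  · rw [← hCf α ⟨le_rfl, hαβ.le⟩]
    exact ⟨_, heq _ ⟨le_rfl, hfαβ.le⟩⟩
  · rw [← hCf β ⟨hαβ.le, le_rfl⟩]
    exact ⟨_, heq _ ⟨hfαβ.le, le_rfl⟩⟩

/-- If the causal curvature of the extension is bounded above, then a maximal curve of positive length
starts in the spacetime if and only if it ends in it. -/
lemma mem_range_iff_of_isMaximalCurve (hM : C1CurvesLipschitz n M) (hsc : g.IsStronglyCausal)
    (hcomplete : g.IsTimelikeGeodesicallyComplete) (hS : S.IsLorentzianLengthSpace)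
    (hι : Isometry ι) (hopen : IsOpen (range ι))
    (hcausal : ∀ (γ : ℝ → M) (J : Set ℝ), g.causalData.IsCausalCurve γ J ↔ S.IsCausalCurve (ι ∘ γ) J)
    (hlen : ∀ (γ : ℝ → M) (a b : ℝ), a < b → g.causalData.IsCausalCurve γ (Icc a b) →
      g.causalData.length γ a b = S.length (ι ∘ γ) a b) {K : ℝ} (hK : S.CausalCurvatureBoundedAbove K)
    (hσ : S.IsMaximalCurve σ) (hpos : 0 < S.τ (σ 0) (σ 1)) : σ 0 ∈ range ι ↔ σ 1 ∈ range ι := by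
  have hP := hS.isLorentzianPreLengthSpace
  obtain ⟨ε, hε, hT⟩ := exists_hasSmallTriangles_modelSpace K
  have key : ∀ α β, 0 ≤ α → α < β → β ≤ 1 → (∀ s ∈ Ioo α β, σ s ∈ range ι) → σ α ≠ σ β →
      σ α ∈ range ι ∧ σ β ∈ range ι := fun α β hα hαβ hβ hmaps hne =>
    endpoints_mem_range hM hsc hcomplete hP hι hcausal hlen hσ (hσ.continuousOn_tau hP hK)
      (fun s t hs hst ht hne => hσ.strict hS hK hT hε hpos hs hst ht hne) hα hαβ hβ hne hmaps
  -- Openness of the image makes the parameters outside it compact, so there is a first or a last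
  -- one. The piece up to it, respectively after it, is inside the image and `key` applies.
  have hA : IsCompact (Icc (0 : ℝ) 1 ∩ σ ⁻¹' (range ι)ᶜ) := isCompact_Icc.of_isClosed_subset
    (hσ.isCausalCurve.continuousOn.preimage_isClosed_of_isClosed isClosed_Icc hopen.isClosed_compl)
    inter_subset_left
  constructor
  · intro h0
    by_contra h1
    obtain ⟨s, hs, hmin⟩ := hA.exists_isLeast ⟨1, by simp, h1⟩
    have hs0 : 0 < s := lt_of_le_of_ne hs.1.1 fun h => hs.2 (h ▸ h0)
    refine hs.2 (key 0 s le_rfl hs0 hs.1.2 (fun t ht => ?_) fun he => hs.2 (he ▸ h0)).2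
    by_contra hcon
    exact (hmin ⟨⟨ht.1.le, ht.2.le.trans hs.1.2⟩, hcon⟩).not_gt ht.2
  · intro h1
    by_contra h0
    obtain ⟨s, hs, hmax⟩ := hA.exists_isGreatest ⟨0, by simp, h0⟩
    have hs1 : s < 1 := lt_of_le_of_ne hs.1.2 fun h => hs.2 (h ▸ h1)
    refine hs.2 (key s 1 hs.1.1 hs1 le_rfl (fun t ht => ?_) fun he => hs.2 (he ▸ h1)).1
    by_contra hcon
    exact (hmax ⟨⟨hs.1.1.trans ht.1.le, ht.2.le⟩, hcon⟩).not_gt ht.1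

/-- If the causal curvature of the extension is bounded above, then chronologically related points lie
both inside or both outside of the spacetime. -/
lemma mem_range_iff_of_ll (hM : C1CurvesLipschitz n M) (hsc : g.IsStronglyCausal)
    (hcomplete : g.IsTimelikeGeodesicallyComplete) (hS : S.IsLorentzianLengthSpace)
    (hι : Isometry ι) (hopen : IsOpen (range ι))
    (hcausal : ∀ (γ : ℝ → M) (J : Set ℝ), g.causalData.IsCausalCurve γ J ↔ S.IsCausalCurve (ι ∘ γ) J)
    (hlen : ∀ (γ : ℝ → M) (a b : ℝ), a < b → g.causalData.IsCausalCurve γ (Icc a b) →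
      g.causalData.length γ a b = S.length (ι ∘ γ) a b) {K : ℝ} (hK : S.CausalCurvatureBoundedAbove K)
    {x y : Y} (hxy : S.ll x y) : x ∈ range ι ↔ y ∈ range ι := by
  have hP := hS.isLorentzianPreLengthSpace
  have hloc : ∀ U, S.IsComparisonNhd K (fun s s' => s' ≤ s) U → ∀ p ∈ U, ∀ q ∈ U, S.ll p q →
      (p ∈ range ι ↔ q ∈ range ι) := by
    intro U hU p hp q hq hpq
    by_cases hne : p = q
    · rw [hne]
    obtain ⟨κ, ⟨hκ, h0, h1⟩, -, hl⟩ := hU.exists_maximal p hp q hq (hP.le_of_ll _ _ hpq) hne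
    have := mem_range_iff_of_isMaximalCurve hM hsc hcomplete hS hι hopen hcausal hlen hK
      (σ := κ) ⟨hκ, by rw [hl, h0, h1], by rw [h0, h1]; exact hU.finite p hp q hq⟩
      (by rw [h0, h1]; exact (hP.tau_pos_iff _ _).2 hpq)
    rwa [h0, h1] at this
  obtain ⟨κ, hκ, rfl, rfl⟩ := hS.isCausallyPathConnected.1 x y hxy
  -- Membership in the image is locally constant along the timelike curve by `hloc`, hence constant.
  refine isPreconnected_Icc.induction₂ (fun s t => κ s ∈ range ι ↔ κ t ∈ range ι) (fun s hs => ?_)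
    (fun _ _ _ _ _ _ h1 h2 => h1.trans h2) (fun _ _ _ _ h => h.symm)
    (show (0 : ℝ) ∈ Icc (0 : ℝ) 1 by simp) (show (1 : ℝ) ∈ Icc (0 : ℝ) 1 by simp)
  obtain ⟨U, hU, hcmp⟩ := hK (κ s)
  filter_upwards [hκ.locallyLipschitz.continuousOn s hs hU, self_mem_nhdsWithin] with t ht htI
  rcases lt_trichotomy s t with h | rfl | h
  · exact hloc U hcmp _ (mem_of_mem_nhds hU) _ ht (hκ.ll s hs t htI h)
  · rfl
  · exact (hloc U hcmp _ ht _ (mem_of_mem_nhds hU) (hκ.ll t htI s hs h)).symm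

end SpacetimeMetric

end

/-! ### The connectedness argument -/

theorem corollary5p6 {n : ℕ} {M : Type*} [MetricSpace M] [ConnectedSpace M]
    [ChartedSpace (EuclideanSpace ℝ (Fin n)) M] [IsManifold (𝓡 n) ∞ M]
    [Bundle.RiemannianBundle (fun x : M => TangentSpace (𝓡 n) x)]
    [IsContMDiffRiemannianBundle (𝓡 n) ∞ (EuclideanSpace ℝ (Fin n))
      (fun x : M => TangentSpace (𝓡 n) x)]
    [IsRiemannianManifold (𝓡 n) M]
    (g : SpacetimeMetric n M) (hsc : g.IsStronglyCausal)
    (hcomplete : g.IsTimelikeGeodesicallyComplete)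
    {Y : Type*} [MetricSpace Y] (S : CausalData Y) (hS : S.IsLorentzianLengthSpace)
    (hext : CausalData.IsExtension g.causalData S) :
    S.HasCausalCurvatureSingularity ∧ ∀ K : ℝ, ¬ S.CausalCurvatureBoundedAbove K := by
  have main : ∀ K : ℝ, ¬ S.CausalCurvatureBoundedAbove K := by
    intro K hK
    obtain ⟨hconn, ι, hι, hopen, hproper, -, -, -, hcausal, hlen⟩ := hext
    have hP := hS.isLorentzianPreLengthSpace
    have hiff : ∀ {x y}, S.ll x y → (x ∈ range ι ↔ y ∈ range ι) := fun h =>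
      SpacetimeMetric.mem_range_iff_of_ll SpacetimeMetric.c1CurvesLipschitz_of_isRiemannianManifold hsc
        hcomplete hS hι hopen hcausal hlen hK h
    -- A limit point `p` of the image has some `z` in its chronological past. The future of `z` is
    -- open by lower semicontinuity of `τ`, so it contains a point `q` of the image. Membership
    -- passes from `q` to `z` and on to `p`.
    have hclosed : IsClosed (range ι) := by
      refine isClosed_of_closure_subset fun p hp => ?_
      obtain ⟨Ω, hpΩ, hΩ⟩ := hS.isLocalisable p
      obtain ⟨z, -, hz⟩ := hΩ.nonempty_past p hpΩ
      have hlsc : LowerSemicontinuous fun y => S.τ z y :=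
        hP.lowerSemicontinuous.comp (g := fun y => (z, y)) (by fun_prop)
      obtain ⟨q, hq, hqι⟩ := mem_closure_iff_nhds.1 hp _
        ((hlsc.isOpen_preimage 0).mem_nhds ((hP.tau_pos_iff _ _).2 hz))
      exact (hiff hz).1 ((hiff ((hP.tau_pos_iff _ _).1 hq)).2 hqι)
    rcases isClopen_iff.1 ⟨hclosed, hopen⟩ with h | h
    · exact (range_nonempty ι).ne_empty h
    · exact hproper h
  exact ⟨Or.inr main, main⟩
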